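/- Consider the following single-server queue (a dam with upper level $L\in\mathbb N$), empty at time $0$. Batches of customers (units of water) arrive at the epochs of a Poisson process of rate $\lambda>0$; the batch sizes are i.i.d. copies of a positive integer random variable $\varsigma$ with $\mathsf{Pr}\{\varsigma=i\}=r_i$ $(i\ge 1)$ and $\mathsf{E}\varsigma<\infty$. Customers are served one at a time in order of arrival. If at the beginning of a service the number of customers in the system (including the one to be served) exceeds $L$, the service time has distribution $B_2$; otherwise it has distribution $B_1$. Here $B_1,B_2$ are probability distributions on $[0,\infty)$ with finite means, and inter-arrival times, batch sizes and service times are independent. Put $\rho_k=\lambda\,\mathsf{E}\varsigma\int_0^\infty x\,\mathrm dB_k(x)$ $(k=1,2)$, $\rho_{1,2}=\int_0^\infty(\lambda x)^2\,\mathrm dB_1(x)$, $\widehat B_1(s)=\int_0^\infty \mathrm e^{-sx}\,\mathrm dB_1(x)$, $\widehat R(z)=\sum_{i\ge1}r_iz^i$, and assume $\rho_2<1$. For every $L$ the limits $p_1(L)=\lim_{t\to\infty}\mathsf{Pr}\{\text{the system is empty at time }t\}$ and $p_2(L)=\lim_{t\to\infty}\mathsf{Pr}\{\text{at time }t\text{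 a service with distribution }B_2\text{ is in progress}\}$ exist, and, as $L\to\infty$ with $\lambda$, $(r_i)$, $B_1$, $B_2$ fixed: (i) If $\rho_1<1$, then $\lim_{L\to\infty}p_1(L)=1-\rho_1$ and $\lim_{L\to\infty}p_2(L)=0$. (ii) If $\rho_1=1$ and, additionally, $\rho_{1,2}<\infty$ and $\mathsf{E}\varsigma^2<\infty$, then $$\lim_{L\to\infty}Lp_1(L)=\frac{\rho_{1,2}(\mathsf{E}\varsigma)^3+\mathsf{E}\varsigma^2-\mathsf{E}\varsigma}{2\,\mathsf{E}\varsigma},\qquad \lim_{L\to\infty}Lp_2(L)=\frac{\rho_2}{1-\rho_2}\cdot\frac{\rho_{1,2}(\mathsf{E}\varsigma)^3+\mathsf{E}\varsigma^2-\mathsf{E}\varsigma}{2\,\mathsf{E}\varsigma}.$$ (iii) If $\rho_1>1$, then the equation $z=\widehat B_1(\lambda-\lambda\widehat R(z))$ has, among its roots in the closed unit disc $|z|\le1$, a unique root $\varphi$ that is least in absolute value; this $\varphi$ is real, and $$\lim_{L\to\infty}\frac{p_1(L)}{\varphi^L}=\frac{(1-\rho_2)\bigl[1+\lambda\widehat B_1'(\lambda-\lambda\widehat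 R(\varphi))\widehat R'(\varphi)\bigr](1-\varphi)\,\mathsf{E}\varsigma}{(\rho_1-\rho_2)\bigl[1-\widehat R(\varphi)\bigr]},\qquad \lim_{L\to\infty}p_2(L)=\frac{\rho_2(\rho_1-1)}{\rho_1-\rho_2}.$$ -/

import Mathlib

open MeasureTheory ProbabilityTheory Filter Topology

noncomputable section

namespace Dam

/-! ### The random input -/

/-- Sample space: the first component lists the pairs (inter-arrival time, batch size) of the
successive batches, the second one lists, for each customer (unit of water) in the order of
service, the pair (length of its service if it is of type 1, length if it is of type 2). -/
abbrev Sample : Type := (ℕ → ℝ × ℕ) × (ℕ → ℝ × ℝ)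

/-- All inter-arrival times (exponential with parameter `lam`), batch sizes (law `r`), service
times of type 1 (law `B₁`) and service times of type 2 (law `B₂`) are independent. -/
def law (lam : ℝ) (r : PMF ℕ) (B₁ B₂ : Measure ℝ) : Measure Sample :=
  (Measure.infinitePi fun _ : ℕ => (expMeasure lam).prod r.toMeasure).prod
    (Measure.infinitePi fun _ : ℕ => B₁.prod B₂)

/-! ### The path of the queue, which is empty at time `0` -/

/-- Arrival time of the `k`-th batch (`k = 0, 1, …`). -/
def batchTime (ω : Sample) (k : ℕ) : ℝ := ∑ i ∈ Finset.range (k + 1), (ω.1 i).1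

/-- The batch to which the `n`-th customer belongs (customers are numbered `0, 1, …`). -/
def batchOf (ω : Sample) (n : ℕ) : ℕ :=
  sInf {k | n < ∑ i ∈ Finset.range (k + 1), (ω.1 i).2}

/-- Arrival time of the `n`-th customer. -/
def arrival (ω : Sample) (n : ℕ) : ℝ := batchTime ω (batchOf ω n)

/-- The number of customers in the system at time `s` (the arrivals at `s` included), when exactly
the customers `0, …, n - 1` have left. -/
def queueFrom (ω : Sample) (n : ℕ) (s : ℝ) : ℕ∞ := {m | n ≤ m ∧ arrival ω m ≤ s}.encard

open Classical in
/-- The time from which the server is free for the `n`-th customer: the customers are served one by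
one in the order of arrival; a service has type 2 if the number of customers in the system at its
beginning exceeds `L`, and type 1 otherwise. -/
def freeTime (L : ℕ) (ω : Sample) : ℕ → ℝ
  | 0 => 0
  | n + 1 =>
    max (freeTime L ω n) (arrival ω n) +
      if (L : ℕ∞) < queueFrom ω n (max (freeTime L ω n) (arrival ω n))
      then (ω.2 n).2 else (ω.2 n).1

/-- Beginning of the service of the `n`-th customer. -/
def serviceStart (L : ℕ) (ω : Sample) (n : ℕ) : ℝ := max (freeTime L ω n) (arrival ω n)

/-- Departure of the `n`-th customer. -/
def departure (L : ℕ) (ω : Sample) (n : ℕ) : ℝ := freeTime L ω (n + 1)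

/-- The queue length (water level) at time `t`: the number of customers that have arrived
but not departed. -/
def level (L : ℕ) (ω : Sample) (t : ℝ) : ℕ∞ :=
  {n | arrival ω n ≤ t ∧ t < departure L ω n}.encard

/-- At time `t` a service of type 2 is in progress. -/
def ServesType2 (L : ℕ) (ω : Sample) (t : ℝ) : Prop :=
  ∃ n, serviceStart L ω n ≤ t ∧ t < departure L ω n ∧
    (L : ℕ∞) < queueFrom ω n (serviceStart L ω n)

/-- The probability that the system is empty at time `t`. -/
def probEmpty (lam : ℝ) (r : PMF ℕ) (B₁ B₂ : Measure ℝ) (L : ℕ) (t : ℝ) : ℝ :=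
  (law lam r B₁ B₂).real {ω | level L ω t = 0}

/-- The probability that a service of type 2 is in progress at time `t`. -/
def probType2 (lam : ℝ) (r : PMF ℕ) (B₁ B₂ : Measure ℝ) (L : ℕ) (t : ℝ) : ℝ :=
  (law lam r B₁ B₂).real {ω | ServesType2 L ω t}

/-! ### Parameters and transforms -/

/-- The `l`-th moment of the batch size. -/
def batchMoment (r : PMF ℕ) (l : ℕ) : ℝ := ∑' i : ℕ, (r i).toReal * (i : ℝ) ^ l

/-- The load: the expected number of customers arriving during a service with law `B`. -/
def load (lam : ℝ) (r : PMF ℕ) (B : Measure ℝ) : ℝ := lam * batchMoment r 1 * ∫ x, x ∂B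

/-- The Laplace–Stieltjes transform. -/
def lst (B : Measure ℝ) (s : ℝ) : ℝ := ∫ x, Real.exp (-s * x) ∂B

/-- The Laplace–Stieltjes transform with a complex argument. -/
def lstC (B : Measure ℝ) (s : ℂ) : ℂ := ∫ x, Complex.exp (-s * x) ∂B

/-- The generating function of the batch size. -/
def pgf (r : PMF ℕ) (z : ℝ) : ℝ := ∑' i : ℕ, (r i).toReal * z ^ i

/-- The generating function of the batch size with a complex argument. -/
def pgfC (r : PMF ℕ) (z : ℂ) : ℂ := ∑' i : ℕ, ((r i).toReal : ℂ) * z ^ i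

/-- `z` is a root of `z = F z` in the closed unit disc. -/
def IsDiscRoot (F : ℂ → ℂ) (z : ℂ) : Prop := ‖z‖ ≤ 1 ∧ z = F z

/-- `φ` is the root of `z = F z` in the closed unit disc that is least in absolute value. -/
def IsLeastRoot (F : ℂ → ℂ) (φ : ℂ) : Prop :=
  IsDiscRoot F φ ∧ ∀ z, IsDiscRoot F z → z ≠ φ → ‖φ‖ < ‖z‖

end Dam

end

open scoped ENNReal

noncomputable section

namespace Dam

/-! During a busy period the queue length just after departures is a walk on `ℕ` that goes down by
at most one per step. Its increments are governed by the laws `p₁`, `p₂` (`inputLaw`) of the number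
of customers arriving during a service; these have means `ρ₁`, `ρ₂`. Let `V` (`lowVisits`) and `W`
be the expected numbers of services of type 1 and 2 in a busy period, `b₁`, `b₂` the mean service
times and `E` the mean batch size.

Idle periods have mean `1 / lam`, so regeneration gives the empty probability `1 / (1 + lam (b₁ V +
b₂ W))`, and the type 2 probability is this number times `lam b₂ W`. Balancing the drift over a busy
period gives `E = (1 - ρ₁) V + (1 - ρ₂) W` (`toReal_lintegral_highCost`). Everything is thus a
function of `V` alone (`tendsto_prob`), and the theorem reduces to the growth of `V` in `L`.

Since the walk cannot skip levels downwards, it descends unit by unit (`cost_eq_sum_stepCost`). The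
expected number `T m` of low steps in a unit descent at distance `m` below the threshold solves the
renewal equation `T m = 1 + ∑ i ≤ m, T (m - i) p₁(> i)` (`lowDescent_eq`). If `ρ₁ < 1`, then `T`
converges to `1 / (1 - ρ₁)` (`renewal_tendsto`). If `ρ₁ = 1`, it grows like `m / μ`, with `μ` half
the second factorial moment of `p₁` (`renewal_tendsto_critical`). If `ρ₁ > 1`, weighting the masses
by `φ ^ (j - 1)`, with `φ` the least root, gives a probability law of mean below one, and `φ ^ (m +
1) T m` converges (`renewal_tendsto_tilt`).

The limits in `t` come from a renewal equation for the idle probability `e`, namely `e + e * w = 1`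
with convolution `*`, where `w v` is `lam` times the probability that the busy period of a batch
lasts beyond `v` (`batchBusy`). This kernel is integrable and nonincreasing, which permits an
elementary renewal theorem (`volterra_tendsto`). The equation is derived from the paths by
conditioning on the first service and on the first batch (`servProb_succ`, `servProb_empty`),
together with uniqueness of bounded solutions (`eq_zero_of_subsolution`, `renewal_representation`).
-/

/-! ### Expected costs of a skip-free walk until it reaches `0` -/

/-- Expected cost of the first `n` steps of the walk on `ℕ` killed at `0` which moves from `k + 1` to
`k + j`, where `j` has law `p₂` if `L < k + 1` and `p₁` otherwise; a step costs `β`, respectively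
`α`. -/
def costIter (p₁ p₂ : Measure ℕ) (α β : ℝ≥0∞) (L : ℕ) : ℕ → ℕ → ℝ≥0∞
  | 0, _ => 0
  | _ + 1, 0 => 0
  | n + 1, k + 1 => (if L < k + 1 then β else α) +
      ∫⁻ j, costIter p₁ p₂ α β L n (k + j) ∂(if L < k + 1 then p₂ else p₁)

/-- Expected total cost until the walk reaches `0`. -/
def cost (p₁ p₂ : Measure ℕ) (α β : ℝ≥0∞) (L k : ℕ) : ℝ≥0∞ := ⨆ n, costIter p₁ p₂ α β L n k

/-- Probability that the walk started at `k` has not reached `0` within `n` steps. -/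
def survive (p₁ p₂ : Measure ℕ) (L : ℕ) : ℕ → ℕ → ℝ≥0∞
  | 0, 0 => 0
  | 0, _ + 1 => 1
  | _ + 1, 0 => 0
  | n + 1, k + 1 => ∫⁻ j, survive p₁ p₂ L n (k + j) ∂(if L < k + 1 then p₂ else p₁)

section Walk

variable {p₁ p₂ : Measure ℕ} {α β : ℝ≥0∞} {L : ℕ}

@[simp] lemma costIter_at_zero (n : ℕ) : costIter p₁ p₂ α β L n 0 = 0 := by
  cases n <;> rfl

@[simp] lemma survive_at_zero (n : ℕ) : survive p₁ p₂ L n 0 = 0 := by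
  cases n <;> rfl

lemma costIter_le_succ (n k : ℕ) :
    costIter p₁ p₂ α β L n k ≤ costIter p₁ p₂ α β L (n + 1) k := by
  induction n generalizing k with
  | zero => exact zero_le
  | succ n ih =>
    cases k with
    | zero => simp
    | succ k =>
      simp only [costIter]
      exact add_le_add le_rfl (lintegral_mono fun j => ih _)

lemma costIter_mono : Monotone (costIter p₁ p₂ α β L) :=
  monotone_nat_of_le_succ fun n k => costIter_le_succ n k

lemma costIter_le_cost (n k : ℕ) : costIter p₁ p₂ α β L n k ≤ cost p₁ p₂ α β L k :=
  le_iSup (fun n => costIter p₁ p₂ α β L n k) n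

@[simp] lemma cost_at_zero : cost p₁ p₂ α β L 0 = 0 := by simp [cost]

lemma cost_succ (k : ℕ) : cost p₁ p₂ α β L (k + 1) = (if L < k + 1 then β else α) +
    ∫⁻ j, cost p₁ p₂ α β L (k + j) ∂(if L < k + 1 then p₂ else p₁) := by
  have h : cost p₁ p₂ α β L (k + 1) = ⨆ n, costIter p₁ p₂ α β L (n + 1) (k + 1) :=
    le_antisymm (iSup_mono fun n => costIter_le_succ n _)
      (iSup_le fun n => costIter_le_cost _ _)
  rw [h]
  simp only [costIter, cost]
  rw [← ENNReal.add_iSup, lintegral_iSup (fun n => Measurable.of_discrete)]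
  intro m n hmn j
  exact costIter_mono hmn _

/-- `cost` is the least nonnegative solution of its one-step equation, so induction on the number of
steps suffices. Nothing is required of `v 0`, since the walk pays nothing there. -/
lemma cost_le_of_superharmonic {v : ℕ → ℝ≥0∞}
    (hv : ∀ k, (if L < k + 1 then β else α) +
      ∫⁻ j, v (k + j) ∂(if L < k + 1 then p₂ else p₁) ≤ v (k + 1)) (k : ℕ) :
    cost p₁ p₂ α β L k ≤ v k := by
  refine iSup_le fun n => ?_
  induction n generalizing k with
  | zero => exact zero_le
  | succ n ih =>
    cases k with
    | zero => simp
    | succ k => exact (add_le_add le_rfl (lintegral_mono fun j => ih _)).trans (hv k)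

lemma costIter_one_succ (n k : ℕ) : costIter p₁ p₂ 1 1 L (n + 1) k =
    costIter p₁ p₂ 1 1 L n k + survive p₁ p₂ L n k := by
  induction n generalizing k with
  | zero => cases k <;> simp [costIter, survive]
  | succ n ih =>
    cases k with
    | zero => simp
    | succ k =>
      rw [costIter]
      simp only [ih]
      rw [lintegral_add_left Measurable.of_discrete, ← add_assoc, ← ih]
      rfl

lemma costIter_one_eq_sum (n k : ℕ) : costIter p₁ p₂ 1 1 L n k =
    ∑ i ∈ Finset.range n, survive p₁ p₂ L i k := by
  induction n with
  | zero => simp [costIter]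
  | succ n ih => rw [costIter_one_succ, ih, Finset.sum_range_succ]

/-- With unit costs the expected lifetime is the sum of the survival probabilities, and the terms of
a convergent series vanish. -/
lemma tendsto_survive {k : ℕ} (h : cost p₁ p₂ 1 1 L k ≠ ⊤) :
    Tendsto (fun n => survive p₁ p₂ L n k) atTop (𝓝 0) := by
  apply ENNReal.tendsto_atTop_zero_of_tsum_ne_top
  rw [ENNReal.tsum_eq_iSup_nat]
  simpa only [cost, costIter_one_eq_sum] using h

/-- A bounded subharmonic function of a recurrent walk is maximal at `0`. -/
lemma le_zero_of_subharmonic [IsProbabilityMeasure p₁] [IsProbabilityMeasure p₂]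
    {v : ℕ → ℝ≥0∞} {C : ℝ≥0∞} (hC : C ≠ ⊤) (hvC : ∀ k, v k ≤ C)
    (hv : ∀ k, v (k + 1) ≤ ∫⁻ j, v (k + j) ∂(if L < k + 1 then p₂ else p₁))
    (hfin : ∀ k, cost p₁ p₂ 1 1 L k ≠ ⊤) (k : ℕ) : v k ≤ v 0 := by
  -- After `n` steps the walk has either been absorbed, contributing `v 0`, or is still alive,
  -- contributing at most `C`.
  have key : ∀ n k, v k ≤ v 0 + C * survive p₁ p₂ L n k := by
    intro n
    induction n with
    | zero =>
      intro k
      cases k with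
      | zero => simp
      | succ k => simpa [survive] using (hvC (k + 1)).trans le_add_self
    | succ n ih =>
      intro k
      cases k with
      | zero => simp
      | succ k =>
        refine (hv k).trans ((lintegral_mono fun j => ih (k + j)).trans ?_)
        rw [lintegral_add_left measurable_const, lintegral_const_mul _ Measurable.of_discrete]
        have : IsProbabilityMeasure (if L < k + 1 then p₂ else p₁) := by split_ifs <;> infer_instance
        simp [survive]
  have h2 : Tendsto (fun n => v 0 + C * survive p₁ p₂ L n k) atTop (𝓝 (v 0 + C * 0)) :=
    tendsto_const_nhds.add (ENNReal.Tendsto.const_mul (tendsto_survive (hfin k)) (Or.inr hC))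
  simpa using ge_of_tendsto' h2 fun n => key n k

/-- Going down by at most one per step, the walk must visit `l` on its way from `i + l` to `0`.
Until then it is a copy of the walk from `i` with threshold `L`; what remains of the `n` steps is
bounded by a full `n`-step run from `l`. -/
lemma costIter_shift_le [IsProbabilityMeasure p₁] [IsProbabilityMeasure p₂] (l n i : ℕ) :
    costIter p₁ p₂ α β (L + l) n (i + l) ≤
      costIter p₁ p₂ α β L n i + costIter p₁ p₂ α β (L + l) n l := by
  induction n generalizing i with
  | zero => simp [costIter]
  | succ n ih =>
    cases i with
    | zero => simp
    | succ i =>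
      have e : i + 1 + l = (i + l) + 1 := by ring
      rw [e, costIter, costIter]
      have e2 : (L + l < i + l + 1) = (L < i + 1) := by simp
      simp only [e2]
      rw [add_assoc]
      refine add_le_add le_rfl ?_
      have : IsProbabilityMeasure (if L < i + 1 then p₂ else p₁) := by split_ifs <;> infer_instance
      calc _ ≤ ∫⁻ j, (costIter p₁ p₂ α β L n (i + j) + costIter p₁ p₂ α β (L + l) (n + 1) l)
              ∂(if L < i + 1 then p₂ else p₁) := by
            refine lintegral_mono fun j => ?_
            have := ih (i + j)
            rw [show i + j + l = i + l + j by ring] at this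
            exact this.trans (add_le_add le_rfl (costIter_le_succ _ _))
        _ = _ := by
          rw [lintegral_add_right _ measurable_const]
          simp

lemma cost_shift_le [IsProbabilityMeasure p₁] [IsProbabilityMeasure p₂] (l i : ℕ) :
    cost p₁ p₂ α β (L + l) (i + l) ≤ cost p₁ p₂ α β L i + cost p₁ p₂ α β (L + l) l :=
  iSup_le fun n => (costIter_shift_le l n i).trans
    (add_le_add (costIter_le_cost _ _) (costIter_le_cost _ _))

/-- To reach `0` from `i + l`, the walk first has to reach `l`. -/
lemma cost_shift [IsProbabilityMeasure p₁] [IsProbabilityMeasure p₂] {l : ℕ}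
    (h1 : ∀ k, cost p₁ p₂ 1 1 L k ≠ ⊤) (h2 : cost p₁ p₂ α β (L + l) l ≠ ⊤) (i : ℕ) :
    cost p₁ p₂ α β (L + l) (i + l) = cost p₁ p₂ α β L i + cost p₁ p₂ α β (L + l) l := by
  refine le_antisymm (cost_shift_le l i) ?_
  set c := cost p₁ p₂ α β (L + l) l with hc
  -- The reverse inequality with an error: the cost `c` of the last part is lost on the event that
  -- `l` has not been reached within `n` steps. The finite expected lifetime makes its probability
  -- vanish.
  have key : ∀ n i, costIter p₁ p₂ α β L n i + c ≤
      cost p₁ p₂ α β (L + l) (i + l) + c * survive p₁ p₂ L n i := by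
    intro n
    induction n with
    | zero =>
      intro i
      cases i with
      | zero => simp [costIter, hc]
      | succ i => simp [costIter, survive]
    | succ n ih =>
      intro i
      cases i with
      | zero => simp [hc]
      | succ i =>
        have e : i + 1 + l = (i + l) + 1 := by ring
        rw [e, cost_succ]
        simp only [costIter, survive]
        have e2 : (L + l < i + l + 1) = (L < i + 1) := by simp
        simp only [e2]
        have : IsProbabilityMeasure (if L < i + 1 then p₂ else p₁) := by
          split_ifs <;> infer_instance
        rw [add_assoc, add_assoc]
        refine add_le_add le_rfl ?_
        have h3 := lintegral_mono (μ := if L < i + 1 then p₂ else p₁) fun j => ih (i + j)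
        rw [lintegral_add_right _ measurable_const,
          lintegral_add_left Measurable.of_discrete,
          lintegral_const_mul _ Measurable.of_discrete] at h3
        simp only [lintegral_const, measure_univ, mul_one] at h3
        simpa only [Nat.add_right_comm i l] using h3
  have h3 : Tendsto (fun n => costIter p₁ p₂ α β L n i + c) atTop
      (𝓝 (cost p₁ p₂ α β L i + c)) :=
    (tendsto_atTop_iSup fun m n h => costIter_mono h i).add tendsto_const_nhds
  have h4 : Tendsto (fun n => cost p₁ p₂ α β (L + l) (i + l) + c * survive p₁ p₂ L n i) atTop
      (𝓝 (cost p₁ p₂ α β (L + l) (i + l) + c * 0)) :=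
    tendsto_const_nhds.add (ENNReal.Tendsto.const_mul (tendsto_survive (h1 i)) (Or.inr h2))
  simpa using le_of_tendsto_of_tendsto' h3 h4 fun n => key n i

/-- A linear Lyapunov function. Above the threshold the drift is negative, which settles `L = 0`.
Raising the threshold by one adds a single low level at the bottom, whose cost is controlled by
repeated attempts to jump from `1` to `0`. -/
lemma exists_cost_le_mul [IsProbabilityMeasure p₁] [IsProbabilityMeasure p₂]
    (hα : α ≠ ⊤) (hβ : β ≠ ⊤) (h0 : p₁ {0} ≠ 0) (hm₁ : ∫⁻ j, (j : ℝ≥0∞) ∂p₁ ≠ ⊤)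
    (hm₂ : ∫⁻ j, (j : ℝ≥0∞) ∂p₂ < 1) (L : ℕ) :
    ∃ C : ℝ≥0∞, C ≠ ⊤ ∧ ∀ k : ℕ, cost p₁ p₂ α β L k ≤ C * k := by
  induction L with
  | zero =>
    have hd : 1 - ∫⁻ j, (j : ℝ≥0∞) ∂p₂ ≠ 0 := (tsub_pos_of_lt hm₂).ne'
    -- The slope solves `C = β + C * m`, where `m` is the mean of `p₂`.
    refine ⟨β / (1 - ∫⁻ j, (j : ℝ≥0∞) ∂p₂), ENNReal.div_ne_top hβ hd, fun k => ?_⟩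
    refine cost_le_of_superharmonic (v := fun k => β / (1 - ∫⁻ j, (j : ℝ≥0∞) ∂p₂) * k)
      (fun k => ?_) k
    simp only [Nat.zero_lt_succ, if_true, Nat.cast_add]
    set m := ∫⁻ j, (j : ℝ≥0∞) ∂p₂ with hm
    rw [lintegral_const_mul _ Measurable.of_discrete, lintegral_add_left measurable_const, ← hm]
    simp only [lintegral_const, measure_univ, mul_one, Nat.cast_one]
    have e : β = β / (1 - m) * (1 - m) :=
      (ENNReal.div_mul_cancel hd (by finiteness)).symm
    calc β + β / (1 - m) * (k + m) = β / (1 - m) * (1 - m) + β / (1 - m) * (k + m) := by rw [← e]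
      _ = β / (1 - m) * (k + ((1 - m) + m)) := by ring
      _ ≤ _ := by rw [tsub_add_cancel_of_le hm₂.le]
  | succ m ih =>
    obtain ⟨C, hC, hCk⟩ := ih
    set A := α + C * ∫⁻ j, (j : ℝ≥0∞) ∂p₁ with hA
    have hAtop : A ≠ ⊤ := by finiteness
    have hle1 : p₁ {0} ≤ 1 := prob_le_one
    -- `A` bounds the cost of one step from `1` and of the return to `1`; each attempt succeeds with
    -- probability `p₁ {0}`, so `D` solves `D = A + D * (1 - p₁ {0})`.
    set D := A / p₁ {0} with hD
    have hDtop : D ≠ ⊤ := ENNReal.div_ne_top hAtop h0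
    have h1 : cost p₁ p₂ α β (m + 1) 1 ≤ D := by
      refine iSup_le fun n => ?_
      induction n with
      | zero => exact zero_le
      | succ n ihn =>
        have hb : ∀ j, costIter p₁ p₂ α β (m + 1) n (0 + j) ≤
            C * j + D * ({0}ᶜ : Set ℕ).indicator 1 j := by
          intro j
          cases j with
          | zero => simp
          | succ j =>
            have h3 := costIter_shift_le (p₁ := p₁) (p₂ := p₂) (α := α) (β := β) (L := m) 1 n j
            rw [zero_add]
            refine h3.trans ?_
            simp only [Set.mem_compl_iff, Set.mem_singleton_iff, Nat.succ_ne_zero,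
              not_false_eq_true, Set.indicator_of_mem, Pi.one_apply, mul_one]
            refine add_le_add ?_ ihn
            refine (costIter_le_cost _ _).trans ((hCk j).trans ?_)
            gcongr
            simp
        have h4 : costIter p₁ p₂ α β (m + 1) (n + 1) 1 ≤ A + D * p₁ {0}ᶜ := by
          have : costIter p₁ p₂ α β (m + 1) (n + 1) 1 =
            α + ∫⁻ j, costIter p₁ p₂ α β (m + 1) n (0 + j) ∂p₁ := by simp [costIter]
          rw [this, hA, add_assoc]
          refine add_le_add le_rfl ((lintegral_mono hb).trans (le_of_eq ?_))
          rw [lintegral_add_left Measurable.of_discrete, lintegral_const_mul _ Measurable.of_discrete,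
            lintegral_const_mul _ Measurable.of_discrete,
            lintegral_indicator_one (MeasurableSet.of_discrete)]
        refine h4.trans (le_of_eq ?_)
        have e : A = D * p₁ {0} := (ENNReal.div_mul_cancel h0 (by finiteness)).symm
        rw [e, ← mul_add, measure_add_measure_compl (MeasurableSet.singleton 0), measure_univ,
          mul_one]
    refine ⟨C + D, by finiteness, fun k => ?_⟩
    cases k with
    | zero => simp
    | succ k =>
      refine (cost_shift_le (L := m) 1 k).trans ?_
      calc _ ≤ C * k + D := add_le_add (hCk k) h1
        _ ≤ (C + D) * ((k : ℝ≥0∞) + 1) := by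
          rw [add_mul, mul_add, mul_add]
          simp only [mul_one]
          calc C * k + D ≤ (C * k + D) + (C + D * k) := le_self_add
            _ = _ := by ring
        _ = _ := by simp

end Walk

/-! ### Decomposition of the cost into unit descents -/

section Descent

/-- Tonelli: the `i`-th summand is counted exactly when `i < j`. -/
lemma lintegral_sum_range (p : Measure ℕ) (d : ℕ → ℝ≥0∞) :
    ∫⁻ j, ∑ i ∈ Finset.range j, d i ∂p = ∑' i, d i * p (Set.Ioi i) := by
  have h : ∀ j : ℕ, ∑ i ∈ Finset.range j, d i = ∑' i, (Set.Ioi i).indicator (fun _ => d i) j := by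
    intro j
    rw [tsum_eq_sum (s := Finset.range j)]
    · refine Finset.sum_congr rfl fun i hi => ?_
      rw [Set.indicator_of_mem (by simpa using hi)]
    · intro i hi
      rw [Set.indicator_of_notMem (by simpa using hi)]
  simp_rw [h]
  rw [lintegral_tsum fun i => Measurable.of_discrete.aemeasurable]
  refine tsum_congr fun i => ?_
  rw [lintegral_indicator_const MeasurableSet.of_discrete]

lemma lintegral_natCast (p : Measure ℕ) : ∫⁻ j, (j : ℝ≥0∞) ∂p = ∑' i, p (Set.Ioi i) := by
  simpa using lintegral_sum_range p (fun _ => 1)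

lemma real_Ioi_zero (p : Measure ℕ) [IsProbabilityMeasure p] :
    p.real (Set.Ioi 0) = 1 - p.real {0} := by
  rw [← probReal_compl_eq_one_sub (MeasurableSet.singleton 0)]
  congr 1
  ext x
  simp [Nat.pos_iff_ne_zero]

lemma real_Ioi_sub (p : Measure ℕ) [IsFiniteMeasure p] (i : ℕ) :
    p.real (Set.Ioi i) - p.real (Set.Ioi (i + 1)) = p.real {i + 1} := by
  have h : Set.Ioi i = {i + 1} ∪ Set.Ioi (i + 1) := by
    ext x
    simp
  rw [h, measureReal_union (by simp) MeasurableSet.of_discrete]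
  ring

lemma real_Ioi_zero_lt_one {p : Measure ℕ} [IsProbabilityMeasure p] (h0 : p {0} ≠ 0) :
    p.real (Set.Ioi 0) < 1 := by
  have h3 : 0 < p.real {0} := lt_of_le_of_ne measureReal_nonneg ((measureReal_ne_zero_iff).2 h0).symm
  rw [real_Ioi_zero]
  linarith

variable {p₁ p₂ : Measure ℕ} {α β : ℝ≥0∞} {L : ℕ}

/-- Expected cost of the descent of the walk by one unit from the level at distance `m` below the
threshold. -/
def descent (p₁ p₂ : Measure ℕ) (α β : ℝ≥0∞) (m : ℕ) : ℝ≥0∞ := cost p₁ p₂ α β (m + 1) 1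

/-- Expected cost of the descent from `i + 1` to `i`. -/
def stepCost (p₁ p₂ : Measure ℕ) (α β : ℝ≥0∞) (L i : ℕ) : ℝ≥0∞ :=
  if i < L then descent p₁ p₂ α β (L - 1 - i) else cost p₁ p₂ α β 0 1

/-- With threshold `0` the low law and the low cost are never used and may be replaced by the high
ones, after which the threshold is arbitrary. This brings threshold `0` into the form `L + l` that
`cost_shift` needs. -/
lemma cost_threshold_zero (L k : ℕ) : cost p₁ p₂ α β 0 k = cost p₂ p₂ β β L k := by
  unfold cost
  congr 1
  ext n
  induction n generalizing k with
  | zero => rfl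
  | succ n ih =>
    cases k with
    | zero => rfl
    | succ k => simp [costIter, ih]

lemma costIter_linear (n k : ℕ) : costIter p₁ p₂ α β L n k =
    α * costIter p₁ p₂ 1 0 L n k + β * costIter p₁ p₂ 0 1 L n k := by
  induction n generalizing k with
  | zero => simp [costIter]
  | succ n ih =>
    cases k with
    | zero => simp
    | succ k =>
      simp only [costIter, ih]
      rw [lintegral_add_left Measurable.of_discrete, lintegral_const_mul _ Measurable.of_discrete,
        lintegral_const_mul _ Measurable.of_discrete]
      split_ifs <;> ring

lemma cost_linear (k : ℕ) : cost p₁ p₂ α β L k =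
    α * cost p₁ p₂ 1 0 L k + β * cost p₁ p₂ 0 1 L k := by
  unfold cost
  simp_rw [costIter_linear (α := α) (β := β), ENNReal.mul_iSup]
  rw [ENNReal.iSup_add_iSup_of_monotone]
  · intro m n h
    exact mul_le_mul_right (costIter_mono h k) _
  · intro m n h
    exact mul_le_mul_right (costIter_mono h k) _

variable [IsProbabilityMeasure p₁] [IsProbabilityMeasure p₂]

lemma cost_ne_top (h0 : p₁ {0} ≠ 0) (hm₁ : ∫⁻ j, (j : ℝ≥0∞) ∂p₁ ≠ ⊤)
    (hm₂ : ∫⁻ j, (j : ℝ≥0∞) ∂p₂ < 1) (hα : α ≠ ⊤) (hβ : β ≠ ⊤) (L k : ℕ) :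
    cost p₁ p₂ α β L k ≠ ⊤ := by
  obtain ⟨C, hC, hCk⟩ := exists_cost_le_mul hα hβ h0 hm₁ hm₂ L
  exact ne_top_of_le_ne_top (by finiteness) (hCk k)

/-- The walk from `k` passes through every lower level, and the descent from `i + 1` to `i` is a
copy of that from `1` to `0` with the threshold lowered by `i`. The induction peels off the last
descent, using `cost_shift` with `l = 1`. -/
lemma cost_eq_sum_stepCost (h0 : p₁ {0} ≠ 0) (hm₁ : ∫⁻ j, (j : ℝ≥0∞) ∂p₁ ≠ ⊤)
    (hm₂ : ∫⁻ j, (j : ℝ≥0∞) ∂p₂ < 1) (hα : α ≠ ⊤) (hβ : β ≠ ⊤) (L k : ℕ) :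
    cost p₁ p₂ α β L k = ∑ i ∈ Finset.range k, stepCost p₁ p₂ α β L i := by
  have hfin : ∀ {a b : ℝ≥0∞} (_ : a ≠ ⊤) (_ : b ≠ ⊤) (L k : ℕ), cost p₁ p₂ a b L k ≠ ⊤ :=
    fun ha hb => cost_ne_top h0 hm₁ hm₂ ha hb
  have h1 := hfin ENNReal.one_ne_top ENNReal.one_ne_top
  induction k generalizing L with
  | zero => simp
  | succ k ih =>
    rw [Finset.sum_range_succ']
    cases L with
    | zero =>
      rw [cost_threshold_zero (0 + 1), cost_shift (L := 0)]
      · rw [← cost_threshold_zero (p₁ := p₁) (α := α), ← cost_threshold_zero (p₁ := p₁) (α := α),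
          ih 0]
        simp [stepCost]
      · intro k
        rw [← cost_threshold_zero (p₁ := p₁) (α := 1)]
        exact h1 0 k
      · rw [← cost_threshold_zero (p₁ := p₁) (α := α)]
        exact hfin hα hβ 0 1
    | succ m =>
      rw [cost_shift (h1 m) (hfin hα hβ _ _), ih m]
      have e : ∀ i, stepCost p₁ p₂ α β (m + 1) (i + 1) = stepCost p₁ p₂ α β m i := fun i => by
        simp only [stepCost, Nat.add_lt_add_iff_right, show m + 1 - 1 - (i + 1) = m - 1 - i by omega]
      simp only [e]
      simp [stepCost, descent]

lemma lintegral_cost (h0 : p₁ {0} ≠ 0) (hm₁ : ∫⁻ j, (j : ℝ≥0∞) ∂p₁ ≠ ⊤)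
    (hm₂ : ∫⁻ j, (j : ℝ≥0∞) ∂p₂ < 1) (hα : α ≠ ⊤) (hβ : β ≠ ⊤) (L : ℕ) (q : Measure ℕ) :
    ∫⁻ j, cost p₁ p₂ α β L j ∂q = ∑ i ∈ Finset.range L, descent p₁ p₂ α β (L - 1 - i) *
      q (Set.Ioi i) + cost p₁ p₂ α β 0 1 * ∑' i, q (Set.Ioi (i + L)) := by
  simp_rw [cost_eq_sum_stepCost h0 hm₁ hm₂ hα hβ]
  rw [lintegral_sum_range, ← Summable.sum_add_tsum_nat_add' (k := L) ENNReal.summable,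
    ← ENNReal.tsum_mul_left]
  congr 1
  · refine Finset.sum_congr rfl fun i hi => ?_
    rw [stepCost, if_pos (by simpa using hi)]
  · simp [stepCost]

lemma cost_zero_one (h0 : p₁ {0} ≠ 0) (hm₁ : ∫⁻ j, (j : ℝ≥0∞) ∂p₁ ≠ ⊤)
    (hm₂ : ∫⁻ j, (j : ℝ≥0∞) ∂p₂ < 1) (hα : α ≠ ⊤) (hβ : β ≠ ⊤) :
    cost p₁ p₂ α β 0 1 = β + cost p₁ p₂ α β 0 1 * ∫⁻ j, (j : ℝ≥0∞) ∂p₂ := by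
  conv_lhs => rw [show (1 : ℕ) = 0 + 1 from rfl, cost_succ]
  simp only [zero_add, zero_lt_one, if_true]
  rw [lintegral_cost h0 hm₁ hm₂ hα hβ, lintegral_natCast]
  simp

/-- The one-step equation exhibits this finite number as its own multiple by a mean below one. -/
lemma cost_zero_one_low (h0 : p₁ {0} ≠ 0) (hm₁ : ∫⁻ j, (j : ℝ≥0∞) ∂p₁ ≠ ⊤)
    (hm₂ : ∫⁻ j, (j : ℝ≥0∞) ∂p₂ < 1) : cost p₁ p₂ 1 0 0 1 = 0 := by
  have h1 := cost_zero_one h0 hm₁ hm₂ ENNReal.one_ne_top ENNReal.zero_ne_top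
  by_contra hne
  have h2 : cost p₁ p₂ 1 0 0 1 * ∫⁻ j, (j : ℝ≥0∞) ∂p₂ < cost p₁ p₂ 1 0 0 1 * 1 :=
    ENNReal.mul_lt_mul_right hne (cost_ne_top h0 hm₁ hm₂ (by simp) (by simp) _ _) hm₂
  rw [zero_add] at h1
  rw [← h1, mul_one] at h2
  exact lt_irrefl _ h2

/-- First-step analysis from level `1`: if the step leads to `j`, then `j` unit descents remain, and
the one with index `i` is needed exactly when `i < j`. For `i ≤ m` it takes place at distance `m -
i` below the threshold; higher ones see only the high law. -/
lemma descent_eq (h0 : p₁ {0} ≠ 0) (hm₁ : ∫⁻ j, (j : ℝ≥0∞) ∂p₁ ≠ ⊤)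
    (hm₂ : ∫⁻ j, (j : ℝ≥0∞) ∂p₂ < 1) (hα : α ≠ ⊤) (hβ : β ≠ ⊤) (m : ℕ) :
    descent p₁ p₂ α β m = α + (∑ i ∈ Finset.range (m + 1), descent p₁ p₂ α β (m - i) *
      p₁ (Set.Ioi i) + cost p₁ p₂ α β 0 1 * ∑' i, p₁ (Set.Ioi (i + (m + 1)))) := by
  conv_lhs => rw [descent, show (1 : ℕ) = 0 + 1 from rfl, cost_succ]
  simp only [zero_add, show ¬ (m + 1 < 1) by omega, if_false]
  rw [lintegral_cost h0 hm₁ hm₂ hα hβ]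
  simp

/-! ### Real-valued forms -/

/-- Expected number of steps below the threshold during a descent by one unit. -/
def lowDescent (p₁ p₂ : Measure ℕ) (m : ℕ) : ℝ := (descent p₁ p₂ 1 0 m).toReal

lemma summable_tail {p : Measure ℕ} [IsFiniteMeasure p] (hm : ∫⁻ j, (j : ℝ≥0∞) ∂p ≠ ⊤) :
    Summable fun i => p.real (Set.Ioi i) := by
  rw [lintegral_natCast] at hm
  exact ENNReal.summable_toReal hm

lemma tsum_tail (p : Measure ℕ) [IsFiniteMeasure p] :
    ∑' i, p.real (Set.Ioi i) = (∫⁻ j, (j : ℝ≥0∞) ∂p).toReal := by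
  rw [lintegral_natCast, ENNReal.tsum_toReal_eq fun i => measure_ne_top _ _]
  rfl

lemma toReal_tsum_tail_add (p : Measure ℕ) [IsFiniteMeasure p] (n : ℕ) :
    (∑' i, p (Set.Ioi (i + n))).toReal = ∑' i, p.real (Set.Ioi (i + n)) := by
  rw [ENNReal.tsum_toReal_eq fun i => measure_ne_top _ _]
  rfl

lemma tsum_tail_add_ne_top {p : Measure ℕ} (hm : ∫⁻ j, (j : ℝ≥0∞) ∂p ≠ ⊤) (n : ℕ) :
    ∑' i, p (Set.Ioi (i + n)) ≠ ⊤ := by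
  rw [lintegral_natCast] at hm
  exact ne_top_of_le_ne_top hm
    (ENNReal.tsum_comp_le_tsum_of_injective (add_left_injective n) fun i => p (Set.Ioi i))

/-- Above the threshold nothing is charged, so the overshoot term disappears and a pure renewal
equation remains, whose weights are the tails of `p₁`. -/
lemma lowDescent_eq (h0 : p₁ {0} ≠ 0) (hm₁ : ∫⁻ j, (j : ℝ≥0∞) ∂p₁ ≠ ⊤)
    (hm₂ : ∫⁻ j, (j : ℝ≥0∞) ∂p₂ < 1) (m : ℕ) :
    lowDescent p₁ p₂ m =
      1 + ∑ i ∈ Finset.range (m + 1), lowDescent p₁ p₂ (m - i) * p₁.real (Set.Ioi i) := by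
  have hf : ∀ m, descent p₁ p₂ 1 0 m ≠ ⊤ := fun m => cost_ne_top h0 hm₁ hm₂ (by simp) (by simp) _ _
  have hU := cost_zero_one_low h0 hm₁ hm₂
  have h := congrArg ENNReal.toReal (descent_eq h0 hm₁ hm₂ ENNReal.one_ne_top
    ENNReal.zero_ne_top m)
  rw [hU, zero_mul, add_zero, ENNReal.toReal_add (by simp)
    (ENNReal.sum_ne_top.2 fun i _ => ENNReal.mul_ne_top (hf _) (measure_ne_top _ _)),
    ENNReal.toReal_sum fun i _ => ENNReal.mul_ne_top (hf _) (measure_ne_top _ _)] at h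
  simpa [lowDescent, ENNReal.toReal_mul, Measure.real] using h

/-- The expected number of steps above the threshold is determined by the drift balance. -/
lemma highDescent_eq (h0 : p₁ {0} ≠ 0) (hm₁ : ∫⁻ j, (j : ℝ≥0∞) ∂p₁ ≠ ⊤)
    (hm₂ : ∫⁻ j, (j : ℝ≥0∞) ∂p₂ < 1) (m : ℕ) :
    (1 - (∫⁻ j, (j : ℝ≥0∞) ∂p₂).toReal) * (descent p₁ p₂ 0 1 m).toReal =
      1 - (1 - (∫⁻ j, (j : ℝ≥0∞) ∂p₁).toReal) * lowDescent p₁ p₂ m := by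
  have hf : ∀ m, descent p₁ p₂ 0 1 m ≠ ⊤ := fun m => cost_ne_top h0 hm₁ hm₂ (by simp) (by simp) _ _
  have hU := congrArg ENNReal.toReal
    (cost_zero_one h0 hm₁ hm₂ ENNReal.zero_ne_top ENNReal.one_ne_top)
  have hUf : cost p₁ p₂ 0 1 0 1 ≠ ⊤ := cost_ne_top h0 hm₁ hm₂ (by simp) (by simp) _ _
  rw [ENNReal.toReal_add (by simp) (by finiteness), ENNReal.toReal_mul] at hU
  induction m using Nat.strong_induction_on with
  | _ m ih =>
    have h := congrArg ENNReal.toReal (descent_eq h0 hm₁ hm₂ ENNReal.zero_ne_top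
      ENNReal.one_ne_top m)
    have ht := tsum_tail_add_ne_top hm₁ (m + 1)
    rw [zero_add, ENNReal.toReal_add
      (ENNReal.sum_ne_top.2 fun i _ => ENNReal.mul_ne_top (hf _) (measure_ne_top _ _))
      (by finiteness),
      ENNReal.toReal_sum fun i _ => ENNReal.mul_ne_top (hf _) (measure_ne_top _ _),
      ENNReal.toReal_mul, toReal_tsum_tail_add] at h
    simp only [ENNReal.toReal_mul] at h
    have hT := lowDescent_eq h0 hm₁ hm₂ m
    have hs := (summable_tail hm₁).sum_add_tsum_nat_add (m + 1)
    rw [tsum_tail] at hs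
    -- The term `i = 0` contains the unknown at `m` itself; once it is split off, the induction
    -- hypothesis applies to the others.
    rw [Finset.sum_range_succ'] at h hT hs
    simp only [Nat.sub_zero] at h hT
    set ρ₂ := (∫⁻ j, (j : ℝ≥0∞) ∂p₂).toReal
    set ρ₁ := (∫⁻ j, (j : ℝ≥0∞) ∂p₁).toReal
    set τ := ∑' i, p₁.real (Set.Ioi (i + (m + 1)))
    set U := (cost p₁ p₂ 0 1 0 1).toReal
    change _ = _ + (descent p₁ p₂ 0 1 m).toReal * p₁.real (Set.Ioi 0) + _ at h
    set D := (descent p₁ p₂ 0 1 m).toReal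
    set T := lowDescent p₁ p₂ m
    set g₀ := p₁.real (Set.Ioi 0)
    have hS : (1 - ρ₂) * ∑ i ∈ Finset.range m, (descent p₁ p₂ 0 1 (m - (i + 1))).toReal *
        p₁.real (Set.Ioi (i + 1)) = ∑ i ∈ Finset.range m, p₁.real (Set.Ioi (i + 1)) - (1 - ρ₁) *
          ∑ i ∈ Finset.range m, lowDescent p₁ p₂ (m - (i + 1)) * p₁.real (Set.Ioi (i + 1)) := by
      rw [Finset.mul_sum, Finset.mul_sum, ← Finset.sum_sub_distrib]
      refine Finset.sum_congr rfl fun i hi => ?_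
      rw [← mul_assoc, ih _ (by have := Finset.mem_range.1 hi; omega)]
      ring
    change D = (∑ i ∈ Finset.range m, (descent p₁ p₂ 0 1 (m - (i + 1))).toReal *
        p₁.real (Set.Ioi (i + 1))) + D * g₀ + U * τ at h
    have hg : g₀ < 1 := real_Ioi_zero_lt_one h0
    have hU' : U * (1 - ρ₂) = 1 := by
      simp at hU
      linarith
    have key : (1 - g₀) * ((1 - ρ₂) * D) = (1 - g₀) * (1 - (1 - ρ₁) * T) := by
      linear_combination (1 - ρ₂) * h + hS + hs + τ * hU' + (1 - ρ₁) * hT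
    exact mul_left_cancel₀ (by linarith) key

end Descent

/-! ### Renewal sequences -/

section Renewal

/-- Dominated convergence for series: `a` is bounded and `R` absolutely summable. The index `n - 1 -
i` is that of `lowVisits`; its truncation is harmless because `i < n`. -/
lemma tendsto_convolution {a R : ℕ → ℝ} {l C : ℝ} (ha : Tendsto a atTop (𝓝 l))
    (hC : ∀ n, |a n| ≤ C) (hR : Summable fun i => |R i|) :
    Tendsto (fun n => ∑ i ∈ Finset.range n, a (n - 1 - i) * R i) atTop (𝓝 (l * ∑' i, R i)) := by
  have h1 : ∀ n, ∑ i ∈ Finset.range n, a (n - 1 - i) * R i =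
      ∑' i, if i < n then a (n - 1 - i) * R i else 0 := by
    intro n
    rw [tsum_eq_sum (s := Finset.range n)]
    · exact Finset.sum_congr rfl fun i hi => by rw [if_pos (by simpa using hi)]
    · intro i hi
      rw [if_neg (by simpa using hi)]
  simp_rw [h1]
  rw [← tsum_mul_left]
  refine tendsto_tsum_of_dominated_convergence (bound := fun i => C * |R i|) (hR.mul_left C) ?_ ?_
  · intro i
    have h2 : Tendsto (fun n => a (n - 1 - i) * R i) atTop (𝓝 (l * R i)) := by
      refine (ha.comp ?_).mul_const _
      simp_rw [Nat.sub_sub]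
      exact tendsto_sub_atTop_nat _
    refine h2.congr' ?_
    filter_upwards [eventually_gt_atTop i] with n hn
    rw [if_pos hn]
  · refine Eventually.of_forall fun n i => ?_
    have hC0 : 0 ≤ C := (abs_nonneg _).trans (hC 0)
    split_ifs
    · rw [Real.norm_eq_abs, abs_mul]
      exact mul_le_mul_of_nonneg_right (hC _) (abs_nonneg _)
    · simp only [norm_zero]
      positivity

variable {f g T : ℕ → ℝ} {ρ : ℝ}

/-- The bound is the fixed point of `c = 1 + ρ * c`. The term `i = 0` carries `T m` itself and is
moved to the left before the induction hypothesis is used. -/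
lemma renewal_le (hg : ∀ i, 0 ≤ g i) (hs : Summable g) (hρ : ∑' i, g i = ρ) (hρ1 : ρ < 1)
    (hT : ∀ m, T m = 1 + ∑ i ∈ Finset.range (m + 1), T (m - i) * g i) (m : ℕ) :
    T m ≤ 1 / (1 - ρ) := by
  induction m using Nat.strong_induction_on with
  | _ m ih =>
    have h := hT m
    rw [Finset.sum_range_succ'] at h
    have h1 : ∑ i ∈ Finset.range m, T (m - (i + 1)) * g (i + 1) ≤
        1 / (1 - ρ) * ∑ i ∈ Finset.range m, g (i + 1) := by
      rw [Finset.mul_sum]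
      refine Finset.sum_le_sum fun i hi => mul_le_mul_of_nonneg_right (ih _ ?_) (hg _)
      have := Finset.mem_range.1 hi
      omega
    have h2 : ∑ i ∈ Finset.range m, g (i + 1) + g 0 ≤ ρ := by
      rw [← Finset.sum_range_succ', ← hρ]
      exact hs.sum_le_tsum _ fun i _ => hg i
    have h0 : g 0 ≤ ρ := by
      rw [← hρ]
      exact hs.le_tsum 0 fun i _ => hg i
    have h3 : 0 < 1 - ρ := by linarith
    have h4 : (1 - g 0) * T m ≤ (1 - g 0) * (1 / (1 - ρ)) := by
      have h5 : 1 / (1 - ρ) * ∑ i ∈ Finset.range m, g (i + 1) ≤ 1 / (1 - ρ) * (ρ - g 0) :=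
        mul_le_mul_of_nonneg_left (by linarith) (by positivity)
      have h6 : 1 / (1 - ρ) * (1 - ρ) = 1 := by field_simp
      simp only [Nat.sub_zero] at h
      nlinarith
    exact le_of_mul_le_mul_left h4 (by linarith)

lemma renewal_nonneg (hg : ∀ i, 0 ≤ g i) (hg0 : g 0 < 1)
    (hT : ∀ m, T m = 1 + ∑ i ∈ Finset.range (m + 1), T (m - i) * g i) (m : ℕ) : 0 ≤ T m := by
  induction m using Nat.strong_induction_on with
  | _ m ih =>
    have h := hT m
    rw [Finset.sum_range_succ'] at h
    have h1 : 0 ≤ ∑ i ∈ Finset.range m, T (m - (i + 1)) * g (i + 1) := by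
      refine Finset.sum_nonneg fun i hi => mul_nonneg (ih _ ?_) (hg _)
      have := Finset.mem_range.1 hi
      omega
    simp only [Nat.sub_zero] at h
    have h2 : 0 ≤ (1 - g 0) * T m := by linarith
    exact nonneg_of_mul_nonneg_right h2 (by linarith)

/-- The increments satisfy a renewal inequality with the nonnegative source `T 0 * g (m + 1)`, so
induction keeps them nonnegative. -/
lemma renewal_monotone (hg : ∀ i, 0 ≤ g i) (hg0 : g 0 < 1)
    (hT : ∀ m, T m = 1 + ∑ i ∈ Finset.range (m + 1), T (m - i) * g i) : Monotone T := by
  refine monotone_nat_of_le_succ fun m => ?_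
  induction m using Nat.strong_induction_on with
  | _ m ih =>
    have h1 := hT (m + 1)
    have h2 := hT m
    rw [Finset.sum_range_succ] at h1
    have h3 : ∑ i ∈ Finset.range (m + 1), T (m - i) * g i + (T (m + 1) - T m) * g 0 ≤
        ∑ i ∈ Finset.range (m + 1), T (m + 1 - i) * g i := by
      rw [Finset.sum_range_succ', Finset.sum_range_succ']
      have : ∑ i ∈ Finset.range m, T (m - (i + 1)) * g (i + 1) ≤
          ∑ i ∈ Finset.range m, T (m + 1 - (i + 1)) * g (i + 1) := by
        refine Finset.sum_le_sum fun i hi => mul_le_mul_of_nonneg_right ?_ (hg _)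
        have hi' := Finset.mem_range.1 hi
        have h4 := ih (m - (i + 1)) (by omega)
        rwa [show m - (i + 1) + 1 = m + 1 - (i + 1) by omega] at h4
      simp only [Nat.sub_zero]
      linarith
    have h5 : 0 ≤ T (m + 1 - (m + 1)) * g (m + 1) :=
      mul_nonneg (renewal_nonneg hg hg0 hT _) (hg _)
    have h6 : 0 ≤ (1 - g 0) * (T (m + 1) - T m) := by linarith
    linarith [nonneg_of_mul_nonneg_right h6 (by linarith)]

/-- Being monotone and bounded, `T` converges; in the limit the equation reads `l = 1 + l * ρ`. -/
lemma renewal_tendsto (hg : ∀ i, 0 ≤ g i) (hs : Summable g) (hρ : ∑' i, g i = ρ) (hρ1 : ρ < 1)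
    (hT : ∀ m, T m = 1 + ∑ i ∈ Finset.range (m + 1), T (m - i) * g i) :
    Tendsto T atTop (𝓝 (1 / (1 - ρ))) := by
  have hg0 : g 0 < 1 := lt_of_le_of_lt (by rw [← hρ]; exact hs.le_tsum 0 fun i _ => hg i) hρ1
  have hle := renewal_le hg hs hρ hρ1 hT
  have hmono := renewal_monotone hg hg0 hT
  have hnn := renewal_nonneg hg hg0 hT
  obtain ⟨l, hl⟩ : ∃ l, Tendsto T atTop (𝓝 l) :=
    ⟨_, tendsto_atTop_ciSup hmono ⟨_, by rintro _ ⟨m, rfl⟩; exact hle m⟩⟩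
  have h1 := (tendsto_convolution (R := g) (C := 1 / (1 - ρ)) hl
    (fun n => by rw [abs_of_nonneg (hnn n)]; exact hle n)
    (by simpa only [abs_of_nonneg (hg _)] using hs)).comp (tendsto_add_atTop_nat 1)
  have h2 : Tendsto T atTop (𝓝 (1 + l * ρ)) := by
    rw [← hρ]
    refine (h1.const_add 1).congr fun m => ?_
    rw [hT m]
    rfl
  have h3 := tendsto_nhds_unique hl h2
  have h4 : l = 1 / (1 - ρ) := by
    rw [eq_div_iff (by linarith)]
    linarith
  rwa [← h4]

/-- The elementary renewal theorem. -/
lemma renewal_tendsto_critical {μ : ℝ} (hg : ∀ i, 0 ≤ g i) (hs : Summable g)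
    (hρ : ∑' i, g i = 1) (hg0 : g 0 < 1)
    (hT : ∀ m, T m = 1 + ∑ i ∈ Finset.range (m + 1), T (m - i) * g i)
    (hμ : HasSum (fun j => ∑' i, g (i + (j + 1))) μ) :
    Tendsto (fun m : ℕ => T m / (m + 1)) atTop (𝓝 (1 / μ)) := by
  set h : ℕ → ℝ := fun j => ∑' i, g (i + (j + 1)) with hh
  have hnn := renewal_nonneg hg hg0 hT
  have hmono := renewal_monotone hg hg0 hT
  have hh0 : ∀ j, 0 ≤ h j := fun j => tsum_nonneg fun i => hg _
  have h0 : h 0 = 1 - g 0 := by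
    have := hs.sum_add_tsum_nat_add 1
    simp only [Finset.sum_range_one, hρ] at this
    simp only [hh, zero_add]
    linarith
  have hstep : ∀ j, h (j + 1) = h j - g (j + 1) := by
    intro j
    have h1 := hs.sum_add_tsum_nat_add (j + 1)
    have h2 := hs.sum_add_tsum_nat_add (j + 1 + 1)
    rw [Finset.sum_range_succ _ (j + 1)] at h2
    simp only [hh]
    linarith
  -- Summed form of the renewal equation: convolving `T` with the second tails `h` gives exactly `m
  -- + 1`, because `h 0 = 1 - g 0` and `h` decreases by `g (j + 1)` at each step.
  have hid : ∀ m, ∑ j ∈ Finset.range (m + 1), T (m - j) * h j = m + 1 := by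
    intro m
    induction m with
    | zero =>
      have := hT 0
      simp only [zero_add, Finset.sum_range_one, Nat.sub_zero, h0, Nat.cast_zero] at this ⊢
      linarith
    | succ m ih =>
      rw [Finset.sum_range_succ']
      have h1 := hT (m + 1)
      rw [Finset.sum_range_succ'] at h1
      simp only [Nat.sub_zero, Nat.add_sub_add_right] at h1 ⊢
      have h2 : ∑ j ∈ Finset.range (m + 1), T (m - j) * h (j + 1) =
          ∑ j ∈ Finset.range (m + 1), T (m - j) * h j -
            ∑ j ∈ Finset.range (m + 1), T (m - j) * g (j + 1) := by
        rw [← Finset.sum_sub_distrib]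
        exact Finset.sum_congr rfl fun j _ => by rw [hstep]; ring
      rw [h2, ih, h0]
      push_cast
      linarith
  have hμ0 : 0 < μ := lt_of_lt_of_le (by rw [h0]; linarith)
    ((hμ.summable.le_tsum 0 fun j _ => hh0 j).trans_eq hμ.tsum_eq)
  -- By monotonicity, replacing every `T (m - j)` in `hid` by `T m` can only increase the sum.
  have hlow : ∀ m : ℕ, 1 / μ ≤ T m / (m + 1) := by
    intro m
    rw [div_le_div_iff₀ hμ0 (by positivity), one_mul, ← hid m]
    calc _ ≤ ∑ j ∈ Finset.range (m + 1), T m * h j :=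
          Finset.sum_le_sum fun j _ => mul_le_mul_of_nonneg_right (hmono (Nat.sub_le _ _)) (hh0 j)
      _ = T m * ∑ j ∈ Finset.range (m + 1), h j := by rw [Finset.mul_sum]
      _ ≤ _ := mul_le_mul_of_nonneg_left
          ((hμ.summable.sum_le_tsum _ fun j _ => hh0 j).trans_eq hμ.tsum_eq) (hnn m)
  -- In `hid` at index `m + K` only the first `K + 1` terms are kept; there `T` is at least `T m`.
  have hup : ∀ K m : ℕ, T m * ∑ j ∈ Finset.range (K + 1), h j ≤ m + K + 1 := by
    intro K m
    have h1 := hid (m + K)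
    have h2 : T m * ∑ j ∈ Finset.range (K + 1), h j ≤
        ∑ j ∈ Finset.range (m + K + 1), T (m + K - j) * h j := by
      rw [Finset.mul_sum]
      refine (Finset.sum_le_sum fun j hj => mul_le_mul_of_nonneg_right (hmono ?_) (hh0 j)).trans
        (Finset.sum_le_sum_of_subset_of_nonneg (Finset.range_mono (by omega))
          fun j _ _ => mul_nonneg (hnn _) (hh0 j))
      have := Finset.mem_range.1 hj
      omega
    rw [h1] at h2
    push_cast at h2
    exact h2
  refine tendsto_order.2 ⟨fun a ha => Eventually.of_forall fun m => ha.trans_le (hlow m), ?_⟩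
  intro c hc
  have hc0 : 0 < c := lt_trans (by positivity) hc
  have hK : ∀ᶠ n in atTop, 1 / c < ∑ j ∈ Finset.range n, h j :=
    hμ.tendsto_sum_nat.eventually_const_lt (by rwa [one_div_lt hc0 hμ0])
  obtain ⟨K, hK⟩ := ((tendsto_add_atTop_nat 1).eventually hK).exists
  set H := ∑ j ∈ Finset.range (K + 1), h j with hH
  have hH0 : 0 < H := lt_trans (by positivity) hK
  have hlim : Tendsto (fun m : ℕ => (1 + K * (1 / ((m : ℝ) + 1))) / H) atTop
      (𝓝 ((1 + K * 0) / H)) :=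
    ((tendsto_one_div_add_atTop_nhds_zero_nat.const_mul _).const_add 1).div_const _
  have hlt : (1 + (K : ℝ) * 0) / H < c := by
    rw [mul_zero, add_zero, one_div_lt hH0 hc0]
    exact hK
  filter_upwards [hlim.eventually_lt_const hlt] with m hm
  refine lt_of_le_of_lt ?_ hm
  rw [div_le_div_iff₀ (by positivity) hH0]
  have h3 := hup K m
  have h4 : (1 + (K : ℝ) * (1 / ((m : ℝ) + 1))) * (m + 1) = m + K + 1 := by
    field_simp
    ring
  rw [h4]
  exact h3

/-- The renewal equation for the tails, in terms of the masses. -/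
lemma renewal_mass_iff (hg0 : g 0 = 1 - f 0) (hgs : ∀ i, g i - g (i + 1) = f (i + 1)) :
    (∀ m, T m = 1 + ∑ i ∈ Finset.range (m + 1), T (m - i) * g i) ↔
      (T 0 * f 0 = 1 ∧ ∀ m, ∑ i ∈ Finset.range (m + 2), T (m + 1 - i) * f i = T m) := by
  -- Differences of consecutive equations turn tails into masses. In terms of masses, exponential
  -- tilting acts termwise.
  have key : ∀ m, (1 + ∑ i ∈ Finset.range (m + 2), T (m + 1 - i) * g i) -
      (1 + ∑ i ∈ Finset.range (m + 1), T (m - i) * g i) =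
        T (m + 1) - ∑ i ∈ Finset.range (m + 2), T (m + 1 - i) * f i := by
    intro m
    rw [Finset.sum_range_succ' _ (m + 1), Finset.sum_range_succ' _ (m + 1)]
    simp only [Nat.add_sub_add_right, Nat.sub_zero, hg0]
    have : ∑ i ∈ Finset.range (m + 1), T (m - i) * f (i + 1) =
        ∑ i ∈ Finset.range (m + 1), T (m - i) * g i -
          ∑ i ∈ Finset.range (m + 1), T (m - i) * g (i + 1) := by
      rw [← Finset.sum_sub_distrib]
      exact Finset.sum_congr rfl fun j _ => by rw [← hgs]; ring
    rw [this]
    ring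
  constructor
  · intro h
    refine ⟨?_, fun m => ?_⟩
    · have := h 0
      simp only [zero_add, Finset.sum_range_one, Nat.sub_zero, hg0] at this
      linarith
    · have h1 := key m
      rw [← h m, ← h (m + 1)] at h1
      linarith
  · rintro ⟨h0, h⟩ m
    induction m with
    | zero =>
      simp only [zero_add, Finset.sum_range_one, Nat.sub_zero, hg0]
      linarith
    | succ m ih =>
      have h1 := key m
      rw [h m] at h1
      linarith

end Renewal

/-! ### Generating functions and exponential tilting -/

section Tilt

variable {p : Measure ℕ} [IsProbabilityMeasure p]

lemma hasSum_real_singleton (p : Measure ℕ) [IsProbabilityMeasure p] :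
    HasSum (fun j => p.real {j}) 1 := by
  have h : ∑' j, p {j} = 1 := by
    have := lintegral_countable' (μ := p) (fun _ => 1)
    simpa using this.symm
  have h2 := ENNReal.hasSum_toReal (f := fun j => p {j}) (by rw [h]; simp)
  rwa [← ENNReal.tsum_toReal_eq (fun j => measure_ne_top _ _), h] at h2

lemma summable_mass_mul_pow {𝕜 : Type*} [RCLike 𝕜] {z : 𝕜} (hz : ‖z‖ ≤ 1) :
    Summable fun j => (p.real {j} : 𝕜) * z ^ j := by
  refine Summable.of_norm_bounded (hasSum_real_singleton p).summable fun j => ?_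
  rw [norm_mul, norm_pow, RCLike.norm_ofReal, abs_of_nonneg measureReal_nonneg]
  exact mul_le_of_le_one_right measureReal_nonneg (pow_le_one₀ (norm_nonneg _) hz)

lemma summable_tail_mul_pow {𝕜 : Type*} [RCLike 𝕜] (hm : ∫⁻ j, (j : ℝ≥0∞) ∂p ≠ ⊤) {z : 𝕜}
    (hz : ‖z‖ ≤ 1) : Summable fun i => (p.real (Set.Ioi i) : 𝕜) * z ^ i := by
  refine Summable.of_norm_bounded (summable_tail hm) fun j => ?_
  rw [norm_mul, norm_pow, RCLike.norm_ofReal, abs_of_nonneg measureReal_nonneg]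
  exact mul_le_of_le_one_right measureReal_nonneg (pow_le_one₀ (norm_nonneg _) hz)

/-- Summation by parts, each mass being a difference of tails. Let `F` and `G` be the generating
functions of the masses and of the tails: apart from `z = 1`, the roots of `z = F z` are the
solutions of `G z = 1`. -/
lemma tsum_mass_mul_pow {𝕜 : Type*} [RCLike 𝕜] (hm : ∫⁻ j, (j : ℝ≥0∞) ∂p ≠ ⊤) {z : 𝕜}
    (hz : ‖z‖ ≤ 1) : ∑' j, (p.real {j} : 𝕜) * z ^ j =
      1 - (1 - z) * ∑' i, (p.real (Set.Ioi i) : 𝕜) * z ^ i := by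
  have hG := summable_tail_mul_pow hm hz
  have hF := summable_mass_mul_pow (p := p) hz
  have h1 := hF.tsum_eq_zero_add
  have h2 := hG.tsum_eq_zero_add
  have hG' := (summable_nat_add_iff 1).2 hG
  have h3 : ∑' j, (p.real {j + 1} : 𝕜) * z ^ (j + 1) =
      z * (∑' i, (p.real (Set.Ioi i) : 𝕜) * z ^ i) -
        ∑' i, (p.real (Set.Ioi (i + 1)) : 𝕜) * z ^ (i + 1) := by
    rw [← tsum_mul_left, ← (hG.mul_left z).tsum_sub hG']
    refine tsum_congr fun j => ?_
    rw [← real_Ioi_sub]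
    push_cast
    ring
  rw [h1, h3]
  rw [real_Ioi_zero] at h2
  push_cast at h2
  linear_combination h2

lemma hasDerivAt_tsum_pow {f : ℕ → ℝ} (hf : ∀ j, 0 ≤ f j) (hf0 : Summable f)
    (hf1 : Summable fun j => f j * j) {x : ℝ} (hx : |x| < 1) :
    HasDerivAt (fun y => ∑' j, f j * y ^ j) (∑' j, f j * (j * x ^ (j - 1))) x := by
  refine hasDerivAt_tsum_of_isPreconnected (u := fun j => f j * j) (t := Set.Ioo (-1) 1) (y₀ := 0)
    hf1 isOpen_Ioo isPreconnected_Ioo (fun j y _ => (hasDerivAt_pow j y).const_mul (f j)) ?_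
    (by simp) ?_ (abs_lt.1 hx)
  · intro j y hy
    rw [norm_mul, norm_mul, norm_pow, Real.norm_of_nonneg (hf j), Real.norm_natCast, ← mul_assoc]
    exact mul_le_of_le_one_right (mul_nonneg (hf j) (Nat.cast_nonneg j))
      (pow_le_one₀ (norm_nonneg _) (abs_lt.2 hy).le)
  · refine hf0.of_norm_bounded fun j => ?_
    rw [norm_mul, norm_pow, Real.norm_of_nonneg (hf j)]
    exact mul_le_of_le_one_right (hf j) (pow_le_one₀ (norm_nonneg _) (by simp))

/-- The law with masses proportional to `p {j} * φ ^ j`. -/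
def tilt (p : Measure ℕ) (φ : ℝ) : Measure ℕ :=
  (ENNReal.ofReal φ)⁻¹ • p.withDensity fun j => ENNReal.ofReal φ ^ j

lemma lintegral_tilt (p : Measure ℕ) (φ : ℝ) (v : ℕ → ℝ≥0∞) :
    ∫⁻ j, v j ∂(tilt p φ) = (ENNReal.ofReal φ)⁻¹ * ∫⁻ j, ENNReal.ofReal φ ^ j * v j ∂p := by
  rw [tilt, lintegral_smul_measure,
    lintegral_withDensity_eq_lintegral_mul _ Measurable.of_discrete Measurable.of_discrete]
  rfl

variable {φ : ℝ}

lemma tilt_real_singleton (p : Measure ℕ) (hφ : 0 < φ) (j : ℕ) :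
    (tilt p φ).real {j} = φ⁻¹ * φ ^ j * p.real {j} := by
  have h : tilt p φ {j} = (ENNReal.ofReal φ)⁻¹ * (ENNReal.ofReal φ ^ j * p {j}) := by
    rw [← lintegral_indicator_one (MeasurableSet.singleton j), lintegral_tilt,
      lintegral_countable', tsum_eq_single j]
    · simp
    · intro i hi
      simp [hi]
  rw [Measure.real, h]
  simp [ENNReal.toReal_mul, ENNReal.toReal_inv, ENNReal.toReal_pow, hφ.le, Measure.real, mul_assoc]

lemma toReal_lintegral_tilt (hφ0 : 0 < φ) :
    (∫⁻ j, (j : ℝ≥0∞) ∂(tilt p φ)).toReal = ∑' j, p.real {j} * (j * φ ^ (j - 1)) := by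
  rw [lintegral_tilt, lintegral_countable', ENNReal.toReal_mul, ENNReal.tsum_toReal_eq,
    ENNReal.toReal_inv, ENNReal.toReal_ofReal hφ0.le, ← tsum_mul_left]
  · refine tsum_congr fun j => ?_
    cases j with
    | zero => simp
    | succ j =>
      simp only [ENNReal.toReal_mul, ENNReal.toReal_pow, ENNReal.toReal_ofReal hφ0.le,
        ENNReal.toReal_natCast, Nat.add_sub_cancel, Measure.real]
      field_simp
      ring
  · intro j
    exact ENNReal.mul_ne_top (ENNReal.mul_ne_top (by finiteness) (by simp)) (measure_ne_top _ _)

variable (hm : ∫⁻ j, (j : ℝ≥0∞) ∂p ≠ ⊤) (hφ0 : 0 < φ) (hφ1 : φ < 1)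
  (hφ : ∑' i, p.real (Set.Ioi i) * φ ^ i = 1)
include hm hφ0 hφ1 hφ

lemma tsum_mass_mul_pow_root : ∑' j, p.real {j} * φ ^ j = φ := by
  have h := tsum_mass_mul_pow (𝕜 := ℝ) hm (z := φ) (by
    rw [Real.norm_of_nonneg hφ0.le]; exact hφ1.le)
  simp only [RCLike.ofReal_real_eq_id, id_eq] at h
  rw [h, hφ]
  ring

/-- The total mass is the generating function at `φ` divided by `φ`, and `φ` is a fixed point. -/
lemma isProbabilityMeasure_tilt : IsProbabilityMeasure (tilt p φ) := by
  constructor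
  rw [← lintegral_one, lintegral_tilt, lintegral_countable']
  have h : ∀ j, ENNReal.ofReal φ ^ j * 1 * p {j} = ENNReal.ofReal (p.real {j} * φ ^ j) := by
    intro j
    rw [mul_one, ENNReal.ofReal_mul measureReal_nonneg, ENNReal.ofReal_pow hφ0.le,
      ofReal_measureReal, mul_comm]
  have hs := summable_mass_mul_pow (p := p) (𝕜 := ℝ) (z := φ)
    (by rw [Real.norm_of_nonneg hφ0.le]; exact hφ1.le)
  simp only [RCLike.ofReal_real_eq_id, id_eq] at hs
  simp_rw [h]
  rw [← ENNReal.ofReal_tsum_of_nonneg (fun j => by positivity) hs,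
    tsum_mass_mul_pow_root hm hφ0 hφ1 hφ]
  exact ENNReal.inv_mul_cancel (by simpa using hφ0) (by simp)

lemma lintegral_geom_sum_eq_one :
    ∫⁻ j, ∑ i ∈ Finset.range j, ENNReal.ofReal φ ^ i ∂p = 1 := by
  rw [lintegral_sum_range]
  have h : ∀ i, ENNReal.ofReal φ ^ i * p (Set.Ioi i) =
      ENNReal.ofReal (p.real (Set.Ioi i) * φ ^ i) := by
    intro j
    rw [ENNReal.ofReal_mul measureReal_nonneg, ENNReal.ofReal_pow hφ0.le,
      ofReal_measureReal, mul_comm]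
  have hs := summable_tail_mul_pow (p := p) (𝕜 := ℝ) hm (z := φ)
    (by rw [Real.norm_of_nonneg hφ0.le]; exact hφ1.le)
  simp only [RCLike.ofReal_real_eq_id, id_eq] at hs
  simp_rw [h]
  rw [← ENNReal.ofReal_tsum_of_nonneg (fun j => by positivity) hs, hφ, ENNReal.ofReal_one]

/-- Termwise `j * φ ^ j ≤ φ * (1 + φ + ⋯ + φ ^ (j - 1))`, strictly for `j ≥ 2`. The right side
integrates to `φ` because the tails have generating function `1` at `φ`, and `hp` makes the
inequality strict after integration. -/
lemma lintegral_tilt_lt_one (hp : p (Set.Ioi 1) ≠ 0) : ∫⁻ j, (j : ℝ≥0∞) ∂(tilt p φ) < 1 := by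
  have hx0 : ENNReal.ofReal φ ≠ 0 := by simpa using hφ0
  have hx1 : ENNReal.ofReal φ < 1 := by simpa using hφ1
  rw [lintegral_tilt, mul_comm, ← div_eq_mul_inv]
  refine (ENNReal.div_lt_iff (Or.inl hx0) (Or.inl (by simp))).2 ?_
  have h1 := lintegral_geom_sum_eq_one hm hφ0 hφ1 hφ
  set x := ENNReal.ofReal φ with hx
  rw [← h1, mul_comm, ← lintegral_const_mul _ Measurable.of_discrete]
  have hle : ∀ j : ℕ, x ^ j * j ≤ x * ∑ i ∈ Finset.range j, x ^ i := by
    intro j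
    rw [Finset.mul_sum, mul_comm, ← nsmul_eq_mul, ← Finset.card_range j, ← Finset.sum_const,
      Finset.card_range]
    refine Finset.sum_le_sum fun i hi => ?_
    rw [← pow_succ']
    exact pow_le_pow_right_of_le_one' hx1.le (Finset.mem_range.1 hi)
  refine lintegral_strict_mono_of_ae_le_of_ae_lt_on (s := Set.Ioi 1) Measurable.of_discrete.aemeasurable
    ?_ (Eventually.of_forall hle) hp (Eventually.of_forall ?_)
  · refine ne_top_of_le_ne_top (b := x) (by simp [hx]) ?_
    calc _ ≤ ∫⁻ j, x * ∑ i ∈ Finset.range j, x ^ i ∂p := lintegral_mono hle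
      _ = x := by rw [lintegral_const_mul _ Measurable.of_discrete, h1, mul_one]
  · intro j hj
    have hj' : 1 < j := hj
    rw [Finset.mul_sum, mul_comm, ← nsmul_eq_mul, ← Finset.card_range j, ← Finset.sum_const,
      Finset.card_range]
    obtain ⟨k, rfl⟩ : ∃ k, j = k + 1 := ⟨j - 1, by omega⟩
    rw [Finset.sum_range_succ', Finset.sum_range_succ' (fun i => x * x ^ i)]
    have hfin : ∑ i ∈ Finset.range k, x ^ (k + 1) ≠ ⊤ := by
      refine ENNReal.sum_ne_top.2 fun i _ => ENNReal.pow_ne_top (by simp [hx])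
    refine ENNReal.add_lt_add_of_le_of_lt hfin ?_ ?_
    · refine Finset.sum_le_sum fun i hi => ?_
      rw [← pow_succ']
      refine pow_le_pow_right_of_le_one' hx1.le ?_
      have := Finset.mem_range.1 hi
      omega
    · rw [← pow_succ']
      rw [hx, ← ENNReal.ofReal_pow hφ0.le, ← ENNReal.ofReal_pow hφ0.le]
      exact (ENNReal.ofReal_lt_ofReal_iff (by positivity)).2
        (pow_lt_pow_right_of_lt_one₀ hφ0 hφ1 (by omega))

/-- Cramér asymptotics of a renewal sequence with tails `p (Set.Ioi i)`. -/
lemma renewal_tendsto_tilt (hp : p (Set.Ioi 1) ≠ 0) {T : ℕ → ℝ}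
    (hT : ∀ m, T m = 1 + ∑ i ∈ Finset.range (m + 1), T (m - i) * p.real (Set.Ioi i)) :
    (∃ C, ∀ m, |φ ^ (m + 1) * T m| ≤ C) ∧ Tendsto (fun m => φ ^ (m + 1) * T m) atTop
      (𝓝 (1 / (1 - ∑' j, p.real {j} * (j * φ ^ (j - 1))))) := by
  have := isProbabilityMeasure_tilt hm hφ0 hφ1 hφ
  have hlt := lintegral_tilt_lt_one hm hφ0 hφ1 hφ hp
  obtain ⟨h0, h1⟩ := (renewal_mass_iff (f := fun j => p.real {j}) (real_Ioi_zero p) (real_Ioi_sub p)).1 hT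
  -- Tilting multiplies the mass form of the equation by a power of `φ`. The exponent `m + 1`
  -- absorbs the factor `φ⁻¹` of the tilted masses, so that the initial condition is still `1`. The
  -- new equation is subcritical.
  have hT' := (renewal_mass_iff (T := fun m => φ ^ (m + 1) * T m)
    (f := fun j => (tilt p φ).real {j}) (real_Ioi_zero (tilt p φ))
    (real_Ioi_sub (tilt p φ))).2 ⟨by
      rw [tilt_real_singleton _ hφ0]
      field_simp
      rw [zero_add, pow_one, mul_assoc, h0, mul_one], fun m => by
      simp only [tilt_real_singleton _ hφ0]
      rw [← h1 m, Finset.mul_sum]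
      refine Finset.sum_congr rfl fun i hi => ?_
      have hi' := Finset.mem_range.1 hi
      have e : φ ^ (m + 1 - i + 1) * φ ^ i = φ ^ (m + 1) * φ := by
        rw [← pow_add, ← pow_succ]
        congr 1
        omega
      calc _ = φ⁻¹ * (φ ^ (m + 1 - i + 1) * φ ^ i) * (T (m + 1 - i) * p.real {i}) := by ring
        _ = _ := by rw [e]; field_simp⟩
  have hg : ∀ i, 0 ≤ (tilt p φ).real (Set.Ioi i) := fun i => measureReal_nonneg
  have hs := summable_tail (p := tilt p φ) hlt.ne_top
  have hρ := tsum_tail (tilt p φ)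
  have hρ1 : (∫⁻ j, (j : ℝ≥0∞) ∂(tilt p φ)).toReal < 1 := by
    have := (ENNReal.toReal_lt_toReal hlt.ne_top ENNReal.one_ne_top).2 hlt
    simpa using this
  have hg0 : (tilt p φ).real (Set.Ioi 0) < 1 :=
    lt_of_le_of_lt (by rw [← hρ]; exact hs.le_tsum 0 fun i _ => hg i) hρ1
  rw [← toReal_lintegral_tilt hφ0]
  refine ⟨⟨1 / (1 - (∫⁻ j, (j : ℝ≥0∞) ∂(tilt p φ)).toReal), fun m => ?_⟩,
    renewal_tendsto hg hs hρ hρ1 hT'⟩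
  rw [abs_of_nonneg (renewal_nonneg hg hg0 hT' m)]
  exact renewal_le hg hs hρ hρ1 hT' m

-- Intermediate values: the generating function of the tails is continuous, is below one at `0` and
-- equals the mean at `1`.
omit hφ hφ0 hφ1 in
lemma exists_tail_root (h0 : p {0} ≠ 0) (h1 : 1 < (∫⁻ j, (j : ℝ≥0∞) ∂p).toReal) :
    ∃ φ : ℝ, 0 < φ ∧ φ < 1 ∧ ∑' i, p.real (Set.Ioi i) * φ ^ i = 1 := by
  have hcont : ContinuousOn (fun x : ℝ => ∑' i, p.real (Set.Ioi i) * x ^ i) (Set.Icc 0 1) := by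
    refine continuousOn_tsum (fun i => by fun_prop) (summable_tail hm) fun i x hx => ?_
    rw [norm_mul, norm_pow, Real.norm_of_nonneg measureReal_nonneg]
    exact mul_le_of_le_one_right measureReal_nonneg
      (pow_le_one₀ (norm_nonneg _) (by rw [Real.norm_of_nonneg hx.1]; exact hx.2))
  have hz : ∑' i, p.real (Set.Ioi i) * (0 : ℝ) ^ i = p.real (Set.Ioi 0) := by
    rw [tsum_eq_single 0]
    · simp
    · intro i hi
      simp [hi]
  have hone : ∑' i, p.real (Set.Ioi i) * (1 : ℝ) ^ i = (∫⁻ j, (j : ℝ≥0∞) ∂p).toReal := by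
    simp [tsum_tail]
  have := intermediate_value_Ioo zero_le_one hcont
    (show (1 : ℝ) ∈ Set.Ioo _ _ from ⟨by
      simp only [hz]
      exact real_Ioi_zero_lt_one h0, by
      simp only [hone]
      exact h1⟩)
  obtain ⟨φ, hφ, h⟩ := this
  exact ⟨φ, hφ.1, hφ.2, h⟩

/-- Every root of `z = ∑ p {j} z ^ j` in the closed unit disc other than `φ` is larger in absolute
value. -/
lemma lt_norm_of_root (hp : p (Set.Ioi 1) ≠ 0) {z : ℂ} (hz : ‖z‖ ≤ 1)
    (hroot : z = ∑' j, (p.real {j} : ℂ) * z ^ j) (hne : z ≠ φ) : φ < ‖z‖ := by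
  -- The root `1` is set aside because the factor `1 - z` is cancelled below.
  by_cases hz1 : z = 1
  · simpa [hz1] using hφ1
  have h := tsum_mass_mul_pow (𝕜 := ℂ) hm hz
  simp only [Complex.coe_algebraMap] at h
  rw [← hroot] at h
  have hG : ∑' i, (p.real (Set.Ioi i) : ℂ) * z ^ i = 1 := by
    have h2 : (1 - z) * (∑' i, (p.real (Set.Ioi i) : ℂ) * z ^ i) = (1 - z) * 1 := by
      linear_combination h
    exact mul_left_cancel₀ (sub_ne_zero.2 (Ne.symm hz1)) h2
  have hGs := summable_tail_mul_pow (𝕜 := ℂ) hm hz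
  simp only [RCLike.ofReal_eq_complex_ofReal] at hGs
  by_contra! hle
  have hre : HasSum (fun i => p.real (Set.Ioi i) * (z ^ i).re) 1 := by
    have := Complex.hasSum_re hGs.hasSum
    rw [hG] at this
    simpa using this
  have hφs := summable_tail_mul_pow (p := p) (𝕜 := ℝ) hm (z := φ)
    (by rw [Real.norm_of_nonneg hφ0.le]; exact hφ1.le)
  simp only [RCLike.ofReal_real_eq_id, id_eq] at hφs
  have hdiff := hφs.hasSum.sub hre
  rw [hφ, sub_self] at hdiff
  -- If `‖z‖ ≤ φ`, these nonnegative terms sum to zero. The term of index `1`, whose weight is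
  -- positive by `hp`, forces `z.re = φ`, and then the bound on `‖z‖` leaves no imaginary part.
  have hnn : ∀ i, 0 ≤ p.real (Set.Ioi i) * φ ^ i - p.real (Set.Ioi i) * (z ^ i).re := by
    intro i
    rw [← mul_sub]
    refine mul_nonneg measureReal_nonneg (sub_nonneg.2 ?_)
    calc (z ^ i).re ≤ ‖z ^ i‖ := Complex.re_le_norm _
      _ = ‖z‖ ^ i := norm_pow _ _
      _ ≤ φ ^ i := pow_le_pow_left₀ (norm_nonneg _) hle i
  have h1 := congrFun ((hasSum_zero_iff_of_nonneg hnn).1 hdiff) 1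
  simp only [pow_one, ← mul_sub, Pi.zero_apply, mul_eq_zero] at h1
  have h2 : φ = z.re := by
    rcases h1 with h1 | h1
    · exact absurd h1 ((measureReal_ne_zero_iff).2 hp)
    · linarith
  apply hne
  have h3 : z.im = 0 := by
    have h4 : ‖z‖ ^ 2 ≤ φ ^ 2 := pow_le_pow_left₀ (norm_nonneg _) hle 2
    rw [Complex.sq_norm, Complex.normSq_apply] at h4
    nlinarith [sq_nonneg z.im]
  apply Complex.ext <;> simp [h2, h3]

end Tilt

/-! ### Costs of a busy period started by a batch -/

section Batch

variable {p₁ p₂ q : Measure ℕ} [IsProbabilityMeasure p₁] [IsProbabilityMeasure p₂]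

/-- Expected number of steps below the threshold `L` of the walk whose start has law `q`. -/
def lowVisits (p₁ p₂ q : Measure ℕ) (L : ℕ) : ℝ :=
  ∑ i ∈ Finset.range L, lowDescent p₁ p₂ (L - 1 - i) * q.real (Set.Ioi i)

lemma lowVisits_nonneg (p₁ p₂ q : Measure ℕ) (L : ℕ) : 0 ≤ lowVisits p₁ p₂ q L :=
  Finset.sum_nonneg fun _ _ => mul_nonneg ENNReal.toReal_nonneg measureReal_nonneg

lemma lintegral_cost_ne_top (h0 : p₁ {0} ≠ 0) (hm₁ : ∫⁻ j, (j : ℝ≥0∞) ∂p₁ ≠ ⊤)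
    (hm₂ : ∫⁻ j, (j : ℝ≥0∞) ∂p₂ < 1) (hq : ∫⁻ j, (j : ℝ≥0∞) ∂q ≠ ⊤)
    {α β : ℝ≥0∞} (hα : α ≠ ⊤) (hβ : β ≠ ⊤) (L : ℕ) : ∫⁻ j, cost p₁ p₂ α β L j ∂q ≠ ⊤ := by
  obtain ⟨C, hC, hCk⟩ := exists_cost_le_mul hα hβ h0 hm₁ hm₂ L
  refine ne_top_of_le_ne_top ?_ (lintegral_mono hCk)
  rw [lintegral_const_mul _ Measurable.of_discrete]
  exact ENNReal.mul_ne_top hC hq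

variable [IsProbabilityMeasure q]

lemma toReal_lintegral_lowCost (h0 : p₁ {0} ≠ 0) (hm₁ : ∫⁻ j, (j : ℝ≥0∞) ∂p₁ ≠ ⊤)
    (hm₂ : ∫⁻ j, (j : ℝ≥0∞) ∂p₂ < 1) (L : ℕ) :
    (∫⁻ j, cost p₁ p₂ 1 0 L j ∂q).toReal = lowVisits p₁ p₂ q L := by
  rw [lintegral_cost h0 hm₁ hm₂ (by simp) (by simp), cost_zero_one_low h0 hm₁ hm₂, zero_mul,
    add_zero, ENNReal.toReal_sum]
  · simp [ENNReal.toReal_mul, lowVisits, lowDescent, Measure.real]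
  · exact fun i _ => ENNReal.mul_ne_top (cost_ne_top h0 hm₁ hm₂ (by simp) (by simp) _ _)
      (measure_ne_top _ _)

/-- Drift balance over a busy period: the walk starts at mean height `∫ j ∂q`, loses on average `1 -
ρ₁` per low step and `1 - ρ₂` per high step, and ends at `0`. The proof adds up the balances
`highDescent_eq` of the unit descents. -/
lemma toReal_lintegral_highCost (h0 : p₁ {0} ≠ 0) (hm₁ : ∫⁻ j, (j : ℝ≥0∞) ∂p₁ ≠ ⊤)
    (hm₂ : ∫⁻ j, (j : ℝ≥0∞) ∂p₂ < 1) (hq : ∫⁻ j, (j : ℝ≥0∞) ∂q ≠ ⊤) (L : ℕ) :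
    (1 - (∫⁻ j, (j : ℝ≥0∞) ∂p₂).toReal) * (∫⁻ j, cost p₁ p₂ 0 1 L j ∂q).toReal =
      (∫⁻ j, (j : ℝ≥0∞) ∂q).toReal -
        (1 - (∫⁻ j, (j : ℝ≥0∞) ∂p₁).toReal) * lowVisits p₁ p₂ q L := by
  have hUf : cost p₁ p₂ 0 1 0 1 ≠ ⊤ := cost_ne_top h0 hm₁ hm₂ (by simp) (by simp) _ _
  have hU := congrArg ENNReal.toReal
    (cost_zero_one h0 hm₁ hm₂ ENNReal.zero_ne_top ENNReal.one_ne_top)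
  rw [ENNReal.toReal_add (by simp) (by finiteness), ENNReal.toReal_mul, ENNReal.toReal_one] at hU
  have hf : ∀ i ∈ Finset.range L, descent p₁ p₂ 0 1 (L - 1 - i) * q (Set.Ioi i) ≠ ⊤ :=
    fun i _ => ENNReal.mul_ne_top (cost_ne_top h0 hm₁ hm₂ (by simp) (by simp) _ _)
      (measure_ne_top _ _)
  have ht := tsum_tail_add_ne_top hq L
  rw [lintegral_cost h0 hm₁ hm₂ (by simp) (by simp),
    ENNReal.toReal_add (ENNReal.sum_ne_top.2 hf) (by finiteness), ENNReal.toReal_sum hf,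
    ENNReal.toReal_mul, toReal_tsum_tail_add, mul_add, Finset.mul_sum]
  have hs := (summable_tail hq).sum_add_tsum_nat_add L
  rw [tsum_tail] at hs
  simp only [ENNReal.toReal_mul, ← mul_assoc, highDescent_eq h0 hm₁ hm₂]
  rw [← hs, lowVisits, Finset.mul_sum, add_sub_right_comm, ← Finset.sum_sub_distrib]
  congr 1
  · refine Finset.sum_congr rfl fun i _ => ?_
    simp only [Measure.real]
    ring
  · linear_combination (∑' i, q.real (Set.Ioi (i + L))) * hU

/-- `lowVisits` is the convolution of the convergent sequence `lowDescent` with the summable tails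
of `q`. -/
lemma lowVisits_tendsto_subcritical (h0 : p₁ {0} ≠ 0) (hm₁ : ∫⁻ j, (j : ℝ≥0∞) ∂p₁ ≠ ⊤)
    (hm₂ : ∫⁻ j, (j : ℝ≥0∞) ∂p₂ < 1) (hq : ∫⁻ j, (j : ℝ≥0∞) ∂q ≠ ⊤)
    (hρ : (∫⁻ j, (j : ℝ≥0∞) ∂p₁).toReal < 1) :
    Tendsto (lowVisits p₁ p₂ q) atTop (𝓝 ((∫⁻ j, (j : ℝ≥0∞) ∂q).toReal /
      (1 - (∫⁻ j, (j : ℝ≥0∞) ∂p₁).toReal))) := by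
  have hT := lowDescent_eq h0 hm₁ hm₂
  have hg : ∀ i, 0 ≤ p₁.real (Set.Ioi i) := fun i => measureReal_nonneg
  have hs := summable_tail hm₁
  have hsum := tsum_tail p₁
  have hs' : Summable fun i => |q.real (Set.Ioi i)| := by
    simpa only [abs_of_nonneg measureReal_nonneg] using summable_tail hq
  have h := tendsto_convolution (renewal_tendsto hg hs hsum hρ hT)
    (C := 1 / (1 - (∫⁻ j, (j : ℝ≥0∞) ∂p₁).toReal)) (fun n => by
      rw [abs_of_nonneg (renewal_nonneg hg (real_Ioi_zero_lt_one h0) hT n)]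
      exact renewal_le hg hs hsum hρ hT n) hs'
  rw [tsum_tail, one_div_mul_eq_div] at h
  exact h

/-- By the elementary renewal theorem `lowDescent` grows linearly with slope `1 / μ`, so each
summand divided by `L` has a limit; a linear bound on `lowDescent` provides the dominating series.
-/
lemma lowVisits_tendsto_critical {μ : ℝ} (h0 : p₁ {0} ≠ 0) (hm₁ : ∫⁻ j, (j : ℝ≥0∞) ∂p₁ ≠ ⊤)
    (hm₂ : ∫⁻ j, (j : ℝ≥0∞) ∂p₂ < 1) (hq : ∫⁻ j, (j : ℝ≥0∞) ∂q ≠ ⊤)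
    (hρ : (∫⁻ j, (j : ℝ≥0∞) ∂p₁).toReal = 1)
    (hμ : HasSum (fun j => ∑' i, p₁.real (Set.Ioi (i + (j + 1)))) μ) :
    Tendsto (fun L : ℕ => lowVisits p₁ p₂ q L / L) atTop
      (𝓝 ((∫⁻ j, (j : ℝ≥0∞) ∂q).toReal / μ)) := by
  have hT := lowDescent_eq h0 hm₁ hm₂
  have hg : ∀ i, 0 ≤ p₁.real (Set.Ioi i) := fun i => measureReal_nonneg
  have hg0 := real_Ioi_zero_lt_one h0
  have hlim := renewal_tendsto_critical hg (summable_tail hm₁) ((tsum_tail p₁).trans hρ) hg0 hT hμ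
  have hnn := renewal_nonneg hg hg0 hT
  obtain ⟨C, hC⟩ : ∃ C, ∀ m : ℕ, lowDescent p₁ p₂ m / (m + 1) ≤ C := by
    obtain ⟨C, hC⟩ := hlim.bddAbove_range
    exact ⟨C, fun m => hC ⟨m, rfl⟩⟩
  have hC0 : 0 ≤ C := le_trans (div_nonneg (hnn 0) (by positivity)) (hC 0)
  have h1 : ∀ L : ℕ, lowVisits p₁ p₂ q L / L =
      ∑' i, if i < L then lowDescent p₁ p₂ (L - 1 - i) / L * q.real (Set.Ioi i) else 0 := by
    intro n
    rw [tsum_eq_sum (s := Finset.range n), lowVisits, Finset.sum_div]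
    · refine Finset.sum_congr rfl fun i hi => ?_
      rw [if_pos (by simpa using hi)]
      ring
    · intro i hi
      rw [if_neg (by simpa using hi)]
  simp_rw [h1]
  rw [← tsum_tail, div_eq_mul_one_div, mul_comm, ← tsum_mul_left]
  refine tendsto_tsum_of_dominated_convergence (bound := fun i => C * q.real (Set.Ioi i))
    ((summable_tail hq).mul_left C) ?_ ?_
  · intro i
    -- Division by `n` is written as division by `n - i` followed by multiplication by `1 - i / n`.
    have h2 : Tendsto (fun n : ℕ => lowDescent p₁ p₂ (n - 1 - i) / ((n - 1 - i : ℕ) + 1) *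
        (1 - i * (1 / (n : ℝ))) * q.real (Set.Ioi i)) atTop
        (𝓝 (1 / μ * (1 - i * 0) * q.real (Set.Ioi i))) := by
      refine (Tendsto.mul (hlim.comp (g := fun m : ℕ => lowDescent p₁ p₂ m / (m + 1))
        (f := fun n : ℕ => n - 1 - i) ?_) ?_).mul_const _
      · simp_rw [Nat.sub_sub]
        exact tendsto_sub_atTop_nat _
      · exact (tendsto_one_div_atTop_nhds_zero_nat.const_mul _).const_sub 1
    simp only [mul_zero, sub_zero, mul_one] at h2
    refine h2.congr' ?_
    filter_upwards [eventually_gt_atTop i] with n hn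
    rw [if_pos hn]
    congr 1
    have h3 : ((n - 1 - i : ℕ) : ℝ) + 1 = n - i := by
      rw [show n - 1 - i = n - (1 + i) by omega, Nat.cast_sub (by omega)]
      push_cast
      ring
    have h4 : (0 : ℝ) < n := by exact_mod_cast (by omega : 0 < n)
    have h5 : (0 : ℝ) < n - i := by
      have : (i : ℝ) < n := by exact_mod_cast hn
      linarith
    rw [h3]
    field_simp
  · refine Eventually.of_forall fun n i => ?_
    split_ifs with hi
    · rw [norm_mul, Real.norm_of_nonneg measureReal_nonneg,
        Real.norm_of_nonneg (div_nonneg (hnn _) (by positivity))]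
      refine mul_le_mul_of_nonneg_right ?_ measureReal_nonneg
      refine le_trans (div_le_div_of_nonneg_left (hnn _) (by positivity) ?_) (hC (n - 1 - i))
      exact_mod_cast (by omega : n - 1 - i + 1 ≤ n)
    · simp only [norm_zero]
      positivity

/-- The splitting `φ ^ L = φ ^ (L - 1 - i + 1) * φ ^ i` distributes the tilting over the
convolution. The last factor of the limit is the generating function of the tails of `q` at `φ`. -/
lemma lowVisits_tendsto_supercritical {φ : ℝ} (h0 : p₁ {0} ≠ 0)
    (hm₁ : ∫⁻ j, (j : ℝ≥0∞) ∂p₁ ≠ ⊤) (hm₂ : ∫⁻ j, (j : ℝ≥0∞) ∂p₂ < 1)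
    (hq : ∫⁻ j, (j : ℝ≥0∞) ∂q ≠ ⊤) (hp : p₁ (Set.Ioi 1) ≠ 0) (hφ0 : 0 < φ) (hφ1 : φ < 1)
    (hφ : ∑' i, p₁.real (Set.Ioi i) * φ ^ i = 1) :
    Tendsto (fun L : ℕ => φ ^ L * lowVisits p₁ p₂ q L) atTop
      (𝓝 (1 / (1 - ∑' j, p₁.real {j} * (j * φ ^ (j - 1))) *
        ((1 - ∑' j, q.real {j} * φ ^ j) / (1 - φ)))) := by
  have hT := lowDescent_eq h0 hm₁ hm₂
  obtain ⟨⟨C, hC⟩, hlim⟩ := renewal_tendsto_tilt hm₁ hφ0 hφ1 hφ hp hT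
  have hn : ‖φ‖ ≤ 1 := by rw [Real.norm_of_nonneg hφ0.le]; exact hφ1.le
  have hs := summable_tail_mul_pow (p := q) (𝕜 := ℝ) hq (z := φ) hn
  have hsum := tsum_mass_mul_pow (p := q) (𝕜 := ℝ) hq (z := φ) hn
  simp only [RCLike.ofReal_real_eq_id, id_eq] at hs hsum
  have h := tendsto_convolution hlim hC hs.abs
  rw [hsum, sub_sub_cancel, mul_div_cancel_left₀ _ (by linarith)]
  refine h.congr fun L => ?_
  rw [lowVisits, Finset.mul_sum]
  refine Finset.sum_congr rfl fun i hi => ?_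
  have hi' := Finset.mem_range.1 hi
  have e : φ ^ L = φ ^ (L - 1 - i + 1) * φ ^ i := by
    rw [← pow_add]
    congr 1
    omega
  rw [e]
  ring

/-- A law on `{0, 1}` has mean at most one. -/
lemma real_Ioi_one_ne_zero {p : Measure ℕ} [IsProbabilityMeasure p]
    (hm : 1 < (∫⁻ j, (j : ℝ≥0∞) ∂p).toReal) : p (Set.Ioi 1) ≠ 0 := by
  intro h
  have h1 : ∫⁻ j, (j : ℝ≥0∞) ∂p ≤ 1 := by
    calc _ ≤ ∫⁻ _, 1 ∂p := by
          refine lintegral_mono_ae ?_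
          have h2 : ∀ᵐ j ∂p, j ∉ Set.Ioi 1 := measure_eq_zero_iff_ae_notMem.1 h
          filter_upwards [h2] with j hj
          have : j ≤ 1 := by simpa using hj
          exact_mod_cast this
      _ = 1 := by simp
  have := ENNReal.toReal_mono ENNReal.one_ne_top h1
  simp only [ENNReal.toReal_one] at this
  linarith

/-- After exchanging the sums, the tail beyond `i` is counted once for each `j < i`. The right side
is the expectation of `j` choose `2`, so the constant of the critical renewal theorem is a second
factorial moment up to the factor `2`. -/
lemma tsum_tsum_tail (p : Measure ℕ) :
    ∑' j, ∑' i, p (Set.Ioi (i + (j + 1))) = ∫⁻ j, ∑ i ∈ Finset.range j, (i : ℝ≥0∞) ∂p := by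
  rw [lintegral_sum_range]
  have h1 : ∀ n, ∑' i, p (Set.Ioi (i + n)) = ∑' i, if n ≤ i then p (Set.Ioi i) else 0 := by
    intro n
    rw [← (add_left_injective n).tsum_eq (f := fun i => if n ≤ i then p (Set.Ioi i) else 0)]
    · simp
    · intro i hi
      by_cases h : n ≤ i
      · exact ⟨i - n, Nat.sub_add_cancel h⟩
      · simp [h] at hi
  simp_rw [h1]
  rw [ENNReal.tsum_comm]
  refine tsum_congr fun i => ?_
  rw [tsum_eq_sum (s := Finset.range i)]
  · rw [Finset.sum_congr rfl fun j hj => if_pos (show j + 1 ≤ i by simpa using hj)]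
    simp
  · intro j hj
    rw [if_neg]
    simpa using hj

lemma hasSum_tsum_tail {p : Measure ℕ} [IsProbabilityMeasure p] (hm : ∫⁻ j, (j : ℝ≥0∞) ∂p ≠ ⊤)
    (h : ∫⁻ j, ∑ i ∈ Finset.range j, (i : ℝ≥0∞) ∂p ≠ ⊤) :
    HasSum (fun j => ∑' i, p.real (Set.Ioi (i + (j + 1))))
      (∫⁻ j, ∑ i ∈ Finset.range j, (i : ℝ≥0∞) ∂p).toReal := by
  rw [← tsum_tsum_tail] at h ⊢
  have := ENNReal.hasSum_toReal h
  rw [ENNReal.tsum_toReal_eq fun j => tsum_tail_add_ne_top hm _]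
  simpa only [toReal_tsum_tail_add] using this

end Batch

/-! ### Asymptotics of the stationary probabilities -/

section Stationary

variable {V : ℕ → ℝ} {E ρ₁ ρ₂ : ℝ}

lemma stationary_subcritical (hE : 0 < E) (hρ₁ : ρ₁ < 1) (hρ₂ : ρ₂ < 1)
    (hV : Tendsto V atTop (𝓝 (E / (1 - ρ₁)))) :
    Tendsto (fun L => E * (1 - ρ₂) / (E + (ρ₁ - ρ₂) * V L)) atTop (𝓝 (1 - ρ₁)) ∧
    Tendsto (fun L => ρ₂ * (E - (1 - ρ₁) * V L) / (E + (ρ₁ - ρ₂) * V L)) atTop (𝓝 0) := by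
  have h1 : 1 - ρ₁ ≠ 0 := by linarith
  have h2 : 1 - ρ₂ ≠ 0 := by linarith
  have hlim : E + (ρ₁ - ρ₂) * (E / (1 - ρ₁)) = E * (1 - ρ₂) / (1 - ρ₁) := by
    field_simp
    ring
  have hne : E * (1 - ρ₂) / (1 - ρ₁) ≠ 0 := div_ne_zero (mul_ne_zero hE.ne' h2) h1
  have hden : Tendsto (fun L => E + (ρ₁ - ρ₂) * V L) atTop (𝓝 (E * (1 - ρ₂) / (1 - ρ₁))) := by
    rw [← hlim]
    exact (hV.const_mul _).const_add _
  constructor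
  · have h := (tendsto_const_nhds (x := E * (1 - ρ₂))).div hden hne
    rwa [div_div_cancel₀ (mul_ne_zero hE.ne' h2)] at h
  · have h := (((hV.const_mul (1 - ρ₁)).const_sub E).const_mul ρ₂).div hden hne
    rwa [mul_div_cancel₀ _ h1, sub_self, mul_zero, zero_div] at h

/-- Dividing the denominator by `L` removes the constant `E` in the limit. The factor `1 - 1` is the
general formula's `1 - ρ₁` after substitution of `ρ₁ = 1`. -/
lemma stationary_critical {μ : ℝ} (hE : 0 < E) (hρ₂ : ρ₂ < 1) (hμ : 0 < μ)
    (hV : Tendsto (fun L : ℕ => V L / L) atTop (𝓝 (E / μ))) :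
    Tendsto (fun L : ℕ => (L : ℝ) * (E * (1 - ρ₂) / (E + (1 - ρ₂) * V L))) atTop (𝓝 μ) ∧
    Tendsto (fun L : ℕ => (L : ℝ) * (ρ₂ * (E - (1 - 1) * V L) / (E + (1 - ρ₂) * V L))) atTop
      (𝓝 (ρ₂ / (1 - ρ₂) * μ)) := by
  have h2 : 1 - ρ₂ ≠ 0 := by linarith
  have hden : Tendsto (fun L : ℕ => E * (1 / (L : ℝ)) + (1 - ρ₂) * (V L / L)) atTop
      (𝓝 (E * 0 + (1 - ρ₂) * (E / μ))) :=
    (tendsto_one_div_atTop_nhds_zero_nat.const_mul E).add (hV.const_mul _)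
  rw [mul_zero, zero_add] at hden
  have hne : (1 - ρ₂) * (E / μ) ≠ 0 := mul_ne_zero h2 (div_ne_zero hE.ne' hμ.ne')
  have key : ∀ c : ℝ, Tendsto (fun L : ℕ => (L : ℝ) * (c / (E + (1 - ρ₂) * V L))) atTop
      (𝓝 (c / ((1 - ρ₂) * (E / μ)))) := by
    intro c
    refine ((tendsto_const_nhds (x := c)).div hden hne).congr' ?_
    filter_upwards [eventually_gt_atTop 0] with L hL
    have hL' : (L : ℝ) ≠ 0 := by positivity
    have e : E * (1 / (L : ℝ)) + (1 - ρ₂) * (V L / L) = (E + (1 - ρ₂) * V L) / L := by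
      field_simp
    rw [Pi.div_apply, e, div_div_eq_mul_div]
    ring
  constructor
  · have h := key (E * (1 - ρ₂))
    have e : E * (1 - ρ₂) / ((1 - ρ₂) * (E / μ)) = μ := by
      rw [div_eq_iff hne]
      field_simp
    rwa [e] at h
  · have h := key (ρ₂ * E)
    have e : ρ₂ * E / ((1 - ρ₂) * (E / μ)) = ρ₂ / (1 - ρ₂) * μ := by
      rw [div_eq_iff hne, div_mul_eq_mul_div, div_mul_eq_mul_div, eq_div_iff h2]
      field_simp
    rw [e] at h
    simpa using h

/-- After multiplication of numerator and denominator by `φ ^ L` every term converges, and those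
without `V` vanish. -/
lemma stationary_supercritical {φ v : ℝ} (hρ₁ : 1 < ρ₁) (hρ₂ : ρ₂ < 1)
    (hφ0 : 0 < φ) (hφ1 : φ < 1) (hv : 0 < v)
    (hV : Tendsto (fun L : ℕ => φ ^ L * V L) atTop (𝓝 v)) :
    Tendsto (fun L : ℕ => E * (1 - ρ₂) / (E + (ρ₁ - ρ₂) * V L) / φ ^ L) atTop
      (𝓝 (E * (1 - ρ₂) / ((ρ₁ - ρ₂) * v))) ∧
    Tendsto (fun L => ρ₂ * (E - (1 - ρ₁) * V L) / (E + (ρ₁ - ρ₂) * V L)) atTop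
      (𝓝 (ρ₂ * (ρ₁ - 1) / (ρ₁ - ρ₂))) := by
  have h1 : ρ₁ - ρ₂ ≠ 0 := by linarith
  have hpow : Tendsto (fun L : ℕ => E * φ ^ L) atTop (𝓝 (E * 0)) :=
    (tendsto_pow_atTop_nhds_zero_of_lt_one hφ0.le hφ1).const_mul E
  have hden : Tendsto (fun L : ℕ => E * φ ^ L + (ρ₁ - ρ₂) * (φ ^ L * V L)) atTop
      (𝓝 (E * 0 + (ρ₁ - ρ₂) * v)) := hpow.add (hV.const_mul _)
  have hnum : Tendsto (fun L : ℕ => ρ₂ * (E * φ ^ L - (1 - ρ₁) * (φ ^ L * V L))) atTop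
      (𝓝 (ρ₂ * (E * 0 - (1 - ρ₁) * v))) := (hpow.sub (hV.const_mul _)).const_mul _
  simp only [mul_zero, zero_add, zero_sub] at hden hnum
  have hne : (ρ₁ - ρ₂) * v ≠ 0 := mul_ne_zero h1 hv.ne'
  have e2 : ∀ L, E * φ ^ L + (ρ₁ - ρ₂) * (φ ^ L * V L) = φ ^ L * (E + (ρ₁ - ρ₂) * V L) :=
    fun L => by ring
  constructor
  · refine ((tendsto_const_nhds (x := E * (1 - ρ₂))).div hden hne).congr fun L => ?_
    rw [Pi.div_apply, div_div, e2, mul_comm (φ ^ L)]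
  · have e : ρ₂ * -((1 - ρ₁) * v) / ((ρ₁ - ρ₂) * v) = ρ₂ * (ρ₁ - 1) / (ρ₁ - ρ₂) := by
      rw [div_eq_div_iff hne h1]
      ring
    rw [← e]
    refine (hnum.div hden hne).congr fun L => ?_
    have : φ ^ L ≠ 0 := by positivity
    have e1 : ρ₂ * (E * φ ^ L - (1 - ρ₁) * (φ ^ L * V L)) =
        φ ^ L * (ρ₂ * (E - (1 - ρ₁) * V L)) := by ring
    rw [Pi.div_apply, e1, e2, mul_div_mul_left _ _ this]

end Stationary

/-! ### A renewal theorem for Volterra equations with a nonincreasing kernel -/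

section Volterra

/-- In the supremum norm weighted by `exp (-(2 * K * x))`, integration from `0` followed by
multiplication by `K` has norm at most `1 / 2`. The weighted supremum, finite because `ψ ≤ 2`,
therefore satisfies `S ≤ η + S / 2`. No continuity is needed. -/
lemma gronwall_bounded {ψ : ℝ → ℝ} {H K η : ℝ} (hψ : Measurable ψ) (h0 : ∀ v, 0 ≤ ψ v)
    (h2 : ∀ v, ψ v ≤ 2) (hK : 0 < K) (hη : 0 ≤ η)
    (h : ∀ x ∈ Set.Icc 0 H, ψ x ≤ η + K * ∫ v in (0 : ℝ)..x, ψ v) :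
    ∀ x ∈ Set.Icc 0 H, ψ x ≤ 2 * η * Real.exp (2 * K * x) := by
  intro x hx
  have hbdd : BddAbove ((fun y => Real.exp (-(2 * K * y)) * ψ y) '' Set.Icc 0 H) := by
    refine ⟨2, ?_⟩
    rintro _ ⟨y, hy, rfl⟩
    have : Real.exp (-(2 * K * y)) ≤ 1 := by
      rw [Real.exp_le_one_iff]
      have := mul_nonneg hK.le hy.1
      linarith
    calc _ ≤ 1 * 2 := mul_le_mul this (h2 y) (h0 y) zero_le_one
      _ = 2 := by norm_num
  set S := sSup ((fun y => Real.exp (-(2 * K * y)) * ψ y) '' Set.Icc 0 H) with hS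
  have hle : ∀ y ∈ Set.Icc 0 H, ψ y ≤ S * Real.exp (2 * K * y) := by
    intro y hy
    have h1 : Real.exp (-(2 * K * y)) * ψ y ≤ S := le_csSup hbdd ⟨y, hy, rfl⟩
    calc ψ y = Real.exp (-(2 * K * y)) * ψ y * Real.exp (2 * K * y) := by
          rw [mul_right_comm, ← Real.exp_add]
          simp
      _ ≤ _ := mul_le_mul_of_nonneg_right h1 (Real.exp_pos _).le
  have hS0 : 0 ≤ S := by
    refine Real.sSup_nonneg ?_
    rintro _ ⟨y, _, rfl⟩
    exact mul_nonneg (Real.exp_pos _).le (h0 y)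
  have hinteg : ∀ y ∈ Set.Icc 0 H, K * ∫ v in (0 : ℝ)..y, ψ v ≤ S / 2 * Real.exp (2 * K * y) := by
    intro y hy
    have h3 : ∫ v in (0 : ℝ)..y, ψ v ≤ ∫ v in (0 : ℝ)..y, S * Real.exp (2 * K * v) := by
      refine intervalIntegral.integral_mono_on hy.1 ?_ ?_ fun v hv => hle v ⟨hv.1, hv.2.trans hy.2⟩
      · rw [intervalIntegrable_iff]
        exact Measure.integrableOn_of_bounded (M := 2) (by simp) hψ.aestronglyMeasurable
          (Eventually.of_forall fun v => by rw [Real.norm_of_nonneg (h0 v)]; exact h2 v)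
      · exact (Continuous.intervalIntegrable (by fun_prop) _ _)
    have h4 : ∫ v in (0 : ℝ)..y, S * Real.exp (2 * K * v) =
        S * ((Real.exp (2 * K * y) - 1) / (2 * K)) := by
      rw [intervalIntegral.integral_const_mul]
      congr 1
      have h5 : ∀ v ∈ Set.uIcc 0 y, HasDerivAt (fun v => Real.exp (2 * K * v) / (2 * K))
          (Real.exp (2 * K * v)) v := by
        intro v _
        have h6 : HasDerivAt (fun v => 2 * K * v) (2 * K) v := by
          simpa using (hasDerivAt_id v).const_mul (2 * K)
        have h7 := h6.exp.div_const (2 * K)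
        rwa [mul_div_cancel_right₀ _ (by positivity)] at h7
      rw [intervalIntegral.integral_eq_sub_of_hasDerivAt h5
        (Continuous.intervalIntegrable (by fun_prop) _ _)]
      simp
      ring
    rw [h4] at h3
    calc K * ∫ v in (0 : ℝ)..y, ψ v ≤ K * (S * ((Real.exp (2 * K * y) - 1) / (2 * K))) :=
          mul_le_mul_of_nonneg_left h3 hK.le
      _ = S / 2 * (Real.exp (2 * K * y) - 1) := by field_simp
      _ ≤ _ := mul_le_mul_of_nonneg_left (by linarith) (by positivity)
  have hSle : S ≤ η + S / 2 := by
    refine csSup_le ⟨_, x, hx, rfl⟩ ?_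
    rintro _ ⟨y, hy, rfl⟩
    have h7 : ψ y ≤ η + S / 2 * Real.exp (2 * K * y) := (h y hy).trans (by linarith [hinteg y hy])
    have h8 : Real.exp (-(2 * K * y)) ≤ 1 := by
      rw [Real.exp_le_one_iff]
      have := mul_nonneg hK.le hy.1
      linarith
    calc Real.exp (-(2 * K * y)) * ψ y
        ≤ Real.exp (-(2 * K * y)) * (η + S / 2 * Real.exp (2 * K * y)) :=
          mul_le_mul_of_nonneg_left h7 (Real.exp_pos _).le
      _ = Real.exp (-(2 * K * y)) * η + S / 2 := by
          rw [mul_add, mul_left_comm, ← Real.exp_add]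
          simp
      _ ≤ _ := by
          have := mul_le_of_le_one_left hη h8
          linarith
  refine (hle x hx).trans (mul_le_mul_of_nonneg_right (by linarith) (Real.exp_pos _).le)

variable {u k : ℝ → ℝ} {c : ℝ}

/-- Subtract the equations at `t` and `t - x`. For `v ≥ x` the kernel difference `k v - k (v - x)`
is nonpositive, while `M - u` is almost nonnegative at late times; distant lags carry little mass.
So if `u t` is close to the limit superior `M`, the defect on the window before `t` satisfies a
Gronwall inequality, and `u` is close to `M` on the whole window. -/
lemma volterra_near_limsup (hu : Measurable u) (hub : ∀ t, |u t| ≤ 1) (hk0 : ∀ v, 0 ≤ k v)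
    (hkneg : ∀ v < 0, k v = 0) (hkanti : AntitoneOn k (Set.Ici 0)) (hki : Integrable k)
    (heq : ∀ t, 0 ≤ t → u t + ∫ v, k v * u (t - v) = c) {H ε : ℝ} (hH : 0 ≤ H) (hε : 0 < ε) :
    ∃ᶠ t in atTop, ∀ h ∈ Set.Icc 0 H, |limsup u atTop - u (t - h)| ≤ ε := by
  set M := limsup u atTop with hM
  set J := ∫ v, k v with hJ
  have hJ0 : 0 ≤ J := integral_nonneg hk0
  have hbdd : IsBoundedUnder (· ≤ ·) atTop u :=
    isBoundedUnder_of ⟨1, fun t => (abs_le.1 (hub t)).2⟩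
  have hcob : IsCoboundedUnder (· ≤ ·) atTop u :=
    (isBoundedUnder_of (r := (· ≥ ·)) ⟨-1, fun t => (abs_le.1 (hub t)).1⟩).isCoboundedUnder_le
  have hM1 : M ≤ 1 := limsup_le_of_le hcob (Eventually.of_forall fun t => (abs_le.1 (hub t)).2)
  have hM2 : -1 ≤ M := le_limsup_of_frequently_le
    (Eventually.of_forall fun t => (abs_le.1 (hub t)).1).frequently hbdd
  set K := k 0 + 1 with hKdef
  have hK : 0 < K := by linarith [hk0 0]
  have hkK : ∀ v, k v ≤ K := by
    intro v
    rcases lt_or_ge v 0 with hv | hv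
    · rw [hkneg v hv]
      exact hK.le
    · have := hkanti Set.self_mem_Ici hv hv
      linarith
  -- Chosen so that the final Gronwall bound `2 * (J + 5) * δ * exp (2 * K * H)` equals `ε`.
  set δ := ε / (2 * (J + 5) * Real.exp (2 * K * H)) with hδ
  have hden : 0 < 2 * (J + 5) * Real.exp (2 * K * H) := by positivity
  have hδ0 : 0 < δ := div_pos hε hden
  obtain ⟨T₀, hT₀⟩ : ∃ T₀, ∀ t ≥ T₀, u t < M + δ :=
    eventually_atTop.1 (eventually_lt_of_limsup_lt (by linarith) hbdd)
  -- Lags beyond `A`, for which `u` may be evaluated before `T₀`, carry kernel mass at most `δ`.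
  obtain ⟨A, hA0, hA⟩ : ∃ A : ℝ, 0 ≤ A ∧ ∫ v in Set.Ioi A, k v ≤ δ := by
    have h1 := tendsto_setIntegral_of_antitone (μ := volume) (f := k) (s := fun n : ℕ => Set.Ioi (n : ℝ))
      (fun n => measurableSet_Ioi) (fun m n hmn => Set.Ioi_subset_Ioi (by exact_mod_cast hmn))
      ⟨0, hki.integrableOn⟩
    have h2 : ⋂ n : ℕ, Set.Ioi (n : ℝ) = ∅ := by
      ext x
      simp only [Set.mem_iInter, Set.mem_Ioi, Set.mem_empty_iff_false, iff_false, not_forall, not_lt]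
      exact exists_nat_ge x
    rw [h2] at h1
    simp only [setIntegral_empty] at h1
    obtain ⟨n, hn⟩ := (h1.eventually_lt_const hδ0).exists
    exact ⟨n, Nat.cast_nonneg n, hn.le⟩
  have hfreq : ∃ᶠ t in atTop, M - δ < u t := frequently_lt_of_lt_limsup hcob (by linarith)
  refine (hfreq.and_eventually (eventually_ge_atTop (|T₀| + A + H))).mono ?_
  rintro t ⟨ht, htge⟩
  have hT0a := le_abs_self T₀
  have hT0n := abs_nonneg T₀
  set ψ : ℝ → ℝ := fun v => |M - u (t - v)| with hψ
  have hψm : Measurable ψ := by fun_prop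
  have hψ2 : ∀ v, ψ v ≤ 2 := by
    intro v
    have := abs_le.1 (hub (t - v))
    rw [hψ]
    simp only [abs_le]
    constructor <;> linarith
  -- Of the constant `J + 5`, the integral estimate contributes `J + 2`, the choice of `t`
  -- contributes `1`, and the passage to the absolute value contributes `2`.
  have hmain : ∀ x ∈ Set.Icc 0 H, ψ x ≤ (J + 5) * δ + K * ∫ v in (0 : ℝ)..x, ψ v := by
    intro x hx
    have hum : ∀ s, Measurable fun v => u (s - v) := fun s => by fun_prop
    have hinteg : ∀ {w : ℝ → ℝ} (_ : Integrable w) (s : ℝ), Integrable fun v => w v * u (s - v) := by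
      intro w hw s
      refine hw.mul_bdd (c := 1) (hum s).aestronglyMeasurable (Eventually.of_forall fun v => ?_)
      exact hub _
    have hks : Integrable fun v => k (v - x) := hki.comp_sub_right x
    have e1 := heq t (by linarith)
    have e2 := heq (t - x) (by linarith [hx.2])
    have e3 : ∫ v, k v * u (t - x - v) = ∫ v, k (v - x) * u (t - v) := by
      rw [← integral_sub_right_eq_self _ x]
      simp
    have e4 : ∫ v, k (v - x) = J := integral_sub_right_eq_self _ x
    have hid : (M - u (t - x)) - (M - u t) = ∫ v, (k v - k (v - x)) * (M - u (t - v)) := by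
      have e5 : (fun v => (k v - k (v - x)) * (M - u (t - v))) = fun v =>
          (M * k v - M * k (v - x)) - (k v * u (t - v) - k (v - x) * u (t - v)) := by
        ext v
        ring
      have hJ1 : Integrable fun v => M * k v - M * k (v - x) :=
        (hki.const_mul M).sub (hks.const_mul M)
      have hJ2 : Integrable fun v => k v * u (t - v) - k (v - x) * u (t - v) :=
        (hinteg hki t).sub (hinteg hks t)
      rw [e5, integral_sub hJ1 hJ2, integral_sub (hki.const_mul M) (hks.const_mul M),
        integral_sub (hinteg hki t) (hinteg hks t), integral_const_mul, integral_const_mul, e4, ← e3]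
      linarith
    -- Below `0` both kernels vanish; strictly between `0` and `x` only `k v` remains; from `x` on
    -- the difference is nonpositive and `M - u ≥ -δ`, except at lags beyond `A`, where the crude
    -- bound `2` is used. The point `0`, outside `Set.Ioc 0 x`, gets its own term of integral zero.
    have hpt : ∀ v, (k v - k (v - x)) * (M - u (t - v)) ≤
        (Set.Ioc 0 x).indicator (fun v => K * ψ v) v + (δ * k (v - x) +
          2 * (Set.Ioi A).indicator k (v - x)) + (({0} : Set ℝ).indicator (fun _ => 2 * K) v) := by
      intro v
      have hψv : M - u (t - v) ≤ ψ v := le_abs_self _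
      have hψv' : -ψ v ≤ M - u (t - v) := neg_abs_le _
      have hi1 : 0 ≤ (Set.Ioc 0 x).indicator (fun v => K * ψ v) v :=
        Set.indicator_nonneg (fun v _ => mul_nonneg hK.le (abs_nonneg _)) v
      have hi2 : 0 ≤ (Set.Ioi A).indicator k (v - x) := Set.indicator_nonneg (fun v _ => hk0 v) _
      have hi3 : 0 ≤ ({0} : Set ℝ).indicator (fun _ => 2 * K) v :=
        Set.indicator_nonneg (fun v _ => by positivity) v
      have hi4 : 0 ≤ δ * k (v - x) := mul_nonneg hδ0.le (hk0 _)
      rcases lt_trichotomy v 0 with hv | hv | hv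
      · rw [hkneg v hv, hkneg (v - x) (by linarith [hx.1]), sub_self, zero_mul] at *
        positivity
      · have h9 : (k v - k (v - x)) * (M - u (t - v)) ≤ K * 2 := by
          have h10 : |k v - k (v - x)| ≤ K := by
            rw [abs_le]
            constructor <;> linarith [hk0 v, hk0 (v - x), hkK v, hkK (v - x)]
          calc _ ≤ |(k v - k (v - x)) * (M - u (t - v))| := le_abs_self _
            _ = |k v - k (v - x)| * ψ v := abs_mul _ _
            _ ≤ _ := mul_le_mul h10 (hψ2 v) (abs_nonneg _) hK.le
        have : ({0} : Set ℝ).indicator (fun _ => 2 * K) v = 2 * K := by simp [hv]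
        linarith
      · by_cases hvx : v < x
        · rw [hkneg (v - x) (by linarith), sub_zero,
            Set.indicator_of_mem (show v ∈ Set.Ioc 0 x from ⟨hv, hvx.le⟩)]
          have h11 : k v * (M - u (t - v)) ≤ K * ψ v :=
            (mul_le_mul_of_nonneg_left hψv (hk0 v)).trans
              (mul_le_mul_of_nonneg_right (hkK v) (abs_nonneg _))
          linarith
        · have hkle : k v ≤ k (v - x) :=
            hkanti (show v - x ∈ Set.Ici 0 by simp; linarith) (show v ∈ Set.Ici 0 from hv.le)
              (by linarith [hx.1])
          have hd : 0 ≤ k (v - x) - k v := by linarith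
          by_cases hvA : A < v - x
          · rw [Set.indicator_of_mem (show v - x ∈ Set.Ioi A from hvA)]
            have h12 : (k v - k (v - x)) * (M - u (t - v)) ≤ 2 * k (v - x) := by
              have h13 : (k (v - x) - k v) * (-(M - u (t - v))) ≤ k (v - x) * 2 := by
                refine (mul_le_mul_of_nonneg_left (show -(M - u (t - v)) ≤ 2 by
                  linarith [hψ2 v]) hd).trans ?_
                linarith [hk0 v]
              linarith
            linarith
          · have h14 : u (t - v) < M + δ := hT₀ _ (by
              have := hx.2
              linarith)
            have h15 : (k (v - x) - k v) * (-(M - u (t - v))) ≤ k (v - x) * δ := by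
              refine (mul_le_mul_of_nonneg_left (show -(M - u (t - v)) ≤ δ by linarith) hd).trans ?_
              nlinarith [hk0 v]
            linarith
    have hI1 : Integrable ((Set.Ioc 0 x).indicator fun v => K * ψ v) := by
      rw [integrable_indicator_iff measurableSet_Ioc]
      refine Measure.integrableOn_of_bounded (M := K * 2) (by simp)
        (hψm.const_mul K).aestronglyMeasurable (Eventually.of_forall fun v => ?_)
      rw [Real.norm_of_nonneg (mul_nonneg hK.le (abs_nonneg _))]
      exact mul_le_mul_of_nonneg_left (hψ2 v) hK.le
    have hI2 : Integrable fun v => (Set.Ioi A).indicator k (v - x) :=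
      (hki.indicator measurableSet_Ioi).comp_sub_right x
    have hI3 : Integrable (({0} : Set ℝ).indicator fun _ => 2 * K) := by
      rw [integrable_indicator_iff (measurableSet_singleton 0)]
      exact integrableOn_const (by simp)
    have hI4 : Integrable fun v => δ * k (v - x) + 2 * (Set.Ioi A).indicator k (v - x) :=
      (hks.const_mul δ).add (hI2.const_mul 2)
    have hfin : ∫ v, (k v - k (v - x)) * (M - u (t - v)) ≤
        K * (∫ v in (0 : ℝ)..x, ψ v) + (δ * J + 2 * δ) := by
      have hI0 : Integrable fun v => (k v - k (v - x)) * (M - u (t - v)) := by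
        refine (hki.sub hks).mul_bdd (c := 2)
          (measurable_const.sub (hum t)).aestronglyMeasurable (Eventually.of_forall fun v => hψ2 v)
      have hI5 : Integrable fun v => (Set.Ioc 0 x).indicator (fun v => K * ψ v) v +
          (δ * k (v - x) + 2 * (Set.Ioi A).indicator k (v - x)) := hI1.add hI4
      have hI6 : Integrable fun v => (Set.Ioc 0 x).indicator (fun v => K * ψ v) v +
          (δ * k (v - x) + 2 * (Set.Ioi A).indicator k (v - x)) +
            (({0} : Set ℝ).indicator (fun _ => 2 * K) v) := hI5.add hI3
      refine (integral_mono hI0 hI6 hpt).trans ?_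
      rw [integral_add hI5 hI3, integral_add hI1 hI4,
        integral_add (hks.const_mul δ) (hI2.const_mul 2), integral_const_mul, integral_const_mul, e4,
        integral_sub_right_eq_self (fun v => (Set.Ioi A).indicator k v) x,
        integral_indicator measurableSet_Ioi, integral_indicator measurableSet_Ioc,
        integral_indicator (measurableSet_singleton 0), integral_const_mul,
        intervalIntegral.integral_of_le hx.1]
      simp
      linarith
    rw [← hid] at hfin
    have h16 : u (t - x) < M + δ := hT₀ _ (by linarith [hx.2])
    have h17 : ψ x ≤ (M - u (t - x)) + 2 * δ := by
      rw [hψ]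
      simp only [abs_le]
      constructor <;> linarith
    have : (J + 5) * δ = δ * J + 5 * δ := by ring
    linarith
  intro x hx
  refine (gronwall_bounded hψm (fun v => abs_nonneg _) hψ2 hK (by positivity) hmain x hx).trans ?_
  calc 2 * ((J + 5) * δ) * Real.exp (2 * K * x) ≤ 2 * ((J + 5) * δ) * Real.exp (2 * K * H) := by
        refine mul_le_mul_of_nonneg_left (Real.exp_le_exp.2 ?_) (by positivity)
        exact mul_le_mul_of_nonneg_left hx.2 (by positivity)
    _ = δ * (2 * (J + 5) * Real.exp (2 * K * H)) := by ring
    _ = ε := div_mul_cancel₀ _ hden.ne'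

/-- There are times `t n` such that `u` is within `1 / (n + 1)` of its limit superior `M` on a
window of length `n` before `t n`. Along them dominated convergence turns the equation into `M + M *
∫ k = c`. -/
lemma volterra_limsup (hu : Measurable u) (hub : ∀ t, |u t| ≤ 1) (hk0 : ∀ v, 0 ≤ k v)
    (hkneg : ∀ v < 0, k v = 0) (hkanti : AntitoneOn k (Set.Ici 0)) (hki : Integrable k)
    (heq : ∀ t, 0 ≤ t → u t + ∫ v, k v * u (t - v) = c) :
    limsup u atTop = c / (1 + ∫ v, k v) := by
  have h1 : ∀ n : ℕ, ∃ t : ℝ, (n : ℝ) ≤ t ∧ ∀ h ∈ Set.Icc 0 (n : ℝ),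
      |limsup u atTop - u (t - h)| ≤ 1 / ((n : ℝ) + 1) := by
    intro n
    obtain ⟨t, ht, h⟩ := ((volterra_near_limsup hu hub hk0 hkneg hkanti hki heq
      (Nat.cast_nonneg n) (Nat.one_div_pos_of_nat (n := n))).and_eventually
        (eventually_ge_atTop (n : ℝ))).exists
    exact ⟨t, h, ht⟩
  choose t ht hth using h1
  set M := limsup u atTop
  have hlim : ∀ v, 0 ≤ v → Tendsto (fun n => u (t n - v)) atTop (𝓝 M) := by
    intro v hv
    rw [tendsto_iff_dist_tendsto_zero]
    refine squeeze_zero' (Eventually.of_forall fun n => dist_nonneg) ?_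
      tendsto_one_div_add_atTop_nhds_zero_nat
    filter_upwards [eventually_ge_atTop ⌈v⌉₊] with n hn
    rw [dist_comm]
    exact hth n v ⟨hv, (Nat.le_ceil v).trans (by exact_mod_cast hn)⟩
  have hconv : Tendsto (fun n => ∫ v, k v * u (t n - v)) atTop (𝓝 (∫ v, k v * M)) := by
    refine tendsto_integral_of_dominated_convergence k (fun n => ?_) hki
      (fun n => Eventually.of_forall fun v => ?_) (Eventually.of_forall fun v => ?_)
    · exact hki.aestronglyMeasurable.mul (Measurable.aestronglyMeasurable (by fun_prop))
    · rw [norm_mul, Real.norm_of_nonneg (hk0 v)]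
      exact mul_le_of_le_one_right (hk0 v) (hub _)
    · rcases lt_or_ge v 0 with hv | hv
      · simp [hkneg v hv]
      · exact (hlim v hv).const_mul _
  have h2 : Tendsto (fun n => u (t n - 0) + ∫ v, k v * u (t n - v)) atTop
      (𝓝 (M + ∫ v, k v * M)) := (hlim 0 le_rfl).add hconv
  have h3 : (fun n => u (t n - 0) + ∫ v, k v * u (t n - v)) = fun _ => c := by
    ext n
    rw [sub_zero]
    exact heq _ ((Nat.cast_nonneg n).trans (ht n))
  rw [h3, integral_mul_const] at h2
  have h4 := tendsto_nhds_unique tendsto_const_nhds h2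
  have h5 : 0 ≤ ∫ v, k v := integral_nonneg hk0
  rw [eq_div_iff (by linarith), h4]
  ring

/-- A bounded solution of `u + k * u = c` with a nonincreasing integrable kernel converges. -/
lemma volterra_tendsto (hu : Measurable u) (hub : ∀ t, |u t| ≤ 1) (hk0 : ∀ v, 0 ≤ k v)
    (hkneg : ∀ v < 0, k v = 0) (hkanti : AntitoneOn k (Set.Ici 0)) (hki : Integrable k)
    (heq : ∀ t, 0 ≤ t → u t + ∫ v, k v * u (t - v) = c) :
    Tendsto u atTop (𝓝 (c / (1 + ∫ v, k v))) := by
  have h1 := volterra_limsup hu hub hk0 hkneg hkanti hki heq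
  -- Applied to `-u`, the same computation shows that the limit inferior has the same value.
  have h2 := volterra_limsup (u := fun t => -u t) (c := -c) hu.neg (fun t => by simpa using hub t)
    hk0 hkneg hkanti hki (fun t ht => by
      rw [← heq t ht]
      simp only [mul_neg, integral_neg]
      ring)
  have hb1 : IsBoundedUnder (· ≤ ·) atTop u :=
    isBoundedUnder_of ⟨1, fun t => (abs_le.1 (hub t)).2⟩
  have hb2 : IsBoundedUnder (· ≤ ·) atTop fun t => -u t :=
    isBoundedUnder_of ⟨1, fun t => by linarith [(abs_le.1 (hub t)).1]⟩
  refine tendsto_order.2 ⟨fun a ha => ?_, fun a ha => ?_⟩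
  · have h3 : limsup (fun t => -u t) atTop < -a := by
      rw [h2, neg_div]
      linarith
    filter_upwards [eventually_lt_of_limsup_lt h3 hb2] with t ht
    linarith
  · exact eventually_lt_of_limsup_lt (by rw [h1]; exact ha) hb1

end Volterra

/-! ### The compound Poisson input during a service -/

section CompoundPoisson

/-- The law of the sum of `n` independent variables with law `r`. -/
def convPow (r : Measure ℕ) : ℕ → Measure ℕ
  | 0 => Measure.dirac 0
  | n + 1 => (r.prod (convPow r n)).map fun p => p.1 + p.2

/-- The probability that a Poisson process of rate `lam` has `n` points in `[0, y]`. -/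
def poissonWeight (lam : ℝ) (n : ℕ) (y : ℝ) : ℝ≥0∞ :=
  ENNReal.ofReal (Real.exp (-(lam * y)) * (lam * y) ^ n / n.factorial)

/-- Expectation of `v` under the law of the number of customers that arrive within time `y`. -/
def inputMean (lam : ℝ) (r : Measure ℕ) (y : ℝ) (v : ℕ → ℝ≥0∞) : ℝ≥0∞ :=
  ∑' n, poissonWeight lam n y * ∫⁻ j, v j ∂(convPow r n)

/-- The joint law of a service time with law `B` and of the number of customers that arrive during
this service. -/
def serviceLaw (lam : ℝ) (r : Measure ℕ) (B : Measure ℝ) : Measure (ℝ × ℕ) :=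
  Measure.sum fun n => (B.withDensity (poissonWeight lam n)).prod (convPow r n)

/-- The law of the number of customers that arrive during a service with law `B`. -/
def inputLaw (lam : ℝ) (r : Measure ℕ) (B : Measure ℝ) : Measure ℕ :=
  (serviceLaw lam r B).map Prod.snd

variable {lam : ℝ} {r : Measure ℕ} {B : Measure ℝ}

lemma lintegral_convPow_succ (n : ℕ) (v : ℕ → ℝ≥0∞) :
    ∫⁻ j, v j ∂(convPow r (n + 1)) = ∫⁻ i, ∫⁻ j, v (i + j) ∂(convPow r n) ∂r := by
  rw [convPow, lintegral_map Measurable.of_discrete Measurable.of_discrete,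
    lintegral_prod _ Measurable.of_discrete.aemeasurable]

lemma measurable_poissonWeight (n : ℕ) : Measurable (poissonWeight lam n) := by
  unfold poissonWeight
  fun_prop

lemma tsum_poissonWeight (hlam : 0 < lam) {y : ℝ} (hy : 0 ≤ y) :
    ∑' n, poissonWeight lam n y = 1 := by
  unfold poissonWeight
  have h1 : HasSum (fun n : ℕ => Real.exp (-(lam * y)) * ((lam * y) ^ n / n.factorial)) 1 := by
    have h2 := (NormedSpace.expSeries_div_hasSum_exp (lam * y)).mul_left (Real.exp (-(lam * y)))
    rwa [← Real.exp_eq_exp_ℝ, ← Real.exp_add, neg_add_cancel, Real.exp_zero] at h2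
  simp_rw [mul_div_assoc]
  rw [← ENNReal.ofReal_tsum_of_nonneg (fun n => by positivity) h1.summable, h1.tsum_eq]
  simp

lemma poissonWeight_succ_mul (hlam : 0 < lam) {y : ℝ} (hy : 0 ≤ y) (n : ℕ) :
    poissonWeight lam (n + 1) y * ((n + 1 : ℕ) : ℝ≥0∞) =
      ENNReal.ofReal (lam * y) * poissonWeight lam n y := by
  unfold poissonWeight
  rw [← ENNReal.ofReal_natCast, ← ENNReal.ofReal_mul (by positivity),
    ← ENNReal.ofReal_mul (by positivity)]
  congr 1
  rw [Nat.factorial_succ]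
  push_cast
  field_simp
  ring

lemma tsum_poissonWeight_mul (hlam : 0 < lam) {y : ℝ} (hy : 0 ≤ y) :
    ∑' n : ℕ, poissonWeight lam n y * (n : ℝ≥0∞) = ENNReal.ofReal (lam * y) := by
  rw [tsum_eq_zero_add' ENNReal.summable]
  simp_rw [poissonWeight_succ_mul hlam hy]
  rw [ENNReal.tsum_mul_left, tsum_poissonWeight hlam hy]
  simp

lemma two_mul_sum_range (n : ℕ) :
    2 * ∑ i ∈ Finset.range (n + 1), (i : ℝ≥0∞) = ((n + 1 : ℕ) : ℝ≥0∞) * n := by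
  have := congrArg (Nat.cast : ℕ → ℝ≥0∞) (Finset.sum_range_id_mul_two (n + 1))
  rw [Nat.add_sub_cancel, Nat.cast_mul, Nat.cast_mul, Nat.cast_sum, Nat.cast_two] at this
  rw [mul_comm, this]

/-- The inner sum is `n` choose `2`; this is the second factorial moment of the Poisson law in a
form free of subtraction. -/
lemma tsum_poissonWeight_mul_sum (hlam : 0 < lam) {y : ℝ} (hy : 0 ≤ y) :
    2 * ∑' n, poissonWeight lam n y * ∑ i ∈ Finset.range n, (i : ℝ≥0∞) =
      ENNReal.ofReal (lam * y) ^ 2 := by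
  have h : ∑' n : ℕ, poissonWeight lam n y * (2 * ∑ i ∈ Finset.range n, (i : ℝ≥0∞)) =
      ∑' n : ℕ, ENNReal.ofReal (lam * y) * (poissonWeight lam n y * n) := by
    rw [tsum_eq_zero_add' ENNReal.summable]
    simp only [Finset.range_zero, Finset.sum_empty, mul_zero, zero_add]
    refine tsum_congr fun n => ?_
    rw [two_mul_sum_range, ← mul_assoc, poissonWeight_succ_mul hlam hy, mul_assoc]
  rw [← ENNReal.tsum_mul_left]
  simp_rw [mul_left_comm (2 : ℝ≥0∞)]
  rw [h, ENNReal.tsum_mul_left, tsum_poissonWeight_mul hlam hy, sq]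

lemma lintegral_serviceLaw [SFinite B] {F : ℝ × ℕ → ℝ≥0∞} (hF : Measurable F) :
    ∫⁻ p, F p ∂(serviceLaw lam r B) = ∫⁻ x, inputMean lam r x (fun j => F (x, j)) ∂B := by
  unfold inputMean
  rw [serviceLaw, lintegral_sum_measure, lintegral_tsum]
  · refine tsum_congr fun n => ?_
    rw [lintegral_prod _ hF.aemeasurable,
      lintegral_withDensity_eq_lintegral_mul _ (measurable_poissonWeight n)]
    · rfl
    · exact hF.lintegral_prod_right'
  · intro n
    exact ((measurable_poissonWeight n).mul hF.lintegral_prod_right').aemeasurable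

lemma lintegral_inputLaw [SFinite B] (v : ℕ → ℝ≥0∞) :
    ∫⁻ j, v j ∂(inputLaw lam r B) = ∫⁻ x, inputMean lam r x v ∂B := by
  rw [inputLaw, lintegral_map Measurable.of_discrete measurable_snd, lintegral_serviceLaw]
  exact Measurable.of_discrete.comp measurable_snd

lemma integral_pow_convPow (z : ℂ) (n : ℕ) :
    ∫ j, z ^ j ∂(convPow r n) = (∫ j, z ^ j ∂r) ^ n := by
  induction n with
  | zero => simp [convPow]
  | succ n ih =>
    rw [convPow, integral_map Measurable.of_discrete.aemeasurable
      Measurable.of_discrete.aestronglyMeasurable]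
    simp_rw [pow_add]
    rw [integral_prod_mul (fun i : ℕ => z ^ i) (fun j : ℕ => z ^ j), ih, pow_one]
    ring

/-- With probability at least `∫ exp (-(lam * x)) ∂B > 0` no batch arrives during the service. -/
lemma inputLaw_zero_ne_zero [IsProbabilityMeasure B] : inputLaw lam r B {0} ≠ 0 := by
  rw [← lintegral_indicator_one (MeasurableSet.singleton 0), lintegral_inputLaw]
  have h : ∫⁻ x, ENNReal.ofReal (Real.exp (-(lam * x))) ∂B ≠ 0 := by
    intro h
    rw [lintegral_eq_zero_iff (by fun_prop)] at h
    obtain ⟨x, hx⟩ := h.exists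
    have : 0 < ENNReal.ofReal (Real.exp (-(lam * x))) := ENNReal.ofReal_pos.2 (Real.exp_pos _)
    exact this.ne' hx
  intro h0
  refine h (le_antisymm (le_trans (lintegral_mono fun x => ?_) h0.le) zero_le)
  calc _ = poissonWeight lam 0 x * ∫⁻ j, ({0} : Set ℕ).indicator 1 j ∂(convPow r 0) := by
        simp [poissonWeight, convPow]
    _ ≤ _ := ENNReal.le_tsum (f := fun n => poissonWeight lam n x *
      ∫⁻ j, ({0} : Set ℕ).indicator 1 j ∂(convPow r n)) 0

variable [IsProbabilityMeasure r]

instance isProbabilityMeasure_convPow (n : ℕ) : IsProbabilityMeasure (convPow r n) := by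
  induction n with
  | zero => rw [convPow]; infer_instance
  | succ n ih =>
    rw [convPow]
    exact Measure.isProbabilityMeasure_map Measurable.of_discrete.aemeasurable

lemma lintegral_natCast_convPow (n : ℕ) :
    ∫⁻ j, (j : ℝ≥0∞) ∂(convPow r n) = n * ∫⁻ j, (j : ℝ≥0∞) ∂r := by
  induction n with
  | zero => simp [convPow]
  | succ n ih =>
    rw [lintegral_convPow_succ]
    simp only [Nat.cast_add]
    have h : ∀ i : ℕ, ∫⁻ j : ℕ, ((i : ℝ≥0∞) + j) ∂(convPow r n) =
        i + n * ∫⁻ j, (j : ℝ≥0∞) ∂r := by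
      intro i
      rw [lintegral_add_left measurable_const, ih]
      simp
    simp_rw [h]
    rw [lintegral_add_right _ measurable_const]
    simp [add_mul, add_comm]

/-- Based on `(i + j) choose 2 = i choose 2 + i * j + j choose 2`; the cross terms produce the
square of the mean. -/
lemma lintegral_sum_range_convPow (n : ℕ) :
    ∫⁻ j, ∑ i ∈ Finset.range j, (i : ℝ≥0∞) ∂(convPow r n) =
      n * (∫⁻ j, ∑ i ∈ Finset.range j, (i : ℝ≥0∞) ∂r) +
        (∑ i ∈ Finset.range n, (i : ℝ≥0∞)) * (∫⁻ j, (j : ℝ≥0∞) ∂r) ^ 2 := by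
  induction n with
  | zero => simp [convPow]
  | succ n ih =>
    rw [lintegral_convPow_succ]
    have h : ∀ i j : ℕ, ∑ x ∈ Finset.range (i + j), (x : ℝ≥0∞) =
        ∑ x ∈ Finset.range i, (x : ℝ≥0∞) + ((i : ℝ≥0∞) * j + ∑ x ∈ Finset.range j, (x : ℝ≥0∞)) := by
      intro i j
      rw [Finset.sum_range_add]
      simp [Finset.sum_add_distrib, mul_comm]
    simp_rw [h]
    have h2 : ∀ i : ℕ, ∫⁻ j : ℕ, (∑ x ∈ Finset.range i, (x : ℝ≥0∞) + ((i : ℝ≥0∞) * j +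
        ∑ x ∈ Finset.range j, (x : ℝ≥0∞))) ∂(convPow r n) = ∑ x ∈ Finset.range i, (x : ℝ≥0∞) +
          ((n * ∫⁻ j, (j : ℝ≥0∞) ∂r) * (i : ℝ≥0∞) +
            ∫⁻ j, ∑ x ∈ Finset.range j, (x : ℝ≥0∞) ∂(convPow r n)) := by
      intro i
      rw [lintegral_add_left measurable_const, lintegral_add_left Measurable.of_discrete,
        lintegral_const_mul _ Measurable.of_discrete, lintegral_natCast_convPow]
      simp [mul_comm]
    simp_rw [h2]
    rw [lintegral_add_left Measurable.of_discrete, lintegral_add_left Measurable.of_discrete,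
      lintegral_const_mul _ Measurable.of_discrete, ih, Finset.sum_range_succ]
    simp only [lintegral_const, measure_univ, mul_one]
    push_cast
    ring

lemma inputMean_natCast (hlam : 0 < lam) {y : ℝ} (hy : 0 ≤ y) :
    inputMean lam r y (fun j => (j : ℝ≥0∞)) =
      ENNReal.ofReal (lam * y) * ∫⁻ j, (j : ℝ≥0∞) ∂r := by
  unfold inputMean
  simp_rw [lintegral_natCast_convPow, ← mul_assoc]
  rw [ENNReal.tsum_mul_right, tsum_poissonWeight_mul hlam hy]

lemma two_mul_inputMean_sum_range (hlam : 0 < lam) {y : ℝ} (hy : 0 ≤ y) :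
    2 * inputMean lam r y (fun j => ∑ i ∈ Finset.range j, (i : ℝ≥0∞)) =
      ENNReal.ofReal (lam * y) * (2 * ∫⁻ j, ∑ i ∈ Finset.range j, (i : ℝ≥0∞) ∂r) +
        ENNReal.ofReal (lam * y) ^ 2 * (∫⁻ j, (j : ℝ≥0∞) ∂r) ^ 2 := by
  unfold inputMean
  simp_rw [lintegral_sum_range_convPow, mul_add, ← mul_assoc]
  rw [ENNReal.tsum_add, ENNReal.tsum_mul_right, ENNReal.tsum_mul_right,
    tsum_poissonWeight_mul hlam hy, mul_add, ← mul_assoc, ← mul_assoc,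
    tsum_poissonWeight_mul_sum hlam hy, mul_comm 2 (ENNReal.ofReal (lam * y))]

lemma inputMean_const (hlam : 0 < lam) {y : ℝ} (hy : 0 ≤ y) (c : ℝ≥0∞) :
    inputMean lam r y (fun _ => c) = c := by
  unfold inputMean
  simp [ENNReal.tsum_mul_right, tsum_poissonWeight hlam hy]

lemma lintegral_serviceLaw_fst [SFinite B] (hlam : 0 < lam) (hB : ∀ᵐ x ∂B, 0 ≤ x)
    {F : ℝ → ℝ≥0∞} (hF : Measurable F) :
    ∫⁻ p, F p.1 ∂(serviceLaw lam r B) = ∫⁻ x, F x ∂B := by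
  rw [lintegral_serviceLaw (F := fun p => F p.1) (hF.comp measurable_fst)]
  refine lintegral_congr_ae ?_
  filter_upwards [hB] with x hx
  exact inputMean_const hlam hx _

lemma isProbabilityMeasure_serviceLaw [IsProbabilityMeasure B] (hlam : 0 < lam)
    (hB : ∀ᵐ x ∂B, 0 ≤ x) : IsProbabilityMeasure (serviceLaw lam r B) := by
  constructor
  have := lintegral_serviceLaw_fst (r := r) hlam hB (measurable_const (a := (1 : ℝ≥0∞)))
  simpa using this

lemma serviceLaw_ae_nonneg [IsProbabilityMeasure B] (hlam : 0 < lam)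
    (hB : ∀ᵐ x ∂B, 0 ≤ x) : ∀ᵐ p ∂(serviceLaw lam r B), 0 ≤ p.1 := by
  have h1 := lintegral_serviceLaw_fst (r := r) hlam hB
    (F := (Set.Iio 0).indicator 1) (measurable_one.indicator measurableSet_Iio)
  rw [lintegral_indicator_one measurableSet_Iio] at h1
  have h2 : B (Set.Iio 0) = 0 := by
    rw [measure_eq_zero_iff_ae_notMem]
    filter_upwards [hB] with x hx
    simpa using hx
  rw [h2, lintegral_eq_zero_iff (f := fun p : ℝ × ℕ => (Set.Iio (0 : ℝ)).indicator 1 p.1)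
    ((measurable_one.indicator measurableSet_Iio).comp measurable_fst)] at h1
  filter_upwards [h1] with p hp
  by_contra h
  simp [not_le.1 h] at hp

lemma isProbabilityMeasure_inputLaw [IsProbabilityMeasure B] (hlam : 0 < lam)
    (hB : ∀ᵐ x ∂B, 0 ≤ x) : IsProbabilityMeasure (inputLaw lam r B) := by
  have := isProbabilityMeasure_serviceLaw (r := r) hlam hB
  exact Measure.isProbabilityMeasure_map measurable_snd.aemeasurable

lemma lintegral_natCast_inputLaw [SFinite B] (hlam : 0 < lam) (hB : ∀ᵐ x ∂B, 0 ≤ x) :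
    ∫⁻ j, (j : ℝ≥0∞) ∂(inputLaw lam r B) =
      (∫⁻ x, ENNReal.ofReal (lam * x) ∂B) * ∫⁻ j, (j : ℝ≥0∞) ∂r := by
  rw [lintegral_inputLaw, ← lintegral_mul_const _ (by fun_prop)]
  refine lintegral_congr_ae ?_
  filter_upwards [hB] with x hx
  exact inputMean_natCast hlam hx

lemma two_mul_lintegral_sum_range_inputLaw [SFinite B] (hlam : 0 < lam)
    (hB : ∀ᵐ x ∂B, 0 ≤ x) :
    2 * ∫⁻ j, ∑ i ∈ Finset.range j, (i : ℝ≥0∞) ∂(inputLaw lam r B) =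
      (∫⁻ x, ENNReal.ofReal (lam * x) ∂B) * (2 * ∫⁻ j, ∑ i ∈ Finset.range j, (i : ℝ≥0∞) ∂r) +
        (∫⁻ x, ENNReal.ofReal (lam * x) ^ 2 ∂B) * (∫⁻ j, (j : ℝ≥0∞) ∂r) ^ 2 := by
  have hm : Measurable fun x => inputMean lam r x fun j => ∑ i ∈ Finset.range j, (i : ℝ≥0∞) :=
    Measurable.tsum fun n => (measurable_poissonWeight n).mul_const _
  rw [lintegral_inputLaw, ← lintegral_const_mul _ hm, ← lintegral_mul_const _ (by fun_prop),
    ← lintegral_mul_const _ (by fun_prop), ← lintegral_add_left (by fun_prop)]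
  refine lintegral_congr_ae ?_
  filter_upwards [hB] with x hx
  exact two_mul_inputMean_sum_range hlam hx

/-- Given the service time `x`, the number of batches is Poisson and each batch contributes a factor
`R`, so the exponential series yields `exp (-(lam * x)) * exp (lam * x * R)`. Both sides are
identified with the same power series in `R`. -/
lemma integral_pow_inputLaw [IsProbabilityMeasure B] (hlam : 0 < lam) (hB : ∀ᵐ x ∂B, 0 ≤ x)
    {z : ℂ} (hz : ‖z‖ ≤ 1) :
    ∫ j, z ^ j ∂(inputLaw lam r B) = lstC B (lam - lam * ∫ j, z ^ j ∂r) := by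
  have := isProbabilityMeasure_serviceLaw (r := r) hlam hB
  set R := ∫ j, z ^ j ∂r with hR
  have hR1 : ‖R‖ ≤ 1 := by
    refine (norm_integral_le_of_norm_le_const (C := 1) (Eventually.of_forall fun j => ?_)).trans
      (by simp)
    rw [norm_pow]
    exact pow_le_one₀ (norm_nonneg _) hz
  have hinteg : Integrable (fun p : ℝ × ℕ => z ^ p.2) (serviceLaw lam r B) := by
    refine Integrable.of_bound (C := 1) (Measurable.of_discrete.comp
      measurable_snd).aestronglyMeasurable (Eventually.of_forall fun p => ?_)
    rw [norm_pow]
    exact pow_le_one₀ (norm_nonneg _) hz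
  have h1 := hasSum_integral_measure hinteg
  rw [← serviceLaw] at h1
  have hw : ∀ n, ∫⁻ x, poissonWeight lam n x ∂B ≤ 1 := by
    intro n
    calc _ ≤ ∫⁻ _, 1 ∂B := by
          refine lintegral_mono_ae ?_
          filter_upwards [hB] with x hx
          rw [← tsum_poissonWeight hlam hx]
          exact ENNReal.le_tsum n
      _ = 1 := by simp
  have hfin : ∀ n, IsFiniteMeasure (B.withDensity (poissonWeight lam n)) := fun n =>
    isFiniteMeasure_withDensity ((hw n).trans_lt ENNReal.one_lt_top).ne
  set a : ℕ → ℝ := fun n => (∫⁻ x, poissonWeight lam n x ∂B).toReal with ha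
  have h2 : ∀ n, ∫ p, z ^ p.2 ∂((B.withDensity (poissonWeight lam n)).prod (convPow r n)) =
      a n * R ^ n := by
    intro n
    rw [integral_fun_snd (fun j : ℕ => z ^ j), integral_pow_convPow, ← hR]
    simp [Measure.real, ha]
  simp_rw [h2] at h1
  have h3 : HasSum (fun n => (a n : ℂ) * R ^ n) (lstC B (lam - lam * R)) := by
    have hsum : Summable a := by
      refine ENNReal.summable_toReal ?_
      rw [← lintegral_tsum fun n => (measurable_poissonWeight n).aemeasurable]
      have : ∫⁻ x, ∑' n, poissonWeight lam n x ∂B = ∫⁻ _, 1 ∂B := by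
        refine lintegral_congr_ae ?_
        filter_upwards [hB] with x hx
        exact tsum_poissonWeight hlam hx
      rw [this]
      simp
    have hae : ∀ n, ∀ᵐ x ∂B, ‖((Real.exp (-(lam * x)) * (lam * x) ^ n / n.factorial : ℝ) : ℂ) *
        R ^ n‖ ≤ (poissonWeight lam n x).toReal := by
      intro n
      filter_upwards [hB] with x hx
      have hnn : 0 ≤ Real.exp (-(lam * x)) * (lam * x) ^ n / n.factorial := by positivity
      rw [norm_mul, Complex.norm_real, Real.norm_of_nonneg hnn, norm_pow, poissonWeight,
        ENNReal.toReal_ofReal hnn]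
      exact mul_le_of_le_one_right hnn (pow_le_one₀ (norm_nonneg _) hR1)
    have hwi : ∀ n, Integrable (fun x => (poissonWeight lam n x).toReal) B := fun n =>
      integrable_toReal_of_lintegral_ne_top (measurable_poissonWeight n).aemeasurable
        ((hw n).trans_lt ENNReal.one_lt_top).ne
    have hai : ∀ n, ∫ x, (poissonWeight lam n x).toReal ∂B = a n := fun n =>
      integral_toReal (measurable_poissonWeight n).aemeasurable
        (Eventually.of_forall fun x => ENNReal.ofReal_lt_top)
    have hFi : ∀ n, Integrable (fun x : ℝ => ((Real.exp (-(lam * x)) * (lam * x) ^ n /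
        n.factorial : ℝ) : ℂ) * R ^ n) B := fun n =>
      (hwi n).mono' (by fun_prop) (hae n)
    have h4 := hasSum_integral_of_summable_integral_norm hFi (by
      refine Summable.of_nonneg_of_le (fun n => integral_nonneg fun x => norm_nonneg _)
        (fun n => ?_) hsum
      rw [← hai]
      exact integral_mono_ae (hFi n).norm (hwi n) (hae n))
    have h5 : ∀ n, ∫ x : ℝ, ((Real.exp (-(lam * x)) * (lam * x) ^ n /
        n.factorial : ℝ) : ℂ) * R ^ n ∂B = a n * R ^ n := by
      intro n
      rw [integral_mul_const, integral_complex_ofReal, ← hai]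
      congr 2
      refine integral_congr_ae ?_
      filter_upwards [hB] with x hx
      rw [poissonWeight, ENNReal.toReal_ofReal (by positivity)]
    simp_rw [h5] at h4
    suffices h : lstC B (lam - lam * R) = ∫ x : ℝ, ∑' n : ℕ, ((Real.exp (-(lam * x)) *
        (lam * x) ^ n / n.factorial : ℝ) : ℂ) * R ^ n ∂B by rwa [h]
    refine integral_congr_ae (Eventually.of_forall fun x => ?_)
    have h6 : HasSum (fun n : ℕ => Complex.exp (-(lam * x : ℝ)) *
        ((lam * x * R) ^ n / n.factorial)) (Complex.exp (-(lam * x : ℝ)) *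
          Complex.exp (lam * x * R)) := by
      have := (NormedSpace.expSeries_div_hasSum_exp (lam * x * R)).mul_left
        (Complex.exp (-(lam * x : ℝ)))
      rwa [← Complex.exp_eq_exp_ℂ] at this
    have h7 : (fun n : ℕ => ((Real.exp (-(lam * x)) * (lam * x) ^ n / n.factorial : ℝ) : ℂ) *
        R ^ n) = fun n : ℕ => Complex.exp (-(lam * x : ℝ)) *
        ((lam * x * R) ^ n / n.factorial) := by
      ext n
      push_cast
      rw [mul_pow (_ * _ : ℂ)]
      ring
    simp only [h7]
    rw [h6.tsum_eq, ← Complex.exp_add]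
    congr 1
    push_cast
    ring
  rw [inputLaw, integral_map measurable_snd.aemeasurable
    Measurable.of_discrete.aestronglyMeasurable]
  exact h1.unique h3

end CompoundPoisson

/-! ### Paths with given arrival times -/

section Path

open Classical in
/-- The time from which the server is free for the `n`-th customer, if the customers arrive at the
times `a` and the server is blocked up to time `c`. -/
def free (L : ℕ) (a : ℕ → ℝ) (s : ℕ → ℝ × ℝ) (c : ℝ) : ℕ → ℝ
  | 0 => c
  | n + 1 => max (free L a s c n) (a n) +
      if (L : ℕ∞) < {m | n ≤ m ∧ a m ≤ max (free L a s c n) (a n)}.encard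
      then (s n).2 else (s n).1

/-- At time `t` a service is in progress, of type 2 unless `P` holds. -/
def Serving (P : Prop) (L : ℕ) (a : ℕ → ℝ) (s : ℕ → ℝ × ℝ) (c t : ℝ) : Prop :=
  ∃ n, max (free L a s c n) (a n) ≤ t ∧ t < free L a s c (n + 1) ∧
    (P ∨ (L : ℕ∞) < {m | n ≤ m ∧ a m ≤ max (free L a s c n) (a n)}.encard)

/-- The arrival times if there are `k` customers at time `0` and the others arrive at `α`. -/
def initArr (k : ℕ) (α : ℕ → ℝ) (n : ℕ) : ℝ := if n < k then 0 else α (n - k)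

/-- Prepend an element to a sequence. -/
def consSeq {X : Type*} (x : X) (s : ℕ → X) : ℕ → X
  | 0 => x
  | n + 1 => s n

variable {P : Prop} {L : ℕ} {a a' : ℕ → ℝ} {s : ℕ → ℝ × ℝ} {c c' t : ℝ}

lemma freeTime_eq_free (ω : Sample) (n : ℕ) :
    freeTime L ω n = free L (arrival ω) ω.2 0 n := by
  induction n with
  | zero => rfl
  | succ n ih =>
    simp only [freeTime, free, ih, queueFrom]

lemma servesType2_iff (ω : Sample) (t : ℝ) :
    ServesType2 L ω t ↔ Serving False L (arrival ω) ω.2 0 t := by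
  simp only [ServesType2, Serving, serviceStart, departure, freeTime_eq_free, queueFrom, false_or]

/-- If somebody is present, the first customer who has not departed by `t` is in service: the
predecessor has left, and by monotonicity this customer has arrived. For customer `0` the assumption
`0 ≤ t` replaces the predecessor. -/
lemma level_eq_zero_iff {ω : Sample} (hω : Monotone (arrival ω)) (ht : 0 ≤ t) :
    level L ω t = 0 ↔ ¬ Serving True L (arrival ω) ω.2 0 t := by
  rw [level, Set.encard_eq_zero, ← not_iff_not, ← Ne.eq_def, ← Set.nonempty_iff_ne_empty, not_not]
  simp only [departure, freeTime_eq_free, Serving, true_or, and_true]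
  constructor
  · intro h
    obtain ⟨n, hn1, hn2⟩ := h
    have hex : ∃ n, t < free L (arrival ω) ω.2 0 (n + 1) := ⟨n, hn2⟩
    classical
    refine ⟨Nat.find hex, max_le ?_ ((hω (Nat.find_min' hex hn2)).trans hn1), Nat.find_spec hex⟩
    rcases Nat.eq_zero_or_pos (Nat.find hex) with h0 | h0
    · rw [h0]
      exact ht
    · have h1 := Nat.find_min hex (m := Nat.find hex - 1) (by omega)
      rw [Nat.sub_add_cancel h0, not_lt] at h1
      exact h1
  · rintro ⟨n, hn1, hn2⟩
    exact ⟨n, (le_max_right _ _).trans hn1, hn2⟩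

lemma encard_shift (a : ℕ → ℝ) (n : ℕ) (y : ℝ) :
    {m | n + 1 ≤ m ∧ a m ≤ y}.encard = {m | n ≤ m ∧ a (m + 1) ≤ y}.encard := by
  rw [← (add_left_injective 1).encard_image {m | n ≤ m ∧ a (m + 1) ≤ y}]
  congr 1
  ext m
  simp only [Set.mem_ofPred_eq, Set.mem_image]
  constructor
  · rintro ⟨h1, h2⟩
    refine ⟨m - 1, ⟨by omega, ?_⟩, Nat.sub_add_cancel (by omega)⟩
    rwa [Nat.sub_add_cancel (by omega)]
  · rintro ⟨x, ⟨h1, h2⟩, rfl⟩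
    exact ⟨by simpa using h1, h2⟩

lemma free_shift (n : ℕ) : free L a s c (n + 1) =
    free L (fun m => a (m + 1)) (fun m => s (m + 1)) (free L a s c 1) n := by
  induction n with
  | zero => rfl
  | succ n ih =>
    conv_lhs => rw [free]
    conv_rhs => rw [free]
    simp only [ih, encard_shift]

/-- After the first service the system restarts with the remaining customers, the server being
blocked until that service ends. -/
lemma serving_iff_first_or : Serving P L a s c t ↔
    (max c (a 0) ≤ t ∧ t < free L a s c 1 ∧ (P ∨ (L : ℕ∞) < {m | a m ≤ max c (a 0)}.encard)) ∨
      Serving P L (fun m => a (m + 1)) (fun m => s (m + 1)) (free L a s c 1) t := by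
  unfold Serving
  constructor
  · rintro ⟨n, hn⟩
    cases n with
    | zero => exact Or.inl (by simpa [free] using hn)
    | succ n =>
      refine Or.inr ⟨n, ?_⟩
      rwa [free_shift n, free_shift (n + 1), encard_shift] at hn
  · rintro (h | ⟨n, hn⟩)
    · exact ⟨0, by simpa [free] using h⟩
    · refine ⟨n + 1, ?_⟩
      rwa [free_shift n, free_shift (n + 1), encard_shift]

lemma free_translate (d : ℝ) (n : ℕ) :
    free L (fun m => a m - d) s (c - d) n = free L a s c n - d := by
  induction n with
  | zero => rfl
  | succ n ih =>
    simp only [free, ih, max_sub_sub_right, sub_le_sub_iff_right]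
    ring

lemma serving_translate (d : ℝ) :
    Serving P L (fun m => a m - d) s (c - d) (t - d) ↔ Serving P L a s c t := by
  simp only [Serving, free_translate, max_sub_sub_right, sub_le_sub_iff_right,
    sub_lt_sub_iff_right]

lemma le_free (hs : ∀ n, 0 ≤ (s n).1 ∧ 0 ≤ (s n).2) (n : ℕ) : c ≤ free L a s c n := by
  induction n with
  | zero => exact le_rfl
  | succ n ih =>
    rw [free]
    have : 0 ≤ if (L : ℕ∞) < {m | n ≤ m ∧ a m ≤ max (free L a s c n) (a n)}.encard
      then (s n).2 else (s n).1 := by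
      split_ifs
      exacts [(hs n).2, (hs n).1]
    linarith [le_max_left (free L a s c n) (a n)]

lemma not_serving_of_lt (hs : ∀ n, 0 ≤ (s n).1 ∧ 0 ≤ (s n).2) (ht : t < c) :
    ¬ Serving P L a s c t := by
  rintro ⟨n, hn, -⟩
  have := le_free (L := L) (a := a) (c := c) hs n
  linarith [le_max_left (free L a s c n) (a n)]

lemma max_eq_of_max_eq {x y z w : ℝ} (hz : w ≤ z) (h : max x w = max y w) : max z x = max z y := by
  rw [← max_eq_left hz, max_assoc, max_assoc, max_comm w x, max_comm w y, h]

lemma le_iff_of_max_eq {x y z w : ℝ} (hz : w ≤ z) (h : max x w = max y w) : x ≤ z ↔ y ≤ z := by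
  have h1 : x ≤ z ↔ max x w ≤ z := by simp [hz]
  have h2 : y ≤ z ↔ max y w ≤ z := by simp [hz]
  rw [h1, h2, h]

/-- The path depends on the arrival times only through their maxima with the time up to which the
server is blocked. -/
lemma free_congr (hs : ∀ n, 0 ≤ (s n).1 ∧ 0 ≤ (s n).2) (h : ∀ n, max (a n) c = max (a' n) c)
    (n : ℕ) : free L a s c n = free L a' s c n := by
  induction n with
  | zero => rfl
  | succ n ih =>
    have hc : c ≤ free L a' s c n := le_free hs n
    have h2 : ∀ m, (a m ≤ max (free L a' s c n) (a' n) ↔ a' m ≤ max (free L a' s c n) (a' n)) :=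
      fun m => le_iff_of_max_eq (hc.trans (le_max_left _ _)) (h m)
    simp only [free, ih, max_eq_of_max_eq hc (h n), h2]

lemma serving_congr (hs : ∀ n, 0 ≤ (s n).1 ∧ 0 ≤ (s n).2) (h : ∀ n, max (a n) c = max (a' n) c) :
    Serving P L a s c t ↔ Serving P L a' s c t := by
  unfold Serving
  refine exists_congr fun n => ?_
  have hc : c ≤ free L a' s c n := le_free hs n
  have h2 : ∀ m, (a m ≤ max (free L a' s c n) (a' n) ↔ a' m ≤ max (free L a' s c n) (a' n)) :=
    fun m => le_iff_of_max_eq (hc.trans (le_max_left _ _)) (h m)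
  simp only [free_congr hs h, max_eq_of_max_eq hc (h n), h2]

/-- The blocking time enters only through its maximum with `a 0`. -/
lemma serving_congr_start (h : c ≤ a 0) (h' : c' ≤ a 0) :
    Serving P L a s c t ↔ Serving P L a s c' t := by
  rw [serving_iff_first_or, serving_iff_first_or (c := c')]
  have e : free L a s c 1 = free L a s c' 1 := by
    simp only [free, max_eq_right h, max_eq_right h']
  rw [e, max_eq_right h, max_eq_right h']

/-- The first service if there are `k + 1` customers at time `0`. -/
lemma serving_initArr_succ {k : ℕ} {α : ℕ → ℝ} (hα : ∀ m, 0 < α m) (b : ℝ × ℝ) :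
    Serving P L (initArr (k + 1) α) (consSeq b s) 0 t ↔
      (0 ≤ t ∧ t < (if L < k + 1 then b.2 else b.1) ∧ (P ∨ L < k + 1)) ∨
        Serving P L (initArr k α) s (if L < k + 1 then b.2 else b.1) t := by
  have h0 : initArr (k + 1) α 0 = 0 := by simp [initArr]
  -- All later arrivals are strictly positive, so exactly `k + 1` customers are present at time `0`,
  -- and `L < k + 1` decides the type of the first service.
  have hset : {m | initArr (k + 1) α m ≤ max 0 (initArr (k + 1) α 0)} = Set.Iio (k + 1) := by
    ext m
    rw [h0, max_self]
    simp only [initArr, Set.mem_ofPred_eq, Set.mem_Iio]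
    split_ifs with h
    · simpa using h
    · simpa [h] using hα _
  have hcard : {m | initArr (k + 1) α m ≤ max 0 (initArr (k + 1) α 0)}.encard = (k + 1 : ℕ) := by
    rw [hset, ← Finset.coe_range, Set.encard_coe_eq_coe_finsetCard, Finset.card_range]
  have hfree : free L (initArr (k + 1) α) (consSeq b s) 0 1 = if L < k + 1 then b.2 else b.1 := by
    rw [free]
    rw [h0, max_self] at hcard
    simp only [free, Nat.zero_le, true_and, h0, max_self, zero_add, consSeq, hcard, Nat.cast_lt]
  have hshift : (fun m => initArr (k + 1) α (m + 1)) = initArr k α := by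
    ext m
    simp [initArr]
  rw [serving_iff_first_or, hfree, hshift, hcard, Nat.cast_lt, h0, max_self]
  rfl

end Path

/-! ### Arrival times of customers in batches -/

section Arrivals

/-- Arrival times of the customers. -/
def arr (ξ : ℕ → ℝ × ℕ) : ℕ → ℝ := arrival (ξ, fun _ => (0, 0))

lemma arrival_eq_arr (ω : Sample) : arrival ω = arr ω.1 := rfl

/-- Customers outside the first batch see a fresh stream started at `x.1`, with batch indices raised
by one. Batch sizes of at least one make the sets under `sInf` nonempty, so that its default value
`0` does not interfere. -/
lemma arr_cons {x : ℝ × ℕ} {ξ : ℕ → ℝ × ℕ} (hξ : ∀ n, 1 ≤ (ξ n).2) (n : ℕ) :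
    arr (consSeq x ξ) n = if n < x.2 then x.1 else x.1 + arr ξ (n - x.2) := by
  have hsum : ∀ {M : Type} [AddCommMonoid M] (v : ℝ × ℕ → M) (k : ℕ),
      ∑ i ∈ Finset.range (k + 1), v (consSeq x ξ i) = ∑ i ∈ Finset.range k, v (ξ i) + v x := by
    intro M _ v k
    rw [Finset.sum_range_succ']
    rfl
  simp only [arr, arrival, batchTime, batchOf, hsum]
  split_ifs with h
  · have h0 : sInf {k | n < ∑ i ∈ Finset.range k, (ξ i).2 + x.2} = 0 := by
      rw [Nat.sInf_eq_zero]
      exact Or.inl (by simpa using h)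
    rw [h0]
    simp
  · have hne : {k | n - x.2 < ∑ i ∈ Finset.range (k + 1), (ξ i).2}.Nonempty := by
      refine ⟨n - x.2, ?_⟩
      have h1 : ∑ _i ∈ Finset.range (n - x.2 + 1), 1 ≤ ∑ i ∈ Finset.range (n - x.2 + 1), (ξ i).2 :=
        Finset.sum_le_sum fun i _ => hξ i
      simp only [Finset.sum_const, Finset.card_range, smul_eq_mul, mul_one] at h1
      exact h1
    set K := sInf {k | n - x.2 < ∑ i ∈ Finset.range (k + 1), (ξ i).2} with hK
    have hmem := Nat.sInf_mem hne
    have h0 : sInf {k | n < ∑ i ∈ Finset.range k, (ξ i).2 + x.2} = K + 1 := by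
      refine le_antisymm (Nat.sInf_le ?_) ?_
      · rw [← hK] at hmem
        simp only [Set.mem_ofPred_eq] at hmem ⊢
        omega
      · have hne' : {k | n < ∑ i ∈ Finset.range k, (ξ i).2 + x.2}.Nonempty := by
          refine ⟨K + 1, ?_⟩
          rw [← hK] at hmem
          simp only [Set.mem_ofPred_eq] at hmem ⊢
          omega
        have hm := Nat.sInf_mem hne'
        set K' := sInf {k | n < ∑ i ∈ Finset.range k, (ξ i).2 + x.2}
        have hK' : K' ≠ 0 := by
          intro h0
          rw [h0] at hm
          simp at hm
          exact h hm
        have : K ≤ K' - 1 := by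
          refine Nat.sInf_le ?_
          simp only [Set.mem_ofPred_eq] at hm ⊢
          rw [Nat.sub_add_cancel (Nat.pos_of_ne_zero hK')]
          omega
        omega
    rw [h0, add_comm]

lemma consSeq_head_tail {X : Type*} (ξ : ℕ → X) : consSeq (ξ 0) (fun n => ξ (n + 1)) = ξ := by
  ext n
  cases n <;> rfl

lemma batchTime_mono {ω : Sample} (h : ∀ n, 0 < (ω.1 n).1) : Monotone (batchTime ω) := by
  intro i j hij
  exact Finset.sum_le_sum_of_subset_of_nonneg (Finset.range_mono (by omega))
    fun n _ _ => (h n).le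

lemma arr_mono {ξ : ℕ → ℝ × ℕ} (h : ∀ n, 0 < (ξ n).1 ∧ 1 ≤ (ξ n).2) : Monotone (arr ξ) := by
  intro m n hmn
  refine batchTime_mono (ω := (ξ, fun _ => (0, 0))) (fun n => (h n).1) ?_
  refine Nat.sInf_le ?_
  have hne : {k | n < ∑ i ∈ Finset.range (k + 1), (ξ i).2}.Nonempty := by
    refine ⟨n, ?_⟩
    have h1 : ∑ _i ∈ Finset.range (n + 1), 1 ≤ ∑ i ∈ Finset.range (n + 1), (ξ i).2 :=
      Finset.sum_le_sum fun i _ => (h i).2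
    simp only [Finset.sum_const, Finset.card_range, smul_eq_mul, mul_one] at h1
    exact h1
  exact lt_of_le_of_lt hmn (Nat.sInf_mem hne)

lemma arr_pos {ξ : ℕ → ℝ × ℕ} (h : ∀ n, 0 < (ξ n).1 ∧ 1 ≤ (ξ n).2) (m : ℕ) : 0 < arr ξ m := by
  unfold arr arrival batchTime
  exact Finset.sum_pos (fun i _ => (h i).1) Finset.nonempty_range_add_one

variable {P : Prop} {L k : ℕ} {s : ℕ → ℝ × ℝ} {x : ℝ × ℕ} {ξ : ℕ → ℝ × ℕ} {y t : ℝ}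

/-- A batch that arrives while the server is blocked. -/
lemma serving_batch_before (hs : ∀ n, 0 ≤ (s n).1 ∧ 0 ≤ (s n).2) (hξ : ∀ n, 1 ≤ (ξ n).2)
    (hx : 0 ≤ x.1) (hy : x.1 ≤ y) :
    Serving P L (initArr k (arr (consSeq x ξ))) s y t ↔
      Serving P L (initArr (k + x.2) (arr ξ)) s (y - x.1) (t - x.1) := by
  rw [← serving_translate x.1]
  refine serving_congr hs fun n => ?_
  have hy' : 0 ≤ y - x.1 := by linarith
  simp only [initArr, arr_cons hξ]
  by_cases h1 : n < k
  · rw [if_pos h1, if_pos (by omega), max_eq_right (by linarith), max_eq_right hy']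
  · rw [if_neg h1]
    by_cases h2 : n < k + x.2
    · rw [if_pos h2, if_pos (by omega), sub_self]
    · rw [if_neg h2, if_neg (by omega), add_sub_cancel_left, Nat.sub_sub]

/-- If no batch arrives while the server is blocked, time can be shifted. -/
lemma serving_batch_after (hs : ∀ n, 0 ≤ (s n).1 ∧ 0 ≤ (s n).2) (hξ : ∀ n, 1 ≤ (ξ n).2)
    (hy : 0 ≤ y) :
    Serving P L (initArr k (arr (consSeq x ξ))) s y t ↔
      Serving P L (initArr k (arr (consSeq (x.1 - y, x.2) ξ))) s 0 (t - y) := by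
  rw [← serving_translate y, sub_self]
  refine serving_congr hs fun n => ?_
  simp only [initArr, arr_cons hξ]
  by_cases h1 : n < k
  · rw [if_pos h1, if_pos h1, max_eq_right (by linarith), max_self]
  · rw [if_neg h1, if_neg h1]
    split_ifs
    · rfl
    · rw [add_sub_right_comm]

/-- The first batch that arrives at an empty system. -/
lemma serving_batch_empty (hξ : ∀ n, 1 ≤ (ξ n).2) (hx : 0 ≤ x.1) (hx2 : 1 ≤ x.2) :
    Serving P L (initArr 0 (arr (consSeq x ξ))) s 0 t ↔
      Serving P L (initArr x.2 (arr ξ)) s 0 (t - x.1) := by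
  rw [← serving_translate x.1]
  have e : (fun m => initArr 0 (arr (consSeq x ξ)) m - x.1) = initArr x.2 (arr ξ) := by
    ext n
    simp only [initArr, arr_cons hξ, Nat.not_lt_zero, if_false, Nat.sub_zero]
    split_ifs
    · exact sub_self _
    · exact add_sub_cancel_left _ _
  rw [e]
  have h0 : initArr x.2 (arr ξ) 0 = 0 := if_pos (by omega)
  exact serving_congr_start (by rw [h0]; linarith) h0.ge

end Arrivals

/-! ### Measurability of the paths -/

section Measurability

/-- Finite witnesses form a countable family, which makes the comparison of the queue length with
`L` measurable. -/
lemma coe_lt_encard_iff (L : ℕ) (S : Set ℕ) :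
    (L : ℕ∞) < S.encard ↔ ∃ F : Finset ℕ, F.card = L + 1 ∧ ∀ m ∈ F, m ∈ S := by
  constructor
  · intro h
    have h1 : ((L + 1 : ℕ) : ℕ∞) ≤ S.encard := by
      push_cast
      exact Order.add_one_le_of_lt h
    obtain ⟨t, hts, ht⟩ := Set.exists_subset_encard_eq h1
    have hfin : t.Finite := Set.finite_of_encard_eq_coe ht
    refine ⟨hfin.toFinset, ?_, fun m hm => hts (by simpa using hm)⟩
    rw [hfin.encard_eq_coe_toFinset_card] at ht
    exact_mod_cast ht
  · rintro ⟨F, hF, hFS⟩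
    calc (L : ℕ∞) < ((L + 1 : ℕ) : ℕ∞) := by exact_mod_cast Nat.lt_succ_self L
      _ = (F : Set ℕ).encard := by rw [Set.encard_coe_eq_coe_finsetCard, hF]
      _ ≤ S.encard := Set.encard_le_encard fun m hm => hFS m hm

variable {X : Type*} [MeasurableSpace X] {a : X → ℕ → ℝ} {s : X → ℕ → ℝ × ℝ} {c t : X → ℝ}

lemma measurableSet_lt_encard (ha : ∀ n, Measurable fun x => a x n) {y : X → ℝ}
    (hy : Measurable y) (L n : ℕ) :
    MeasurableSet {x | (L : ℕ∞) < {m | n ≤ m ∧ a x m ≤ y x}.encard} := by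
  simp only [coe_lt_encard_iff, Set.mem_ofPred_eq]
  simp only [Set.ofPred_exists, Set.ofPred_and, Set.ofPred_forall]
  refine MeasurableSet.iUnion fun F => (MeasurableSet.const _).inter ?_
  refine MeasurableSet.iInter fun m => MeasurableSet.iInter fun _ => ?_
  exact (MeasurableSet.const _).inter (measurableSet_le (ha m) hy)

lemma measurable_free (ha : ∀ n, Measurable fun x => a x n) (hs : ∀ n, Measurable fun x => s x n)
    (hc : Measurable c) (L n : ℕ) : Measurable fun x => free L (a x) (s x) (c x) n := by
  induction n with
  | zero => exact hc
  | succ n ih =>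
    simp only [free]
    refine (ih.max (ha n)).add (Measurable.ite (measurableSet_lt_encard ha (ih.max (ha n)) L n) ?_ ?_)
    · exact (hs n).snd
    · exact (hs n).fst

lemma measurableSet_serving (ha : ∀ n, Measurable fun x => a x n)
    (hs : ∀ n, Measurable fun x => s x n) (hc : Measurable c) (ht : Measurable t) (P : Prop) (L : ℕ) :
    MeasurableSet {x | Serving P L (a x) (s x) (c x) (t x)} := by
  simp only [Serving, Set.ofPred_exists, Set.ofPred_and, Set.ofPred_or]
  refine MeasurableSet.iUnion fun n => ?_
  have hf := measurable_free ha hs hc L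
  refine (measurableSet_le ((hf n).max (ha n)) ht).inter
    ((measurableSet_lt ht (hf (n + 1))).inter ((MeasurableSet.const _).union ?_))
  exact measurableSet_lt_encard ha ((hf n).max (ha n)) L n

/-- The value `k` is attained either as the first index with the property or, for `k = 0`, as the
default value on the empty set. -/
lemma measurable_sInf_nat {p : X → ℕ → Prop} (hp : ∀ k, MeasurableSet {x | p x k}) :
    Measurable fun x => sInf {k | p x k} := by
  refine measurable_to_countable' fun k => ?_
  have h : (fun x => sInf {k | p x k}) ⁻¹' {k} =
      ({x | p x k} ∩ ⋂ j, ⋂ _ : j < k, {x | p x j}ᶜ) ∪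
        ({x | k = 0} ∩ ⋂ j, {x | p x j}ᶜ) := by
    ext x
    simp only [Set.mem_preimage, Set.mem_singleton_iff, Set.mem_union, Set.mem_inter_iff,
      Set.mem_ofPred_eq, Set.mem_iInter, Set.mem_compl_iff]
    constructor
    · intro hx
      by_cases hne : {k | p x k}.Nonempty
      · left
        refine ⟨?_, fun j hj => ?_⟩
        · rw [← hx]
          exact Nat.sInf_mem hne
        · rw [← hx] at hj
          exact Nat.notMem_of_lt_sInf hj
      · right
        rw [Set.not_nonempty_iff_eq_empty] at hne
        refine ⟨?_, fun j hj => ?_⟩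
        · rw [← hx, hne, Nat.sInf_empty]
        · have : j ∈ {k | p x k} := hj
          rw [hne] at this
          exact this
    · rintro (⟨h1, h2⟩ | ⟨h1, h2⟩)
      · refine le_antisymm (Nat.sInf_le h1) ?_
        by_contra! hlt
        exact h2 _ hlt (Nat.sInf_mem ⟨k, h1⟩)
      · have : {k | p x k} = ∅ := by
          ext j
          simpa using h2 j
        rw [this, Nat.sInf_empty, h1]
  rw [h]
  refine ((hp k).inter (MeasurableSet.iInter fun j => MeasurableSet.iInter fun _ =>
    (hp j).compl)).union ((MeasurableSet.const _).inter (MeasurableSet.iInter fun j => (hp j).compl))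

lemma measurable_arr (n : ℕ) : Measurable fun ξ : ℕ → ℝ × ℕ => arr ξ n := by
  have h1 : ∀ k, Measurable fun ξ : ℕ → ℝ × ℕ => batchTime (ξ, fun _ => (0, 0)) k := by
    intro k
    unfold batchTime
    fun_prop
  have h2 : Measurable fun ξ : ℕ → ℝ × ℕ => batchOf (ξ, fun _ => (0, 0)) n := by
    unfold batchOf
    refine measurable_sInf_nat fun k => ?_
    exact measurableSet_lt measurable_const (by fun_prop)
  have h3 : Measurable fun p : (ℕ → ℝ × ℕ) × ℕ => batchTime (p.1, fun _ => (0, 0)) p.2 :=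
    measurable_from_prod_countable_left h1
  exact h3.comp (measurable_id.prodMk h2)

lemma measurable_initArr {α : X → ℕ → ℝ} (hα : ∀ n, Measurable fun x => α x n) (k n : ℕ) :
    Measurable fun x => initArr k (α x) n := by
  unfold initArr
  split_ifs
  · exact measurable_const
  · exact hα _

end Measurability

/-! ### Sequences of independent variables -/

section Sequences

variable {X : Type*} [MeasurableSpace X]

lemma measurable_consSeq : Measurable fun p : X × (ℕ → X) => consSeq p.1 p.2 := by
  refine measurable_pi_iff.2 fun n => ?_
  cases n with
  | zero => exact measurable_fst
  | succ n => exact (measurable_pi_apply n).comp measurable_snd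

lemma map_consSeq_infinitePi (m : Measure X) [IsProbabilityMeasure m] :
    (m.prod (Measure.infinitePi fun _ : ℕ => m)).map (fun p => consSeq p.1 p.2) =
      Measure.infinitePi fun _ : ℕ => m := by
  refine Measure.eq_infinitePi _ fun S A hA => ?_
  classical
  rw [Measure.map_apply measurable_consSeq (MeasurableSet.pi S.countable_toSet fun i _ => hA i)]
  set N := S.sup id + 1 with hN
  have hS : S ⊆ Finset.range (N + 1) := by
    intro i hi
    have : i ≤ S.sup id := Finset.le_sup (f := id) hi
    simp only [Finset.mem_range]
    omega
  -- Padding by `Set.univ` replaces `S` by an initial segment, for which prepending a coordinate is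
  -- a shift of indices.
  set A' : ℕ → Set X := fun i => if i ∈ S then A i else Set.univ with hA'
  have hA'm : ∀ i, MeasurableSet (A' i) := by
    intro i
    simp only [hA']
    split_ifs
    exacts [hA i, MeasurableSet.univ]
  have h1 : (fun p : X × (ℕ → X) => consSeq p.1 p.2) ⁻¹' (S : Set ℕ).pi A =
      A' 0 ×ˢ ((Finset.range N : Finset ℕ) : Set ℕ).pi (fun i => A' (i + 1)) := by
    ext p
    simp only [Set.mem_preimage, Set.mem_pi, Finset.mem_coe, Set.mem_prod, Finset.mem_range, hA']
    constructor
    · intro h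
      refine ⟨?_, fun i _ => ?_⟩
      · split_ifs with h0
        · exact h 0 h0
        · trivial
      · split_ifs with h0
        · exact h (i + 1) h0
        · trivial
    · rintro ⟨h0, h⟩ i hi
      cases i with
      | zero => simpa [hi, consSeq] using h0
      | succ i =>
        have := h i (by have := Finset.mem_range.1 (hS hi); omega)
        simpa [hi, consSeq] using this
  rw [h1, Measure.prod_prod, Measure.infinitePi_pi _ (fun i _ => hA'm (i + 1)), mul_comm,
    ← Finset.prod_range_succ' (fun i => m (A' i))]
  rw [← Finset.prod_subset hS]
  · exact Finset.prod_congr rfl fun i hi => by simp [hA', hi]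
  · intro i _ hi
    simp [hA', hi]

lemma lintegral_infinitePi_cons (m : Measure X) [IsProbabilityMeasure m]
    {F : (ℕ → X) → ℝ≥0∞} (hF : Measurable F) :
    ∫⁻ ξ, F ξ ∂(Measure.infinitePi fun _ : ℕ => m) =
      ∫⁻ x, ∫⁻ ξ, F (consSeq x ξ) ∂(Measure.infinitePi fun _ : ℕ => m) ∂m := by
  conv_lhs => rw [← map_consSeq_infinitePi m]
  rw [lintegral_map hF measurable_consSeq,
    lintegral_prod (fun p : X × (ℕ → X) => F (consSeq p.1 p.2))
      (hF.comp measurable_consSeq).aemeasurable]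

lemma ae_infinitePi (m : Measure X) [IsProbabilityMeasure m] {p : X → Prop} (hp : ∀ᵐ x ∂m, p x) :
    ∀ᵐ ξ ∂(Measure.infinitePi fun _ : ℕ => m), ∀ n, p (ξ n) := by
  rw [ae_all_iff]
  intro n
  exact (measurePreserving_eval_infinitePi (fun _ : ℕ => m) n).quasiMeasurePreserving.ae hp

end Sequences

/-! ### The exponential law -/

section Exponential

variable {lam : ℝ}

lemma lintegral_expMeasure {F : ℝ → ℝ≥0∞} (hF : Measurable F) :
    ∫⁻ u, F u ∂(expMeasure lam) =
      ∫⁻ u, (if 0 ≤ u then ENNReal.ofReal (lam * Real.exp (-(lam * u))) else 0) * F u := by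
  have hm : Measurable (gammaPDF 1 lam) := by
    unfold gammaPDF
    exact (measurable_gammaPDFReal 1 lam).ennreal_ofReal
  rw [expMeasure, gammaMeasure, lintegral_withDensity_eq_lintegral_mul _ hm hF]
  refine lintegral_congr fun u => ?_
  have h : gammaPDF 1 lam u = exponentialPDF lam u := rfl
  rw [Pi.mul_apply, h, exponentialPDF_eq]
  split_ifs <;> simp

lemma expMeasure_ae_pos : ∀ᵐ u ∂(expMeasure lam), 0 < u := by
  have h : expMeasure lam (Set.Iic 0) = 0 := by
    rw [← lintegral_indicator_one measurableSet_Iic,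
      lintegral_expMeasure (measurable_one.indicator measurableSet_Iic), lintegral_eq_zero_iff']
    · have h0 : ∀ᵐ u : ℝ, u ≠ 0 := by simp [ae_iff, measure_singleton]
      filter_upwards [h0] with u hu
      rcases lt_or_gt_of_ne hu with h | h
      · simp [h.not_ge]
      · simp [h.not_ge]
    · refine Measurable.aemeasurable (Measurable.mul (Measurable.ite measurableSet_Ici ?_ ?_) ?_)
      · fun_prop
      · fun_prop
      · exact measurable_one.indicator measurableSet_Iic
  rw [measure_eq_zero_iff_ae_notMem] at h
  filter_upwards [h] with u hu
  simpa using hu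

/-- The lack of memory of the exponential law. -/
lemma lintegral_expMeasure_memoryless {F : ℝ → ℝ≥0∞} (hF : Measurable F) {y : ℝ}
    (hy : 0 ≤ y) : ∫⁻ u, (if u ≤ y then 0 else F (u - y)) ∂(expMeasure lam) =
      ENNReal.ofReal (Real.exp (-(lam * y))) * ∫⁻ u, F u ∂(expMeasure lam) := by
  have hm : Measurable fun u => if u ≤ y then 0 else F (u - y) :=
    Measurable.ite measurableSet_Iic measurable_const (by fun_prop)
  have hd : Measurable fun u : ℝ =>
      if 0 ≤ u then ENNReal.ofReal (lam * Real.exp (-(lam * u))) else 0 :=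
    Measurable.ite measurableSet_Ici (by fun_prop) measurable_const
  have hdF : Measurable fun u : ℝ =>
      (if 0 ≤ u then ENNReal.ofReal (lam * Real.exp (-(lam * u))) else 0) * F u := hd.mul hF
  rw [lintegral_expMeasure hm, lintegral_expMeasure hF, ← lintegral_const_mul _ hdF,
    ← lintegral_add_right_eq_self _ y]
  have h0 : ∀ᵐ u : ℝ, u ≠ 0 := by simp [ae_iff, measure_singleton]
  refine lintegral_congr_ae ?_
  filter_upwards [h0] with u hu
  rcases lt_or_gt_of_ne hu with h | h
  · simp [h.not_ge, h.le]
  · have h1 : ¬ (u + y ≤ y) := by linarith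
    have h2 : 0 ≤ u + y := by linarith
    rw [if_neg h1, if_pos h2, if_pos h.le, add_sub_cancel_right, ← mul_assoc,
      ← ENNReal.ofReal_mul (Real.exp_pos _).le]
    congr 2
    rw [mul_left_comm, ← Real.exp_add]
    congr 2
    ring

/-- A first point at `u ≤ y` followed by `n` points in the remaining time makes `n + 1` points. The
exponentials combine, and the integral of `(y - u) ^ n` supplies the new factor of the factorial. -/
lemma lintegral_expMeasure_poissonWeight (hlam : 0 < lam) {y : ℝ} (hy : 0 ≤ y) (n : ℕ) :
    ∫⁻ u, (if u ≤ y then poissonWeight lam n (y - u) else 0) ∂(expMeasure lam) =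
      poissonWeight lam (n + 1) y := by
  have hm : Measurable fun u => if u ≤ y then poissonWeight lam n (y - u) else 0 :=
    Measurable.ite measurableSet_Iic
      ((measurable_poissonWeight n).comp (measurable_const.sub measurable_id)) measurable_const
  rw [lintegral_expMeasure hm]
  set c : ℝ := Real.exp (-(lam * y)) * lam ^ (n + 1) / n.factorial with hc
  have hc0 : 0 ≤ c := by positivity
  have h1 : ∀ u, (if 0 ≤ u then ENNReal.ofReal (lam * Real.exp (-(lam * u))) else 0) *
      (if u ≤ y then poissonWeight lam n (y - u) else 0) =
        (Set.Icc 0 y).indicator (fun u => ENNReal.ofReal (c * (y - u) ^ n)) u := by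
    intro u
    by_cases hu : u ∈ Set.Icc 0 y
    · rw [Set.indicator_of_mem hu, if_pos hu.1, if_pos hu.2, poissonWeight,
        ← ENNReal.ofReal_mul (by positivity)]
      congr 1
      have e : Real.exp (-(lam * y)) = Real.exp (-(lam * u)) * Real.exp (-(lam * (y - u))) := by
        rw [← Real.exp_add]
        congr 1
        ring
      rw [hc, e, mul_pow]
      ring
    · rw [Set.indicator_of_notMem hu]
      rw [Set.mem_Icc, not_and_or] at hu
      rcases hu with hu | hu <;> simp [hu]
  simp_rw [h1]
  rw [lintegral_indicator measurableSet_Icc, ← ofReal_integral_eq_lintegral_ofReal]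
  · rw [integral_Icc_eq_integral_Ioc, ← intervalIntegral.integral_of_le hy,
      intervalIntegral.integral_const_mul,
      intervalIntegral.integral_comp_sub_left (fun x => x ^ n) y, integral_pow, poissonWeight]
    congr 1
    rw [hc, Nat.factorial_succ]
    push_cast
    simp only [sub_self, sub_zero, ne_eq, Nat.add_eq_zero_iff, one_ne_zero, and_false,
      not_false_eq_true, zero_pow, mul_pow]
    field_simp
  · exact (Continuous.continuousOn (by fun_prop)).integrableOn_compact isCompact_Icc
  · rw [EventuallyLE, ae_restrict_iff' measurableSet_Icc]
    refine Eventually.of_forall fun u hu => ?_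
    have : 0 ≤ y - u := by linarith [hu.2]
    positivity

/-- By lack of memory the complement has mass `exp (-(lam * y))`. The strict inequality drives the
contraction in `first_batch_le`. -/
lemma expMeasure_Iic_lt_one (hlam : 0 < lam) {y : ℝ} (hy : 0 ≤ y) :
    expMeasure lam (Set.Iic y) < 1 := by
  have := isProbabilityMeasure_expMeasure hlam
  have h := lintegral_expMeasure_memoryless (lam := lam) (measurable_const (a := (1 : ℝ≥0∞))) hy
  have h1 : (fun u => if u ≤ y then (0 : ℝ≥0∞) else 1) = (Set.Iic y)ᶜ.indicator 1 := by
    ext u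
    by_cases hu : u ≤ y
    · simp [hu]
    · simp [hu, not_le.1 hu]
  rw [h1, lintegral_indicator_one measurableSet_Iic.compl] at h
  refine lt_of_le_of_ne prob_le_one fun h2 => ?_
  rw [(prob_compl_eq_zero_iff measurableSet_Iic).2 h2] at h
  simp only [lintegral_const, measure_univ, mul_one] at h
  have := ENNReal.ofReal_pos.2 (Real.exp_pos (-(lam * y)))
  rw [← h] at this
  exact lt_irrefl _ this

end Exponential

/-! ### The Markov renewal equations of the queue -/

section RenewalEquations

/-- The probability that at time `t` a service is in progress (of type 2 unless `P` holds), if there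
are `k` customers at time `0` and the server is blocked up to time `y`. -/
def servProb (P : Prop) (lam : ℝ) (r : PMF ℕ) (B₁ B₂ : Measure ℝ) (L k : ℕ) (y t : ℝ) : ℝ≥0∞ :=
  law lam r B₁ B₂ {ω | Serving P L (initArr k (arr ω.1)) ω.2 y t}

variable {P : Prop} {lam : ℝ} {r : PMF ℕ} {B₁ B₂ : Measure ℝ} [IsProbabilityMeasure B₁]
  [IsProbabilityMeasure B₂] {L k : ℕ} {y t : ℝ}

lemma isProbabilityMeasure_law (hlam : 0 < lam) : IsProbabilityMeasure (law lam r B₁ B₂) := by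
  have := isProbabilityMeasure_expMeasure hlam
  unfold law
  infer_instance

lemma measurableSet_serving_sample {X : Type*} [MeasurableSpace X] {ξ : X → ℕ → ℝ × ℕ}
    {s : X → ℕ → ℝ × ℝ} {y t : X → ℝ} (hξ : Measurable ξ) (hs : Measurable s) (hy : Measurable y)
    (ht : Measurable t) (P : Prop) (L k : ℕ) :
    MeasurableSet {x | Serving P L (initArr k (arr (ξ x))) (s x) (y x) (t x)} :=
  measurableSet_serving (a := fun x => initArr k (arr (ξ x)))
    (fun n => measurable_initArr (α := fun x => arr (ξ x))
      (fun n => (measurable_arr n).comp hξ) k n)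
    (fun n => (measurable_pi_apply n).comp hs) hy ht P L

lemma measurable_servProb (hlam : 0 < lam) :
    Measurable fun p : ℝ × ℝ => servProb P lam r B₁ B₂ L k p.1 p.2 := by
  have := isProbabilityMeasure_law (r := r) (B₁ := B₁) (B₂ := B₂) hlam
  exact measurable_measure_prodMk_left (ν := law lam r B₁ B₂) (s := {p : (ℝ × ℝ) × Sample |
    Serving P L (initArr k (arr p.2.1)) p.2.2 p.1.1 p.1.2})
    (measurableSet_serving_sample (by fun_prop) (by fun_prop) (by fun_prop) (by fun_prop) P L k)

lemma servProb_le_one (hlam : 0 < lam) : servProb P lam r B₁ B₂ L k y t ≤ 1 := by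
  have := isProbabilityMeasure_law (r := r) (B₁ := B₁) (B₂ := B₂) hlam
  exact prob_le_one

lemma servProb_eq_lintegral : servProb P lam r B₁ B₂ L k y t =
    ∫⁻ ξ, (Measure.infinitePi fun _ : ℕ => B₁.prod B₂)
      {s | Serving P L (initArr k (arr ξ)) s y t}
        ∂(Measure.infinitePi fun _ : ℕ => (expMeasure lam).prod r.toMeasure) := by
  rw [servProb, law, Measure.prod_apply]
  · rfl
  · exact measurableSet_serving_sample measurable_fst measurable_snd measurable_const
      measurable_const P L k

lemma measurable_infinitePi_serving {X : Type*} [MeasurableSpace X] {ξ : X → ℕ → ℝ × ℕ}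
    {y t : X → ℝ} (hξ : Measurable ξ) (hy : Measurable y) (ht : Measurable t) :
    Measurable fun x => (Measure.infinitePi fun _ : ℕ => B₁.prod B₂)
      {s | Serving P L (initArr k (arr (ξ x))) s (y x) (t x)} :=
  measurable_measure_prodMk_left (ν := Measure.infinitePi fun _ : ℕ => B₁.prod B₂)
    (s := {p : X × (ℕ → ℝ × ℝ) | Serving P L (initArr k (arr (ξ p.1))) p.2 (y p.1) (t p.1)})
    (measurableSet_serving_sample (by fun_prop) (by fun_prop) (by fun_prop) (by fun_prop) P L k)

lemma ae_services_nonneg (hB₁ : ∀ᵐ x ∂B₁, 0 ≤ x) (hB₂ : ∀ᵐ x ∂B₂, 0 ≤ x) :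
    ∀ᵐ s ∂(Measure.infinitePi fun _ : ℕ => B₁.prod B₂), ∀ n, 0 ≤ (s n).1 ∧ 0 ≤ (s n).2 := by
  refine ae_infinitePi (B₁.prod B₂) (p := fun b => 0 ≤ b.1 ∧ 0 ≤ b.2) ?_
  exact (Measure.quasiMeasurePreserving_fst.ae hB₁).and (Measure.quasiMeasurePreserving_snd.ae hB₂)

lemma ae_batch (hlam : 0 < lam) (hr : r 0 = 0) :
    ∀ᵐ x ∂((expMeasure lam).prod r.toMeasure), 0 < x.1 ∧ 1 ≤ x.2 := by
  have := isProbabilityMeasure_expMeasure hlam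
  have h : ∀ᵐ i ∂r.toMeasure, 1 ≤ i := by
    have h0 : r.toMeasure {0} = 0 := by
      rw [r.toMeasure_apply_singleton 0 (MeasurableSet.singleton 0), hr]
    rw [measure_eq_zero_iff_ae_notMem] at h0
    filter_upwards [h0] with i hi
    exact Nat.one_le_iff_ne_zero.2 (by simpa using hi)
  exact (Measure.quasiMeasurePreserving_fst.ae expMeasure_ae_pos).and
    (Measure.quasiMeasurePreserving_snd.ae h)

lemma ae_batches (hlam : 0 < lam) (hr : r 0 = 0) :
    ∀ᵐ ξ ∂(Measure.infinitePi fun _ : ℕ => (expMeasure lam).prod r.toMeasure),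
      ∀ n, 0 < (ξ n).1 ∧ 1 ≤ (ξ n).2 := by
  have := isProbabilityMeasure_expMeasure hlam
  exact ae_infinitePi _ (ae_batch hlam hr)

lemma servProb_of_lt (hB₁ : ∀ᵐ x ∂B₁, 0 ≤ x) (hB₂ : ∀ᵐ x ∂B₂, 0 ≤ x)
    (ht : t < y) : servProb P lam r B₁ B₂ L k y t = 0 := by
  have hm : Measurable fun ξ : ℕ → ℝ × ℕ => (Measure.infinitePi fun _ : ℕ => B₁.prod B₂)
      {s | Serving P L (initArr k (arr ξ)) s y t} :=
    measurable_infinitePi_serving measurable_id measurable_const measurable_const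
  rw [servProb_eq_lintegral, lintegral_eq_zero_iff hm]
  refine Eventually.of_forall fun ξ => ?_
  change _ = (0 : ℝ≥0∞)
  rw [measure_eq_zero_iff_ae_notMem]
  filter_upwards [ae_services_nonneg hB₁ hB₂] with s hs
  exact not_serving_of_lt hs ht

/-- Condition on the first pair of service times. The two alternatives exclude each other up to a
null set: if the first service still runs at `t`, the server is blocked beyond `t`. Hence the
probabilities add. -/
lemma servProb_service (hlam : 0 < lam) (hr : r 0 = 0) (hB₁ : ∀ᵐ x ∂B₁, 0 ≤ x)
    (hB₂ : ∀ᵐ x ∂B₂, 0 ≤ x) (t : ℝ) : servProb P lam r B₁ B₂ L (k + 1) 0 t =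
      ∫⁻ x, ({x | 0 ≤ t ∧ t < x ∧ (P ∨ L < k + 1)}.indicator 1 x +
        servProb P lam r B₁ B₂ L k x t) ∂(if L < k + 1 then B₂ else B₁) := by
  have hexp := isProbabilityMeasure_expMeasure hlam
  set ν := Measure.infinitePi fun _ : ℕ => B₁.prod B₂ with hν
  set μ := Measure.infinitePi fun _ : ℕ => (expMeasure lam).prod r.toMeasure with hμ
  set D : Set ℝ := {x | 0 ≤ t ∧ t < x ∧ (P ∨ L < k + 1)} with hD
  have hDm : MeasurableSet D := by
    simp only [hD, Set.ofPred_and]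
    exact (MeasurableSet.const _).inter (measurableSet_Ioi.inter (MeasurableSet.const _))
  set x : ℝ × ℝ → ℝ := fun b => if L < k + 1 then b.2 else b.1 with hx
  have hxm : Measurable x := by
    simp only [hx]
    split_ifs
    exacts [measurable_snd, measurable_fst]
  have hxmap : (B₁.prod B₂).map x = if L < k + 1 then B₂ else B₁ := by
    simp only [hx]
    split_ifs
    · exact Measure.map_snd_prod.trans (by simp)
    · exact Measure.map_fst_prod.trans (by simp)
  have h1 : ∀ ξ : ℕ → ℝ × ℕ, (∀ n, 0 < (ξ n).1 ∧ 1 ≤ (ξ n).2) →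
      ν {s | Serving P L (initArr (k + 1) (arr ξ)) s 0 t} =
        ∫⁻ b, (D.indicator 1 (x b) + ν {s | Serving P L (initArr k (arr ξ)) s (x b) t})
          ∂(B₁.prod B₂) := by
    intro ξ hξ
    have hset : MeasurableSet {s | Serving P L (initArr (k + 1) (arr ξ)) s 0 t} :=
      measurableSet_serving_sample measurable_const measurable_id measurable_const
        measurable_const P L (k + 1)
    rw [← lintegral_indicator_one hset, hν,
      lintegral_infinitePi_cons _ (measurable_one.indicator hset)]
    refine lintegral_congr fun b => ?_
    by_cases hb : x b ∈ D
    · have hb' : 0 ≤ t ∧ t < x b ∧ (P ∨ L < k + 1) := hb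
      have h2 : ν {s | Serving P L (initArr k (arr ξ)) s (x b) t} = 0 := by
        rw [measure_eq_zero_iff_ae_notMem]
        filter_upwards [ae_services_nonneg hB₁ hB₂] with s hs
        exact not_serving_of_lt hs hb'.2.1
      rw [← hν, h2, Set.indicator_of_mem hb]
      have h3 : ∀ s, {s | Serving P L (initArr (k + 1) (arr ξ)) s 0 t}.indicator
          (1 : (ℕ → ℝ × ℝ) → ℝ≥0∞) (consSeq b s) = 1 := by
        intro s
        rw [Set.indicator_of_mem]
        · rfl
        · exact (serving_initArr_succ (arr_pos hξ) b).2 (Or.inl hb')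
      simp [h3]
    · rw [Set.indicator_of_notMem hb, zero_add]
      have hset2 : MeasurableSet {s | Serving P L (initArr k (arr ξ)) s (x b) t} :=
        measurableSet_serving_sample measurable_const measurable_id measurable_const
          measurable_const P L k
      rw [← lintegral_indicator_one hset2]
      refine lintegral_congr fun s => ?_
      have h4 : consSeq b s ∈ {s | Serving P L (initArr (k + 1) (arr ξ)) s 0 t} ↔
          s ∈ {s | Serving P L (initArr k (arr ξ)) s (x b) t} := by
        refine (serving_initArr_succ (arr_pos hξ) b).trans ?_
        exact or_iff_right hb
      by_cases h5 : s ∈ {s | Serving P L (initArr k (arr ξ)) s (x b) t}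
      · rw [Set.indicator_of_mem h5, Set.indicator_of_mem (h4.2 h5)]
        rfl
      · rw [Set.indicator_of_notMem h5, Set.indicator_of_notMem fun h => h5 (h4.1 h)]
  have hm2 : Measurable fun p : (ℕ → ℝ × ℕ) × (ℝ × ℝ) =>
      ν {s | Serving P L (initArr k (arr p.1)) s (x p.2) t} :=
    measurable_infinitePi_serving measurable_fst (hxm.comp measurable_snd) measurable_const
  have hm1 : Measurable fun b => D.indicator (1 : ℝ → ℝ≥0∞) (x b) :=
    (measurable_one.indicator hDm).comp hxm
  have hm3 : Measurable fun x => D.indicator (1 : ℝ → ℝ≥0∞) x + servProb P lam r B₁ B₂ L k x t :=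
    (measurable_one.indicator hDm).add
      ((measurable_servProb hlam).comp (measurable_id.prodMk measurable_const))
  rw [← hxmap, lintegral_map hm3 hxm, servProb_eq_lintegral]
  calc _ = ∫⁻ ξ, ∫⁻ b, (D.indicator 1 (x b) + ν {s | Serving P L (initArr k (arr ξ)) s (x b) t})
          ∂(B₁.prod B₂) ∂μ := by
        refine lintegral_congr_ae ?_
        filter_upwards [ae_batches hlam hr] with ξ hξ
        exact h1 ξ hξ
    _ = ∫⁻ b, ∫⁻ ξ, (D.indicator 1 (x b) + ν {s | Serving P L (initArr k (arr ξ)) s (x b) t})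
          ∂μ ∂(B₁.prod B₂) :=
        lintegral_lintegral_swap ((hm1.comp measurable_snd).add hm2).aemeasurable
    _ = _ := by
        refine lintegral_congr fun b => ?_
        rw [lintegral_add_left measurable_const, servProb_eq_lintegral]
        simp [hμ, hν]

lemma lintegral_cons_batch (hlam : 0 < lam) {F : (ℕ → ℝ × ℕ) → ℝ≥0∞} (hF : Measurable F) :
    ∫⁻ ξ, F ξ ∂(Measure.infinitePi fun _ : ℕ => (expMeasure lam).prod r.toMeasure) =
      ∫⁻ x, ∫⁻ ξ, F (consSeq x ξ)
        ∂(Measure.infinitePi fun _ : ℕ => (expMeasure lam).prod r.toMeasure)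
          ∂((expMeasure lam).prod r.toMeasure) := by
  have hexp := isProbabilityMeasure_expMeasure hlam
  exact lintegral_infinitePi_cons _ hF

lemma servProb_empty (hlam : 0 < lam) (hr : r 0 = 0) (t : ℝ) :
    servProb P lam r B₁ B₂ L 0 0 t =
      ∫⁻ x, servProb P lam r B₁ B₂ L x.2 0 (t - x.1) ∂((expMeasure lam).prod r.toMeasure) := by
  have hm : Measurable fun ξ : ℕ → ℝ × ℕ => (Measure.infinitePi fun _ : ℕ => B₁.prod B₂)
      {s | Serving P L (initArr 0 (arr ξ)) s 0 t} :=
    measurable_infinitePi_serving measurable_id measurable_const measurable_const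
  rw [servProb_eq_lintegral, lintegral_cons_batch hlam hm]
  refine lintegral_congr_ae ?_
  filter_upwards [ae_batch hlam hr] with x hx
  rw [servProb_eq_lintegral]
  refine lintegral_congr_ae ?_
  filter_upwards [ae_batches hlam hr] with ξ hξ
  simp only [serving_batch_empty (fun n => (hξ n).2) hx.1.le hx.2]

/-- Either the first batch arrives while the server is blocked, or the residual waiting time at `y`
is again exponential and the system restarts at `y` with the same `k`. -/
lemma servProb_first_batch (hlam : 0 < lam) (hr : r 0 = 0) (hB₁ : ∀ᵐ x ∂B₁, 0 ≤ x)
    (hB₂ : ∀ᵐ x ∂B₂, 0 ≤ x) (k : ℕ) (hy : 0 ≤ y) (t : ℝ) :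
    servProb P lam r B₁ B₂ L k y t =
      ∫⁻ x, (if x.1 ≤ y then servProb P lam r B₁ B₂ L (k + x.2) (y - x.1) (t - x.1) else 0)
        ∂((expMeasure lam).prod r.toMeasure) +
      ENNReal.ofReal (Real.exp (-(lam * y))) * servProb P lam r B₁ B₂ L k 0 (t - y) := by
  have hexp := isProbabilityMeasure_expMeasure hlam
  set ν := Measure.infinitePi fun _ : ℕ => B₁.prod B₂ with hν
  set μ := Measure.infinitePi fun _ : ℕ => (expMeasure lam).prod r.toMeasure with hμ
  set G : (ℕ → ℝ × ℕ) → ℝ≥0∞ := fun ξ => ν {s | Serving P L (initArr k (arr ξ)) s y t} with hG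
  set G' : (ℕ → ℝ × ℕ) → ℝ≥0∞ :=
    fun ξ => ν {s | Serving P L (initArr k (arr ξ)) s 0 (t - y)} with hG'
  have hGm : Measurable G :=
    measurable_infinitePi_serving measurable_id measurable_const measurable_const
  have hG'm : Measurable G' :=
    measurable_infinitePi_serving measurable_id measurable_const measurable_const
  set H : ℝ × ℕ → ℝ≥0∞ := fun x => ∫⁻ ξ, G' (consSeq x ξ) ∂μ with hH
  have hHm : Measurable H := (hG'm.comp measurable_consSeq).lintegral_prod_right'
  have hH0 : servProb P lam r B₁ B₂ L k 0 (t - y) =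
      ∫⁻ x, H x ∂((expMeasure lam).prod r.toMeasure) := by
    rw [servProb_eq_lintegral, lintegral_cons_batch hlam hG'm]
  have hHy : ∫⁻ x, (if x.1 ≤ y then 0 else H (x.1 - y, x.2)) ∂((expMeasure lam).prod r.toMeasure) =
      ENNReal.ofReal (Real.exp (-(lam * y))) * servProb P lam r B₁ B₂ L k 0 (t - y) := by
    rw [hH0, lintegral_prod_symm _ hHm.aemeasurable, lintegral_prod_symm]
    · rw [← lintegral_const_mul _ hHm.lintegral_prod_left']
      refine lintegral_congr fun i => ?_
      exact lintegral_expMeasure_memoryless (F := fun u => H (u, i))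
        (hHm.comp (measurable_id.prodMk measurable_const)) hy
    · refine (Measurable.ite (measurableSet_le measurable_fst measurable_const) measurable_const
        (hHm.comp ?_)).aemeasurable
      exact (measurable_fst.sub measurable_const).prodMk measurable_snd
  rw [← hHy, ← lintegral_add_right, servProb_eq_lintegral, lintegral_cons_batch hlam hGm]
  · refine lintegral_congr_ae ?_
    filter_upwards [ae_batch hlam hr] with x hx
    split_ifs with hxy
    · rw [add_zero, servProb_eq_lintegral]
      refine lintegral_congr_ae ?_
      filter_upwards [ae_batches hlam hr] with ξ hξ
      refine measure_congr ?_
      filter_upwards [ae_services_nonneg hB₁ hB₂] with s hs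
      exact propext (serving_batch_before hs (fun n => (hξ n).2) hx.1.le hxy)
    · rw [zero_add]
      refine lintegral_congr_ae ?_
      filter_upwards [ae_batches hlam hr] with ξ hξ
      refine measure_congr ?_
      filter_upwards [ae_services_nonneg hB₁ hB₂] with s hs
      exact propext (serving_batch_after hs (fun n => (hξ n).2) hy)
  · refine Measurable.ite (measurableSet_le measurable_fst measurable_const) measurable_const
      (hHm.comp ?_)
    exact (measurable_fst.sub measurable_const).prodMk measurable_snd

lemma measurable_inputMean {v : ℕ → ℝ≥0∞} {r : Measure ℕ} :
    Measurable fun y => inputMean lam r y v :=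
  Measurable.tsum fun n => (measurable_poissonWeight n).mul_const _

/-- The compound Poisson mean obeys the same decomposition: the first batch splits off from `n + 1`
batches, and `lintegral_expMeasure_poissonWeight` accounts for its arrival time. The last term is
the event of no batch. -/
lemma inputMean_first_batch (hlam : 0 < lam) {r : Measure ℕ} [IsProbabilityMeasure r] (hy : 0 ≤ y)
    (v : ℕ → ℝ≥0∞) : inputMean lam r y v =
      ∫⁻ x, (if x.1 ≤ y then inputMean lam r (y - x.1) (fun j => v (x.2 + j)) else 0)
        ∂((expMeasure lam).prod r) + ENNReal.ofReal (Real.exp (-(lam * y))) * v 0 := by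
  have hexp := isProbabilityMeasure_expMeasure hlam
  have hm : ∀ n : ℕ, Measurable fun x : ℝ × ℕ => (if x.1 ≤ y then poissonWeight lam n (y - x.1)
      else 0) * ∫⁻ j, v (x.2 + j) ∂(convPow r n) := by
    intro n
    refine Measurable.mul (Measurable.ite (measurableSet_le measurable_fst measurable_const)
      ((measurable_poissonWeight n).comp (measurable_const.sub measurable_fst)) measurable_const) ?_
    exact (Measurable.of_discrete (f := fun i : ℕ => ∫⁻ j, v (i + j) ∂(convPow r n))).comp
      measurable_snd
  have h1 : ∀ x : ℝ × ℕ, (if x.1 ≤ y then inputMean lam r (y - x.1) (fun j => v (x.2 + j)) else 0) =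
      ∑' n, (if x.1 ≤ y then poissonWeight lam n (y - x.1) else 0) *
        ∫⁻ j, v (x.2 + j) ∂(convPow r n) := by
    intro x
    split_ifs
    · rfl
    · simp
  simp_rw [h1]
  rw [lintegral_tsum fun n => (hm n).aemeasurable, inputMean, tsum_eq_zero_add' ENNReal.summable,
    add_comm]
  congr 1
  · refine tsum_congr fun n => ?_
    rw [lintegral_convPow_succ, ← lintegral_expMeasure_poissonWeight hlam hy,
      lintegral_prod_mul (f := fun u : ℝ => if u ≤ y then poissonWeight lam n (y - u) else 0)
        (g := fun i : ℕ => ∫⁻ j, v (i + j) ∂(convPow r n))]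
    · exact (Measurable.ite measurableSet_Iic
        ((measurable_poissonWeight n).comp (measurable_const.sub measurable_id))
          measurable_const).aemeasurable
    · exact Measurable.of_discrete.aemeasurable
  · simp [poissonWeight, convPow]

/-- Uniqueness of the bounded solution of the first-batch equation. -/
lemma first_batch_le (hlam : 0 < lam) {r : Measure ℕ} [IsProbabilityMeasure r]
    {U V : ℕ → ℝ → ℝ≥0∞} {w : ℕ → ℝ → ℝ≥0∞} (hV : ∀ k, Measurable (V k))
    (hU1 : ∀ k y, U k y ≤ 1) (hw : ∀ k y, w k y ≠ ⊤)
    (hU : ∀ k y, 0 ≤ y → U k y = ∫⁻ x, (if x.1 ≤ y then U (k + x.2) (y - x.1) else 0)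
      ∂((expMeasure lam).prod r) + w k y)
    (hVeq : ∀ k y, 0 ≤ y → V k y = ∫⁻ x, (if x.1 ≤ y then V (k + x.2) (y - x.1) else 0)
      ∂((expMeasure lam).prod r) + w k y) (k : ℕ) (hy : 0 ≤ y) : U k y ≤ V k y := by
  have hexp := isProbabilityMeasure_expMeasure hlam
  set S : ℝ≥0∞ := ⨆ k : ℕ, ⨆ z : Set.Icc 0 y, (U k z - V k z) with hS
  have hS1 : S ≤ 1 := iSup_le fun k => iSup_le fun z => tsub_le_self.trans (hU1 k z)
  have hle : ∀ k : ℕ, ∀ z ∈ Set.Icc 0 y, U k z - V k z ≤ S := fun k z hz =>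
    (le_iSup (fun z : Set.Icc 0 y => U k z - V k z) ⟨z, hz⟩).trans
      (le_iSup (fun k : ℕ => ⨆ z : Set.Icc 0 y, (U k z - V k z)) k)
  -- One application of the equations gains the probability that the first batch arrives by `y`;
  -- since this is below one, the finite supremum `S` must vanish.
  have hstep : S ≤ S * expMeasure lam (Set.Iic y) := by
    refine iSup_le fun k => iSup_le fun ⟨z, hz⟩ => ?_
    change U k z - V k z ≤ _
    rw [hU k z hz.1, hVeq k z hz.1, ENNReal.add_sub_add_eq_sub_right (hw k z)]
    have hVm : Measurable fun x : ℝ × ℕ => if x.1 ≤ z then V (k + x.2) (z - x.1) else 0 := by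
      refine Measurable.ite (measurableSet_le measurable_fst measurable_const) ?_ measurable_const
      refine measurable_from_prod_countable_left fun i => ?_
      exact (hV (k + i)).comp (measurable_const.sub measurable_id)
    refine (lintegral_sub_le _ _ hVm).trans ?_
    have h0 : ∀ᵐ x ∂((expMeasure lam).prod r), 0 < x.1 :=
      Measure.quasiMeasurePreserving_fst.ae expMeasure_ae_pos
    calc _ ≤ ∫⁻ x, (Set.Iic y ×ˢ (Set.univ : Set ℕ)).indicator (fun _ => S) x
          ∂((expMeasure lam).prod r) := by
          refine lintegral_mono_ae ?_
          filter_upwards [h0] with x hx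
          by_cases h : x.1 ≤ z
          · rw [if_pos h, if_pos h, Set.indicator_of_mem
              (show x ∈ Set.Iic y ×ˢ (Set.univ : Set ℕ) from ⟨h.trans hz.2, trivial⟩)]
            exact hle _ _ ⟨by linarith, by linarith [hz.2]⟩
          · simp [h]
      _ = _ := by
          rw [lintegral_indicator_const (measurableSet_Iic.prod MeasurableSet.univ),
            Measure.prod_prod]
          simp
  have hS0 : S = 0 := by
    by_contra hne
    have h1 : S * expMeasure lam (Set.Iic y) < S * 1 :=
      ENNReal.mul_lt_mul_right hne (hS1.trans_lt ENNReal.one_lt_top).ne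
        (expMeasure_Iic_lt_one hlam hy)
    rw [mul_one] at h1
    exact absurd hstep (not_le.2 h1)
  have := hle k y ⟨hy, le_rfl⟩
  rw [hS0] at this
  exact tsub_eq_zero_iff_le.1 (le_antisymm this zero_le)

/-- With `t - y` held fixed, both sides solve the first-batch equation in `y`, whose bounded
solution is unique. -/
lemma servProb_blocked (hlam : 0 < lam) (hr : r 0 = 0) (hB₁ : ∀ᵐ x ∂B₁, 0 ≤ x)
    (hB₂ : ∀ᵐ x ∂B₂, 0 ≤ x) (k : ℕ) (hy : 0 ≤ y) (t : ℝ) :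
    servProb P lam r B₁ B₂ L k y t =
      inputMean lam r.toMeasure y (fun j => servProb P lam r B₁ B₂ L (k + j) 0 (t - y)) := by
  set d := t - y with hd
  set U : ℕ → ℝ → ℝ≥0∞ := fun k z => servProb P lam r B₁ B₂ L k z (z + d) with hUdef
  -- Cut off at negative `z`, where the Poisson weights are not probabilities and the bound by one
  -- may fail.
  set V : ℕ → ℝ → ℝ≥0∞ := fun k z =>
    if 0 ≤ z then inputMean lam r.toMeasure z (fun j => servProb P lam r B₁ B₂ L (k + j) 0 d)
    else 0 with hVdef
  set w : ℕ → ℝ → ℝ≥0∞ := fun k z =>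
    ENNReal.ofReal (Real.exp (-(lam * z))) * servProb P lam r B₁ B₂ L k 0 d with hwdef
  have hUm : ∀ k, Measurable (U k) := fun k =>
    (measurable_servProb hlam).comp (measurable_id.prodMk (measurable_id.add measurable_const))
  have hVm : ∀ k, Measurable (V k) := fun k =>
    Measurable.ite measurableSet_Ici measurable_inputMean measurable_const
  have hU1 : ∀ k z, U k z ≤ 1 := fun k z => servProb_le_one hlam
  have hV1 : ∀ k z, V k z ≤ 1 := by
    intro k z
    simp only [hVdef]
    split_ifs with hz
    · rw [← inputMean_const (r := r.toMeasure) hlam hz 1]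
      exact ENNReal.tsum_le_tsum fun n => mul_le_mul_right
        (lintegral_mono fun j => servProb_le_one hlam) _
    · exact zero_le
  have hw : ∀ k z, w k z ≠ ⊤ := fun k z =>
    ENNReal.mul_ne_top ENNReal.ofReal_ne_top
      ((servProb_le_one hlam).trans_lt ENNReal.one_lt_top).ne
  have hU : ∀ k z, 0 ≤ z → U k z = ∫⁻ x, (if x.1 ≤ z then U (k + x.2) (z - x.1) else 0)
      ∂((expMeasure lam).prod r.toMeasure) + w k z := by
    intro k z hz
    simp only [hUdef, hwdef]
    rw [servProb_first_batch hlam hr hB₁ hB₂ k hz]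
    simp only [add_sub_cancel_left, sub_add_eq_add_sub]
  have hV : ∀ k z, 0 ≤ z → V k z = ∫⁻ x, (if x.1 ≤ z then V (k + x.2) (z - x.1) else 0)
      ∂((expMeasure lam).prod r.toMeasure) + w k z := by
    intro k z hz
    simp only [hVdef, hwdef, if_pos hz]
    rw [inputMean_first_batch hlam hz]
    congr 1
    refine lintegral_congr fun x => ?_
    by_cases hx : x.1 ≤ z
    · rw [if_pos hx, if_pos hx, if_pos (by linarith)]
      simp only [add_assoc]
    · rw [if_neg hx, if_neg hx]
  have h := le_antisymm (first_batch_le hlam hVm hU1 hw hU hV k hy)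
    (first_batch_le hlam hUm hV1 hw hV hU k hy)
  simpa only [hUdef, hVdef, if_pos hy, hd, add_sub_cancel] using h

/-- The renewal equation at the end of the first service. -/
lemma servProb_succ (hlam : 0 < lam) (hr : r 0 = 0) (hB₁ : ∀ᵐ x ∂B₁, 0 ≤ x)
    (hB₂ : ∀ᵐ x ∂B₂, 0 ≤ x) (k : ℕ) (t : ℝ) : servProb P lam r B₁ B₂ L (k + 1) 0 t =
      (if L < k + 1 then B₂ else B₁) {x | 0 ≤ t ∧ t < x ∧ (P ∨ L < k + 1)} +
      ∫⁻ p, servProb P lam r B₁ B₂ L (k + p.2) 0 (t - p.1)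
        ∂(serviceLaw lam r.toMeasure (if L < k + 1 then B₂ else B₁)) := by
  have hB : ∀ᵐ x ∂(if L < k + 1 then B₂ else B₁), 0 ≤ x := by split_ifs <;> assumption
  have hBp : IsProbabilityMeasure (if L < k + 1 then B₂ else B₁) := by split_ifs <;> assumption
  have hDm : MeasurableSet {x : ℝ | 0 ≤ t ∧ t < x ∧ (P ∨ L < k + 1)} := by
    simp only [Set.ofPred_and]
    exact (MeasurableSet.const _).inter (measurableSet_Ioi.inter (MeasurableSet.const _))
  rw [servProb_service hlam hr hB₁ hB₂, lintegral_add_left (measurable_one.indicator hDm),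
    lintegral_indicator_one hDm, lintegral_serviceLaw]
  · congr 1
    refine lintegral_congr_ae ?_
    filter_upwards [hB] with x hx
    exact servProb_blocked hlam hr hB₁ hB₂ k hx t
  · refine measurable_from_prod_countable_left fun i => ?_
    exact (measurable_servProb (P := P) (r := r) (B₁ := B₁) (B₂ := B₂) (L := L) (k := k + i)
      hlam).comp (measurable_const.prodMk (measurable_const.sub measurable_id))

end RenewalEquations

/-! ### Markov renewal equations -/

section MarkovRenewal

/-- Expectation of `u` after a step of the Markov renewal process from the state `k` at time to
go `t`; under `μ` the step lasts for the first coordinate and adds the second one to the state. -/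
def shiftMean (μ : Measure (ℝ × ℕ)) (u : ℕ → ℝ → ℝ≥0∞) (k : ℕ) (t : ℝ) : ℝ≥0∞ :=
  ∫⁻ p, u (k + p.2) (t - p.1) ∂μ

/-- Iterates of the Markov renewal equation with forcing term `g`, killed in the state `0`. -/
def busyIter (κ : ℕ → Measure (ℝ × ℕ)) (g : ℕ → ℝ → ℝ≥0∞) : ℕ → ℕ → ℝ → ℝ≥0∞
  | 0, _, _ => 0
  | _ + 1, 0, _ => 0
  | n + 1, k + 1, t => g k t + shiftMean (κ k) (busyIter κ g n) k t

/-- The minimal solution of the Markov renewal equation killed in the state `0`. -/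
def busy (κ : ℕ → Measure (ℝ × ℕ)) (g : ℕ → ℝ → ℝ≥0∞) (k : ℕ) (t : ℝ) : ℝ≥0∞ :=
  ⨆ n, busyIter κ g n k t

variable {μ : Measure (ℝ × ℕ)} {u v : ℕ → ℝ → ℝ≥0∞}

lemma measurable_shift (hu : ∀ k, Measurable (u k)) (k : ℕ) :
    Measurable fun q : ℝ × (ℝ × ℕ) => u (k + q.2.2) (q.1 - q.2.1) := by
  have h : Measurable fun q : ℝ × ℕ => u (k + q.2) q.1 :=
    measurable_from_prod_countable_left fun i => hu (k + i)
  exact h.comp ((measurable_fst.sub (measurable_fst.comp measurable_snd)).prodMk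
    (measurable_snd.comp measurable_snd))

lemma measurable_shift_const (hu : ∀ k, Measurable (u k)) (k : ℕ) (t : ℝ) :
    Measurable fun p : ℝ × ℕ => u (k + p.2) (t - p.1) :=
  (measurable_shift hu k).comp (measurable_const.prodMk measurable_id)

lemma measurable_shiftMean [SFinite μ] (hu : ∀ k, Measurable (u k)) (k : ℕ) :
    Measurable (shiftMean μ u k) :=
  (measurable_shift hu k).lintegral_prod_right'

lemma shiftMean_mono (h : ∀ k t, u k t ≤ v k t) (k : ℕ) (t : ℝ) :
    shiftMean μ u k t ≤ shiftMean μ v k t :=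
  lintegral_mono fun _ => h _ _

lemma shiftMean_of_neg (hμ : ∀ᵐ p ∂μ, 0 ≤ p.1) (hu : ∀ k t, t < 0 → u k t = 0) {k : ℕ} {t : ℝ}
    (ht : t < 0) : shiftMean μ u k t = 0 := by
  rw [shiftMean, lintegral_congr_ae (g := fun _ => 0), lintegral_zero]
  filter_upwards [hμ] with p hp
  exact hu _ _ (by linarith)

lemma shiftMean_add (hu : ∀ k, Measurable (u k)) (k : ℕ) (t : ℝ) :
    shiftMean μ (fun k t => u k t + v k t) k t = shiftMean μ u k t + shiftMean μ v k t :=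
  lintegral_add_left (measurable_shift_const hu k t) _

lemma shiftMean_tsub_le (hv : ∀ k, Measurable (v k)) (k : ℕ) (t : ℝ) :
    shiftMean μ u k t - shiftMean μ v k t ≤ shiftMean μ (fun k t => u k t - v k t) k t :=
  lintegral_sub_le _ _ (measurable_shift_const hv k t)

lemma lintegral_shiftMean [SFinite μ] (hu : ∀ k, Measurable (u k)) (k : ℕ) :
    ∫⁻ t, shiftMean μ u k t = ∫⁻ j, (∫⁻ t, u (k + j) t) ∂(μ.map Prod.snd) := by
  rw [lintegral_map Measurable.of_discrete measurable_snd]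
  unfold shiftMean
  rw [lintegral_lintegral_swap (measurable_shift hu k).aemeasurable]
  refine lintegral_congr fun p => ?_
  exact lintegral_sub_right_eq_self (fun t => u (k + p.2) t) p.1

lemma shiftMean_convolution [SFinite μ] {w : ℝ → ℝ≥0∞} (hu : ∀ k, Measurable (u k))
    (hw : Measurable w) (k : ℕ) (t : ℝ) :
    shiftMean μ (fun k t => ∫⁻ v, u k (t - v) * w v) k t =
      ∫⁻ v, shiftMean μ u k (t - v) * w v := by
  unfold shiftMean
  have hm : Measurable fun q : (ℝ × ℕ) × ℝ => u (k + q.1.2) (t - q.2 - q.1.1) :=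
    (measurable_shift hu k).comp
      ((measurable_const.sub measurable_snd).prodMk measurable_fst)
  simp_rw [sub_right_comm t _ (_ : ℝ)]
  rw [lintegral_lintegral_swap]
  · refine lintegral_congr fun v => ?_
    rw [lintegral_mul_const]
    exact hm.comp (measurable_id.prodMk measurable_const)
  · exact (hm.mul (hw.comp measurable_snd)).aemeasurable

variable {κ : ℕ → Measure (ℝ × ℕ)} {g : ℕ → ℝ → ℝ≥0∞}

@[simp] lemma busyIter_at_zero (n : ℕ) (t : ℝ) : busyIter κ g n 0 t = 0 := by
  cases n <;> rfl

@[simp] lemma busy_at_zero (t : ℝ) : busy κ g 0 t = 0 := by simp [busy]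

lemma busyIter_le_succ (n k : ℕ) (t : ℝ) : busyIter κ g n k t ≤ busyIter κ g (n + 1) k t := by
  induction n generalizing k t with
  | zero => exact zero_le
  | succ n ih =>
    cases k with
    | zero => simp
    | succ k => exact add_le_add le_rfl (shiftMean_mono ih _ _)

lemma busyIter_mono (k : ℕ) (t : ℝ) : Monotone fun n => busyIter κ g n k t :=
  monotone_nat_of_le_succ fun n => busyIter_le_succ n k t

lemma busyIter_le_busy (n k : ℕ) (t : ℝ) : busyIter κ g n k t ≤ busy κ g k t :=
  le_iSup (fun n => busyIter κ g n k t) n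

lemma busy_le_of_superharmonic (hv : ∀ k t, g k t + shiftMean (κ k) v k t ≤ v (k + 1) t) (k : ℕ)
    (t : ℝ) : busy κ g k t ≤ v k t := by
  refine iSup_le fun n => ?_
  induction n generalizing k t with
  | zero => exact zero_le
  | succ n ih =>
    cases k with
    | zero => simp
    | succ k => exact (add_le_add le_rfl (shiftMean_mono ih _ _)).trans (hv k t)

lemma busyIter_of_neg (hκ : ∀ k, ∀ᵐ p ∂(κ k), 0 ≤ p.1) (hg0 : ∀ k t, t < 0 → g k t = 0) (n k : ℕ)
    (t : ℝ) (ht : t < 0) : busyIter κ g n k t = 0 := by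
  induction n generalizing k t with
  | zero => rfl
  | succ n ih =>
    cases k with
    | zero => rfl
    | succ k => rw [busyIter, hg0 k t ht, shiftMean_of_neg (hκ k) ih ht, add_zero]

lemma busy_of_neg (hκ : ∀ k, ∀ᵐ p ∂(κ k), 0 ≤ p.1) (hg0 : ∀ k t, t < 0 → g k t = 0) (k : ℕ)
    (t : ℝ) (ht : t < 0) : busy κ g k t = 0 := by
  simp [busy, busyIter_of_neg hκ hg0 _ k t ht]

/-- A bounded subsolution of the homogeneous Markov renewal equation vanishes. -/
lemma eq_zero_of_subsolution {η : Measure (ℝ × ℕ)} {p₁ p₂ : Measure ℕ} {L : ℕ} {C : ℝ≥0∞}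
    [IsProbabilityMeasure p₁] [IsProbabilityMeasure p₂]
    (hκ0 : ∀ k, ∀ᵐ p ∂(κ k), 0 ≤ p.1)
    (hκ : ∀ k, (κ k).map Prod.snd = if L < k + 1 then p₂ else p₁)
    (hfin : ∀ k, cost p₁ p₂ 1 1 L k ≠ ⊤)
    (hη : ∫⁻ p, ENNReal.ofReal (Real.exp (-p.1)) ∂η < 1) (hC : C ≠ ⊤) (huC : ∀ k t, u k t ≤ C)
    (hu0 : ∀ k t, t < 0 → u k t = 0) (hu : ∀ k t, u (k + 1) t ≤ shiftMean (κ k) u k t)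
    (huη : ∀ t, u 0 t ≤ shiftMean η u 0 t) (k : ℕ) (t : ℝ) : u k t = 0 := by
  -- Discounting by `exp (-t)`: steps have nonnegative duration, so `δ` is subharmonic for the
  -- embedded walk and maximal at `0`. From `0` the law `η` discounts by a factor below one, whence
  -- `δ 0 = 0`.
  set δ : ℕ → ℝ≥0∞ := fun k => ⨆ t : ℝ, ENNReal.ofReal (Real.exp (-t)) * u k t with hδ
  have hle : ∀ k t, ENNReal.ofReal (Real.exp (-t)) * u k t ≤ δ k := fun k t =>
    le_iSup (fun t : ℝ => ENNReal.ofReal (Real.exp (-t)) * u k t) t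
  have hδC : ∀ k, δ k ≤ C := by
    refine fun k => iSup_le fun t => ?_
    rcases lt_or_ge t 0 with ht | ht
    · simp [hu0 k t ht]
    · refine (mul_le_mul' (ENNReal.ofReal_le_one.2 ?_) (huC k t)).trans (one_mul C).le
      exact Real.exp_le_one_iff.2 (by linarith)
  have hsplit : ∀ (t : ℝ) (k : ℕ) (p : ℝ × ℕ),
      ENNReal.ofReal (Real.exp (-t)) * u (k + p.2) (t - p.1) ≤
        ENNReal.ofReal (Real.exp (-p.1)) * δ (k + p.2) := by
    intro t k p
    have : Real.exp (-t) = Real.exp (-p.1) * Real.exp (-(t - p.1)) := by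
      rw [← Real.exp_add]
      congr 1
      ring
    rw [this, ENNReal.ofReal_mul (Real.exp_pos _).le, mul_assoc]
    exact mul_le_mul' le_rfl (hle _ _)
  have hδ0 : ∀ k, δ k ≤ δ 0 := by
    refine le_zero_of_subharmonic hC hδC (fun k => iSup_le fun t => ?_) hfin
    rw [← hκ, lintegral_map Measurable.of_discrete measurable_snd]
    refine (mul_le_mul' le_rfl (hu k t)).trans ?_
    rw [shiftMean, ← lintegral_const_mul' _ _ ENNReal.ofReal_ne_top]
    refine lintegral_mono_ae ?_
    filter_upwards [hκ0 k] with p hp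
    refine (hsplit t k p).trans ((mul_le_mul' (ENNReal.ofReal_le_one.2 ?_) le_rfl).trans
      (one_mul _).le)
    exact Real.exp_le_one_iff.2 (by linarith)
  have hstep : δ 0 ≤ (∫⁻ p, ENNReal.ofReal (Real.exp (-p.1)) ∂η) * δ 0 := by
    refine iSup_le fun t => (mul_le_mul' le_rfl (huη t)).trans ?_
    rw [shiftMean, ← lintegral_const_mul' _ _ ENNReal.ofReal_ne_top,
      ← lintegral_mul_const' _ _ (ne_top_of_le_ne_top hC (hδC 0))]
    exact lintegral_mono fun p => (hsplit t 0 p).trans (mul_le_mul' le_rfl (hδ0 _))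
  have h0 : δ 0 = 0 := by
    by_contra hne
    have h1 := ENNReal.mul_lt_mul_left hne (ne_top_of_le_ne_top hC (hδC 0)) hη
    rw [one_mul] at h1
    exact absurd hstep (not_le.2 h1)
  have h2 := (hle k t).trans (hδ0 k)
  rw [h0, nonpos_iff_eq_zero, mul_eq_zero] at h2
  exact h2.resolve_left (ENNReal.ofReal_pos.2 (Real.exp_pos _)).ne'

variable [∀ k, IsProbabilityMeasure (κ k)]

lemma measurable_busyIter (hg : ∀ k, Measurable (g k)) (n k : ℕ) :
    Measurable (busyIter κ g n k) := by
  induction n generalizing k with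
  | zero => exact measurable_const
  | succ n ih =>
    cases k with
    | zero => exact measurable_const
    | succ k => exact (hg k).add (measurable_shiftMean ih k)

lemma measurable_busy (hg : ∀ k, Measurable (g k)) (k : ℕ) : Measurable (busy κ g k) :=
  Measurable.iSup fun n => measurable_busyIter hg n k

lemma busy_succ (hg : ∀ k, Measurable (g k)) (k : ℕ) (t : ℝ) :
    busy κ g (k + 1) t = g k t + shiftMean (κ k) (busy κ g) k t := by
  have h : busy κ g (k + 1) t = ⨆ n, busyIter κ g (n + 1) (k + 1) t :=
    le_antisymm (iSup_mono fun n => busyIter_le_succ n _ _)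
      (iSup_le fun n => busyIter_le_busy _ _ _)
  rw [h]
  simp only [busyIter, busy, shiftMean]
  rw [← ENNReal.add_iSup, lintegral_iSup
    (fun n => measurable_shift_const (measurable_busyIter hg n) k t)]
  intro m n hmn p
  exact busyIter_mono _ _ hmn

/-- The integral of the minimal solution is an expected cost of the embedded walk. -/
lemma lintegral_busy {p₁ p₂ : Measure ℕ} {α β : ℝ≥0∞} {L : ℕ} (hg : ∀ k, Measurable (g k))
    (hκ : ∀ k, (κ k).map Prod.snd = if L < k + 1 then p₂ else p₁)
    (hgi : ∀ k, ∫⁻ t, g k t = if L < k + 1 then β else α) (k : ℕ) :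
    ∫⁻ t, busy κ g k t = cost p₁ p₂ α β L k := by
  have h : ∀ n k, ∫⁻ t, busyIter κ g n k t = costIter p₁ p₂ α β L n k := by
    intro n
    induction n with
    | zero => simp [busyIter, costIter]
    | succ n ih =>
      intro k
      cases k with
      | zero => simp
      | succ k =>
        simp only [busyIter, costIter]
        rw [lintegral_add_left (hg k), hgi, lintegral_shiftMean (measurable_busyIter hg n), hκ]
        simp_rw [ih]
  unfold busy cost
  rw [lintegral_iSup (fun n => measurable_busyIter hg n k) fun m n hmn t => busyIter_mono k t hmn]
  simp_rw [h]

lemma shiftMean_step (hμ : ∀ᵐ p ∂μ, 0 ≤ p.1) (k : ℕ) (t : ℝ) :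
    shiftMean μ (fun _ t => (Set.Ici 0).indicator 1 t) k t = μ {p | 0 ≤ t ∧ p.1 ≤ t} := by
  have hm : MeasurableSet {p : ℝ × ℕ | 0 ≤ t ∧ p.1 ≤ t} := by
    simp only [Set.ofPred_and]
    exact (MeasurableSet.const _).inter (measurableSet_le measurable_fst measurable_const)
  rw [shiftMean, ← lintegral_indicator_one hm]
  refine lintegral_congr_ae ?_
  filter_upwards [hμ] with p hp
  by_cases h : p.1 ≤ t
  · rw [Set.indicator_of_mem (show p ∈ {p : ℝ × ℕ | 0 ≤ t ∧ p.1 ≤ t} from ⟨hp.trans h, h⟩),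
      Set.indicator_of_mem (show t - p.1 ∈ Set.Ici (0 : ℝ) from sub_nonneg.2 h)]
    rfl
  · rw [Set.indicator_of_notMem (s := Set.Ici (0 : ℝ)) (fun h' => h (sub_nonneg.1 h')),
      Set.indicator_of_notMem (s := {p : ℝ × ℕ | 0 ≤ t ∧ p.1 ≤ t}) (fun h' => h h'.2)]

/-- A step either lasts beyond `t` or has ended by then, so the unit step function solves the
renewal equation forced by the residual probability. It therefore dominates every `busy` with a
smaller forcing term. -/
lemma step_eq [IsProbabilityMeasure μ] (hμ : ∀ᵐ p ∂μ, 0 ≤ p.1) (k : ℕ) (t : ℝ) :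
    μ {p | 0 ≤ t ∧ t < p.1} + shiftMean μ (fun _ t => (Set.Ici 0).indicator 1 t) k t =
      (Set.Ici (0 : ℝ)).indicator 1 t := by
  rw [shiftMean_step hμ]
  by_cases ht : 0 ≤ t
  · rw [Set.indicator_of_mem (show t ∈ Set.Ici (0 : ℝ) from ht)]
    simp only [ht, true_and]
    have hm : MeasurableSet {p : ℝ × ℕ | p.1 ≤ t} := measurableSet_le measurable_fst measurable_const
    have h := prob_add_prob_compl (μ := μ) hm
    rw [add_comm] at h
    simpa [Set.compl_ofPred] using h
  · simp [ht]

lemma busy_le_step (hκ : ∀ k, ∀ᵐ p ∂(κ k), 0 ≤ p.1)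
    (hg : ∀ k t, g k t ≤ κ k {p | 0 ≤ t ∧ t < p.1}) (k : ℕ) (t : ℝ) :
    busy κ g k t ≤ (Set.Ici (0 : ℝ)).indicator 1 t := by
  refine busy_le_of_superharmonic (v := fun _ t => (Set.Ici (0 : ℝ)).indicator 1 t)
    (fun k t => ?_) k t
  rw [← step_eq (hκ k) k t]
  exact add_le_add (hg k t) le_rfl

lemma busyIter_le_one (hκ : ∀ k, ∀ᵐ p ∂(κ k), 0 ≤ p.1)
    (hg : ∀ k t, g k t ≤ κ k {p | 0 ≤ t ∧ t < p.1}) (n k : ℕ) (t : ℝ) :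
    busyIter κ g n k t ≤ 1 :=
  (busyIter_le_busy n k t).trans ((busy_le_step hκ hg k t).trans
    (Set.indicator_le_self' (fun _ _ => zero_le) t))

/-- With this forcing term `busy` is the probability that a busy period outlasts `t`. Its
monotonicity is what makes `volterra_tendsto` applicable. -/
lemma antitoneOn_busy (hκ : ∀ k, ∀ᵐ p ∂(κ k), 0 ≤ p.1)
    (hg : ∀ k t, g k t = κ k {p | 0 ≤ t ∧ t < p.1}) (k : ℕ) :
    AntitoneOn (busy κ g k) (Set.Ici 0) := by
  have hg0 : ∀ k t, t < 0 → g k t = 0 := by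
    intro k t ht
    simp [hg, not_le.2 ht]
  -- Extended by `1` to negative times, the iterates satisfy a recursion without forcing term, and
  -- averaging over shifts preserves antitonicity.
  set H : ℕ → ℕ → ℝ → ℝ≥0∞ := fun n k t => if t < 0 then 1 else busyIter κ g n k t with hH
  have hH1 : ∀ n k t, H n k t ≤ 1 := by
    intro n k t
    simp only [hH]
    split_ifs
    · exact le_rfl
    · exact busyIter_le_one hκ (fun k t => (hg k t).le) n k t
  have hanti : ∀ n k, Antitone (H n k) := by
    intro n
    induction n with
    | zero =>
      intro k s t hst
      simp only [hH, busyIter]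
      split_ifs
      · exact le_rfl
      · linarith
      · exact zero_le
      · exact le_rfl
    | succ n ih =>
      intro k
      cases k with
      | zero =>
        intro s t hst
        simp only [hH, busyIter]
        split_ifs
        · exact le_rfl
        · linarith
        · exact zero_le
        · exact le_rfl
      | succ k =>
        have hrec : ∀ t, 0 ≤ t → H (n + 1) (k + 1) t = shiftMean (κ k) (H n) k t := by
          intro t ht
          simp only [hH, busyIter, if_neg (not_lt.2 ht), hg, ht, true_and]
          have hm : MeasurableSet {p : ℝ × ℕ | t < p.1} :=
            measurableSet_lt measurable_const measurable_fst
          rw [← lintegral_indicator_one hm, shiftMean, shiftMean,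
            ← lintegral_add_left (measurable_one.indicator hm)]
          refine lintegral_congr fun p => ?_
          by_cases hp : t < p.1
          · rw [Set.indicator_of_mem (show p ∈ {p : ℝ × ℕ | t < p.1} from hp),
              if_pos (by linarith), busyIter_of_neg hκ hg0 n _ _ (by linarith)]
            simp
          · rw [Set.indicator_of_notMem (s := {p : ℝ × ℕ | t < p.1}) (fun h => hp h), if_neg (by linarith), zero_add]
        intro s t hst
        by_cases hs : s < 0
        · refine (hH1 _ _ _).trans ?_
          simp [hH, hs]
        · rw [hrec s (not_lt.1 hs), hrec t ((not_lt.1 hs).trans hst)]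
          exact lintegral_mono fun p => ih _ (by linarith)
  intro s hs t ht hst
  refine iSup_mono fun n => ?_
  have := hanti n k hst
  have hs' : ¬ s < 0 := not_lt.2 hs
  have ht' : ¬ t < 0 := not_lt.2 ht
  simpa only [hH, if_neg hs', if_neg ht'] using this

end MarkovRenewal

/-! ### Representation by the idle probability, and limits in time -/

section RenewalLimit

variable {lam : ℝ} {r : Measure ℕ} {κ : ℕ → Measure (ℝ × ℕ)} {g : ℕ → ℝ → ℝ≥0∞}

/-- The rate at which batches arrive, times the mean of the solution over the batch size. -/
def batchBusy (lam : ℝ) (r : Measure ℕ) (κ : ℕ → Measure (ℝ × ℕ)) (g : ℕ → ℝ → ℝ≥0∞) (v : ℝ) :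
    ℝ≥0∞ :=
  ENNReal.ofReal lam * ∫⁻ i, busy κ g i v ∂r

/-- Waiting times are almost surely positive. This is the discount factor that
`eq_zero_of_subsolution` requires. -/
lemma lintegral_exp_expMeasure_lt_one (hlam : 0 < lam) [IsProbabilityMeasure r] :
    ∫⁻ p, ENNReal.ofReal (Real.exp (-p.1)) ∂((expMeasure lam).prod r) < 1 := by
  have hexp := isProbabilityMeasure_expMeasure hlam
  have h0 : ∀ᵐ p ∂((expMeasure lam).prod r), 0 < p.1 :=
    Measure.quasiMeasurePreserving_fst.ae expMeasure_ae_pos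
  have hm : Measurable fun p : ℝ × ℕ => ENNReal.ofReal (Real.exp (-p.1)) := by fun_prop
  have hlt : ∀ᵐ p ∂((expMeasure lam).prod r), ENNReal.ofReal (Real.exp (-p.1)) < 1 := by
    filter_upwards [h0] with p hp
    rw [ENNReal.ofReal_lt_one, Real.exp_lt_one_iff]
    linarith
  have hfin : ∫⁻ p, ENNReal.ofReal (Real.exp (-p.1)) ∂((expMeasure lam).prod r) ≠ ⊤ :=
    ne_top_of_le_ne_top (b := ∫⁻ _, 1 ∂((expMeasure lam).prod r)) (by simp)
      (lintegral_mono_ae (hlt.mono fun _ h => h.le))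
  have := lintegral_strict_mono (μ := (expMeasure lam).prod r) (IsProbabilityMeasure.ne_zero _)
    (aemeasurable_const (b := (1 : ℝ≥0∞))) hfin hlt
  simpa using this

variable [∀ k, IsProbabilityMeasure (κ k)]

lemma measurable_batchBusy [SFinite r] (hg : ∀ k, Measurable (g k)) :
    Measurable (batchBusy lam r κ g) := by
  have h : Measurable fun q : ℝ × ℕ => busy κ g q.2 q.1 :=
    measurable_from_prod_countable_left fun i => measurable_busy hg i
  exact h.lintegral_prod_right'.const_mul _

lemma lintegral_batchBusy [SFinite r] {p₁ p₂ : Measure ℕ} {α β : ℝ≥0∞} {L : ℕ}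
    (hg : ∀ k, Measurable (g k)) (hκ : ∀ k, (κ k).map Prod.snd = if L < k + 1 then p₂ else p₁)
    (hgi : ∀ k, ∫⁻ t, g k t = if L < k + 1 then β else α) :
    ∫⁻ v, batchBusy lam r κ g v = ENNReal.ofReal lam * ∫⁻ i, cost p₁ p₂ α β L i ∂r := by
  have h : Measurable fun q : ℝ × ℕ => busy κ g q.2 q.1 :=
    measurable_from_prod_countable_left fun i => measurable_busy hg i
  unfold batchBusy
  rw [lintegral_const_mul _ h.lintegral_prod_right', lintegral_lintegral_swap h.aemeasurable]
  simp_rw [lintegral_busy hg hκ hgi]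

/-- The substitution `v = t - u` turns the exponential waiting time into a convolution, and the
factor `lam` of the density becomes the rate in `batchBusy`. -/
lemma shiftMean_exp [IsProbabilityMeasure r] (hlam : 0 < lam) {h : ℕ → ℝ → ℝ≥0∞}
    (hh : ∀ k, Measurable (h k)) (t : ℝ) :
    shiftMean ((expMeasure lam).prod r) h 0 t =
      ∫⁻ v, (if 0 ≤ t - v then ENNReal.ofReal (Real.exp (-(lam * (t - v)))) else 0) *
        (ENNReal.ofReal lam * ∫⁻ i, h i v ∂r) := by
  have hexp := isProbabilityMeasure_expMeasure hlam
  have hm : Measurable fun q : ℝ × ℕ => h q.2 q.1 :=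
    measurable_from_prod_countable_left fun i => hh i
  have hm' : Measurable fun v => ∫⁻ i, h i v ∂r := hm.lintegral_prod_right'
  have hm'' : Measurable fun u => ∫⁻ i, h i (t - u) ∂r :=
    hm'.comp (measurable_const.sub measurable_id)
  unfold shiftMean
  rw [lintegral_prod _ (measurable_shift_const hh 0 t).aemeasurable]
  simp only [zero_add]
  rw [lintegral_expMeasure hm'', ← lintegral_sub_left_eq_self _ t]
  refine lintegral_congr fun v => ?_
  simp only [sub_sub_cancel]
  split_ifs
  · rw [ENNReal.ofReal_mul hlam.le]
    ring
  · simp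

/-- The solution of the Markov renewal equation in terms of its minimal killed solution and of the
probabilities `e` that the state `0` is occupied. -/
lemma renewal_representation [IsProbabilityMeasure r] (hlam : 0 < lam) {p₁ p₂ : Measure ℕ} {L : ℕ}
    [IsProbabilityMeasure p₁] [IsProbabilityMeasure p₂]
    (hκ0 : ∀ k, ∀ᵐ p ∂(κ k), 0 ≤ p.1)
    (hκ : ∀ k, (κ k).map Prod.snd = if L < k + 1 then p₂ else p₁)
    (hfin : ∀ k, cost p₁ p₂ 1 1 L k ≠ ⊤) (hg : ∀ k, Measurable (g k))
    (hgκ : ∀ k t, g k t ≤ κ k {p | 0 ≤ t ∧ t < p.1})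
    (hw : ∫⁻ v, batchBusy lam r κ g v ≠ ⊤)
    {f e : ℕ → ℝ → ℝ≥0∞} (hf : ∀ k, Measurable (f k)) (he : ∀ k, Measurable (e k))
    (hf1 : ∀ k t, f k t ≤ 1) (he1 : ∀ k t, e k t ≤ 1)
    (hf0 : ∀ k t, t < 0 → f k t = 0) (he0 : ∀ k t, t < 0 → e k t = 0)
    (hfs : ∀ k t, f (k + 1) t = g k t + shiftMean (κ k) f k t)
    (hfz : ∀ t, f 0 t = shiftMean ((expMeasure lam).prod r) f 0 t)
    (hes : ∀ k t, e (k + 1) t = shiftMean (κ k) e k t)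
    (hez : ∀ t, e 0 t = (if 0 ≤ t then ENNReal.ofReal (Real.exp (-(lam * t))) else 0) +
      shiftMean ((expMeasure lam).prod r) e 0 t) (t : ℝ) :
    f 0 t = ∫⁻ v, e 0 (t - v) * batchBusy lam r κ g v := by
  have hexp := isProbabilityMeasure_expMeasure hlam
  set η := (expMeasure lam).prod r with hη
  set w := batchBusy lam r κ g with hwdef
  set h := busy κ g with hh
  have hg0 : ∀ k t, t < 0 → g k t = 0 := by
    intro k t ht
    simpa [not_le.2 ht] using hgκ k t
  have hhm : ∀ k, Measurable (h k) := fun k => measurable_busy hg k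
  have hwm : Measurable w := measurable_batchBusy hg
  have hh0 : ∀ k t, t < 0 → h k t = 0 := busy_of_neg hκ0 hg0
  have hh1 : ∀ k t, h k t ≤ 1 := fun k t => (busy_le_step hκ0 hgκ k t).trans
    (Set.indicator_le_self' (fun _ _ => zero_le) t)
  have hw0 : ∀ v, v < 0 → w v = 0 := by
    intro v hv
    simp [hwdef, batchBusy, ← hh, hh0 _ v hv]
  have hjm : ∀ k, Measurable fun q : ℝ × ℝ => e k (q.1 - q.2) * w q.2 := fun k =>
    ((he k).comp (measurable_fst.sub measurable_snd)).mul (hwm.comp measurable_snd)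
  set c : ℕ → ℝ → ℝ≥0∞ := fun k t => ∫⁻ v, e k (t - v) * w v with hc
  have hcm : ∀ k, Measurable (c k) := fun k => (hjm k).lintegral_prod_right'
  -- The candidate solution: either the initial busy period still runs at `t`, or the one running at
  -- `t` was started at some `t - v` by a batch that met an empty system.
  set Φ : ℕ → ℝ → ℝ≥0∞ := fun k t => h k t + c k t with hΦ
  have hΦm : ∀ k, Measurable (Φ k) := fun k => (hhm k).add (hcm k)
  have hΦshift : ∀ (μ : Measure (ℝ × ℕ)) [SFinite μ] (k : ℕ) (t : ℝ), shiftMean μ Φ k t =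
      shiftMean μ h k t + ∫⁻ v, shiftMean μ e k (t - v) * w v := by
    intro μ _ k t
    rw [← shiftMean_convolution he hwm]
    exact shiftMean_add hhm k t
  have hΦs : ∀ k t, Φ (k + 1) t = g k t + shiftMean (κ k) Φ k t := by
    intro k t
    rw [hΦshift, ← add_assoc, ← busy_succ hg]
    simp only [hΦ, hc, hes]
    rfl
  have hΦz : ∀ t, Φ 0 t = shiftMean η Φ 0 t := by
    intro t
    rw [hΦshift, hη, shiftMean_exp hlam hhm, ← hη]
    have h1 : Φ 0 t = ∫⁻ v, e 0 (t - v) * w v := by simp [hΦ, hc, hh]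
    rw [h1, ← lintegral_add_left]
    · refine lintegral_congr fun v => ?_
      rw [hez (t - v), add_mul]
      rfl
    · refine Measurable.mul (Measurable.ite ?_ (by fun_prop) measurable_const) hwm
      exact measurableSet_le measurable_const (measurable_const.sub measurable_id)
  have hcC : ∀ k t, c k t ≤ ∫⁻ v, w v := fun k t =>
    lintegral_mono fun v => (mul_le_mul' (he1 k _) le_rfl).trans (one_mul _).le
  have hc0 : ∀ k t, t < 0 → c k t = 0 := by
    intro k t ht
    simp only [hc]
    rw [lintegral_congr (g := fun _ => 0), lintegral_zero]
    intro v
    rcases lt_or_ge v 0 with hv | hv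
    · rw [hw0 v hv, mul_zero]
    · rw [he0 k _ (by linarith), zero_mul]
  have hC : 1 + ∫⁻ v, w v ≠ ⊤ := ENNReal.add_ne_top.2 ⟨ENNReal.one_ne_top, hw⟩
  have hstep : ∀ {a b x : ℝ≥0∞}, (x + a) - (x + b) ≤ a - b := by
    intro a b x
    rw [tsub_le_iff_left, add_assoc]
    exact add_le_add le_rfl (le_add_tsub)
  -- Uniqueness: the truncated differences in both directions are bounded subsolutions, hence zero.
  have hle1 : f 0 t - Φ 0 t = 0 := by
    refine eq_zero_of_subsolution (u := fun k t => f k t - Φ k t) hκ0 hκ hfin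
      (lintegral_exp_expMeasure_lt_one (r := r) hlam) ENNReal.one_ne_top
      (fun k t => tsub_le_self.trans (hf1 k t)) (fun k t ht => by simp [hf0 k t ht])
      (fun k t => ?_) (fun t => ?_) 0 t
    · rw [hfs, hΦs]
      exact hstep.trans (shiftMean_tsub_le hΦm k t)
    · rw [hfz, hΦz]
      exact shiftMean_tsub_le hΦm 0 t
  have hle2 : Φ 0 t - f 0 t = 0 := by
    refine eq_zero_of_subsolution (u := fun k t => Φ k t - f k t) hκ0 hκ hfin
      (lintegral_exp_expMeasure_lt_one (r := r) hlam) hC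
      (fun k t => tsub_le_self.trans (add_le_add (hh1 k t) (hcC k t)))
      (fun k t ht => by simp [hΦ, hh0 k t ht, hc0 k t ht])
      (fun k t => ?_) (fun t => ?_) 0 t
    · rw [hfs, hΦs]
      exact hstep.trans (shiftMean_tsub_le hf k t)
    · rw [hfz, hΦz]
      exact shiftMean_tsub_le hf 0 t
  have h1 : f 0 t = Φ 0 t :=
    le_antisymm (tsub_eq_zero_iff_le.1 hle1) (tsub_eq_zero_iff_le.1 hle2)
  rw [h1]
  simp [hΦ, hc, hh]

/-- A convolution with an integrable kernel has the limit that it should have. -/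
lemma tendsto_convolution_toReal {e w : ℝ → ℝ≥0∞} {ℓ : ℝ} (he : Measurable e) (he1 : ∀ t, e t ≤ 1)
    (hw : Measurable w) (hwi : ∫⁻ v, w v ≠ ⊤)
    (hlim : Tendsto (fun t => (e t).toReal) atTop (𝓝 ℓ)) :
    Tendsto (fun t => (∫⁻ v, e (t - v) * w v).toReal) atTop (𝓝 (ℓ * (∫⁻ v, w v).toReal)) := by
  have hwae : ∀ᵐ v, w v < ⊤ := ae_lt_top hw hwi
  have hk : Integrable fun v => (w v).toReal := integrable_toReal_of_lintegral_ne_top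
    hw.aemeasurable hwi
  have h1 : ∀ t, (∫⁻ v, e (t - v) * w v).toReal = ∫ v, (e (t - v)).toReal * (w v).toReal := by
    intro t
    rw [← integral_toReal]
    · simp_rw [ENNReal.toReal_mul]
    · exact ((he.comp (measurable_const.sub measurable_id)).mul hw).aemeasurable
    · filter_upwards [hwae] with v hv
      exact ENNReal.mul_lt_top ((he1 _).trans_lt ENNReal.one_lt_top) hv
  simp_rw [h1]
  rw [← integral_toReal hw.aemeasurable hwae, ← integral_const_mul]
  refine tendsto_integral_filter_of_dominated_convergence (fun v => (w v).toReal) ?_ ?_ hk ?_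
  · exact Eventually.of_forall fun t => ((he.comp (measurable_const.sub
      measurable_id)).ennreal_toReal.mul hw.ennreal_toReal).aestronglyMeasurable
  · refine Eventually.of_forall fun t => Eventually.of_forall fun v => ?_
    rw [Real.norm_of_nonneg (by positivity)]
    refine mul_le_of_le_one_left ENNReal.toReal_nonneg ?_
    exact ENNReal.toReal_le_of_le_ofReal zero_le_one (by simpa using he1 _)
  · refine Eventually.of_forall fun v => ?_
    exact (hlim.comp (tendsto_atTop_add_const_right atTop (-v) tendsto_id)).mul_const _

/-- The key renewal theorem for an equation with a decreasing kernel. -/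
lemma tendsto_of_renewal_equation {e w : ℝ → ℝ≥0∞} (he : Measurable e) (he1 : ∀ t, e t ≤ 1)
    (hw : Measurable w) (hwi : ∫⁻ v, w v ≠ ⊤) (hwtop : ∀ v, w v ≠ ⊤) (hw0 : ∀ v < 0, w v = 0)
    (hanti : AntitoneOn w (Set.Ici 0))
    (heq : ∀ t, 0 ≤ t → e t + ∫⁻ v, e (t - v) * w v = 1) :
    Tendsto (fun t => (e t).toReal) atTop (𝓝 (1 / (1 + (∫⁻ v, w v).toReal))) := by
  have hwae : ∀ᵐ v, w v < ⊤ := ae_lt_top hw hwi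
  rw [← integral_toReal hw.aemeasurable hwae]
  have hetop : ∀ t, e t ≠ ⊤ := fun t => ((he1 t).trans_lt ENNReal.one_lt_top).ne
  refine volterra_tendsto he.ennreal_toReal ?_ (fun v => ENNReal.toReal_nonneg)
    (fun v hv => by rw [hw0 v hv]; rfl) ?_
    (integrable_toReal_of_lintegral_ne_top hw.aemeasurable hwi) ?_
  · intro t
    rw [abs_of_nonneg ENNReal.toReal_nonneg]
    exact ENNReal.toReal_le_of_le_ofReal zero_le_one (by simpa using he1 t)
  · intro s hs t ht hst
    exact ENNReal.toReal_mono (hwtop s) (hanti hs ht hst)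
  · intro t ht
    have h1 := heq t ht
    have h2 : ∫⁻ v, e (t - v) * w v ≠ ⊤ :=
      ne_top_of_le_ne_top ENNReal.one_ne_top (h1 ▸ le_add_self)
    have h3 : (∫⁻ v, e (t - v) * w v).toReal = ∫ v, (w v).toReal * (e (t - v)).toReal := by
      rw [← integral_toReal]
      · simp_rw [ENNReal.toReal_mul, mul_comm]
      · exact ((he.comp (measurable_const.sub measurable_id)).mul hw).aemeasurable
      · filter_upwards [hwae] with v hv
        exact ENNReal.mul_lt_top (hetop _).lt_top hv
    rw [← h3, ← ENNReal.toReal_add (hetop t) h2, h1, ENNReal.toReal_one]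

end RenewalLimit

/-! ### The limiting probabilities of the queue -/

section QueueLimit

/-- The step law of the Markov renewal process of the queue from the state `k + 1`. -/
def queueStep (lam : ℝ) (r : PMF ℕ) (B₁ B₂ : Measure ℝ) (L k : ℕ) : Measure (ℝ × ℕ) :=
  serviceLaw lam r.toMeasure (if L < k + 1 then B₂ else B₁)

/-- The probability that the first service is in progress at time `t` if it starts at time `0` with
`k + 1` customers; only services of type 2 count unless `P` holds. -/
def queueForcing (P : Prop) (B₁ B₂ : Measure ℝ) (L k : ℕ) (t : ℝ) : ℝ≥0∞ :=
  (if L < k + 1 then B₂ else B₁) {x | 0 ≤ t ∧ t < x ∧ (P ∨ L < k + 1)}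

/-- The probability that the queue is empty at time `t` if it starts with `k` customers. -/
def idleProb (lam : ℝ) (r : PMF ℕ) (B₁ B₂ : Measure ℝ) (L k : ℕ) (t : ℝ) : ℝ≥0∞ :=
  (Set.Ici (0 : ℝ)).indicator 1 t - servProb True lam r B₁ B₂ L k 0 t

variable {P : Prop} {lam : ℝ} {r : PMF ℕ} {B₁ B₂ : Measure ℝ} [IsProbabilityMeasure B₁]
  [IsProbabilityMeasure B₂] {L : ℕ}

lemma isProbabilityMeasure_queueStep (hlam : 0 < lam) (hB₁ : ∀ᵐ x ∂B₁, 0 ≤ x)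
    (hB₂ : ∀ᵐ x ∂B₂, 0 ≤ x) (k : ℕ) : IsProbabilityMeasure (queueStep lam r B₁ B₂ L k) := by
  unfold queueStep
  split_ifs
  exacts [isProbabilityMeasure_serviceLaw hlam hB₂, isProbabilityMeasure_serviceLaw hlam hB₁]

lemma queueStep_ae_nonneg (hlam : 0 < lam) (hB₁ : ∀ᵐ x ∂B₁, 0 ≤ x)
    (hB₂ : ∀ᵐ x ∂B₂, 0 ≤ x) (k : ℕ) : ∀ᵐ p ∂(queueStep lam r B₁ B₂ L k), 0 ≤ p.1 := by
  unfold queueStep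
  split_ifs
  exacts [serviceLaw_ae_nonneg hlam hB₂, serviceLaw_ae_nonneg hlam hB₁]

omit [IsProbabilityMeasure B₁] [IsProbabilityMeasure B₂] in
lemma map_snd_queueStep (k : ℕ) : (queueStep lam r B₁ B₂ L k).map Prod.snd =
    if L < k + 1 then inputLaw lam r.toMeasure B₂ else inputLaw lam r.toMeasure B₁ := by
  unfold queueStep
  split_ifs <;> rfl

omit [IsProbabilityMeasure B₁] [IsProbabilityMeasure B₂] in
lemma measurableSet_residual (Q : Prop) :
    MeasurableSet {p : ℝ × ℝ | 0 ≤ p.1 ∧ p.1 < p.2 ∧ Q} := by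
  simp only [Set.ofPred_and]
  exact (measurableSet_le measurable_const measurable_fst).inter
    ((measurableSet_lt measurable_fst measurable_snd).inter (MeasurableSet.const _))

lemma measurable_queueForcing (k : ℕ) : Measurable (queueForcing P B₁ B₂ L k) := by
  have : IsProbabilityMeasure (if L < k + 1 then B₂ else B₁) := by split_ifs <;> infer_instance
  exact measurable_measure_prodMk_left (measurableSet_residual _)

/-- Exchange of integrals: the times `t` with `0 ≤ t < x` form an interval of length `x`. -/
lemma lintegral_measure_residual {B : Measure ℝ} [SFinite B] :
    ∫⁻ t, B {x | 0 ≤ t ∧ t < x} = ∫⁻ x, ENNReal.ofReal x ∂B := by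
  have hs := measurableSet_residual True
  simp only [and_true] at hs
  have h1 := Measure.prod_apply (μ := (volume : Measure ℝ)) (ν := B) hs
  have h2 := Measure.prod_apply_symm (μ := (volume : Measure ℝ)) (ν := B) hs
  refine (h1.symm.trans h2).trans (lintegral_congr fun x => ?_)
  have h3 : (fun t : ℝ => (t, x)) ⁻¹' {p : ℝ × ℝ | 0 ≤ p.1 ∧ p.1 < p.2} = Set.Ico 0 x := rfl
  rw [h3, Real.volume_Ico, sub_zero]

open Classical in
lemma lintegral_queueForcing (k : ℕ) : ∫⁻ t, queueForcing P B₁ B₂ L k t =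
    if L < k + 1 then ∫⁻ x, ENNReal.ofReal x ∂B₂
    else if P then ∫⁻ x, ENNReal.ofReal x ∂B₁ else 0 := by
  unfold queueForcing
  by_cases hL : L < k + 1
  · simp only [hL, if_true, or_true, and_true, lintegral_measure_residual]
  · by_cases hP : P
    · simp only [hL, hP, if_true, if_false, true_or, and_true, lintegral_measure_residual]
    · simp [hL, hP]

lemma queueForcing_true (hlam : 0 < lam) (hB₁ : ∀ᵐ x ∂B₁, 0 ≤ x) (hB₂ : ∀ᵐ x ∂B₂, 0 ≤ x) (k : ℕ)
    (t : ℝ) : queueForcing True B₁ B₂ L k t = queueStep lam r B₁ B₂ L k {p | 0 ≤ t ∧ t < p.1} := by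
  have hB : ∀ᵐ x ∂(if L < k + 1 then B₂ else B₁), 0 ≤ x := by split_ifs <;> assumption
  have : IsProbabilityMeasure (if L < k + 1 then B₂ else B₁) := by split_ifs <;> infer_instance
  have hs : MeasurableSet {x : ℝ | 0 ≤ t ∧ t < x} := by
    simp only [Set.ofPred_and]
    exact (MeasurableSet.const _).inter measurableSet_Ioi
  have h := lintegral_serviceLaw_fst (r := r.toMeasure) hlam hB
    (F := {x : ℝ | 0 ≤ t ∧ t < x}.indicator 1) (measurable_one.indicator hs)
  rw [lintegral_indicator_one hs] at h
  simp only [queueForcing, true_or, and_true, queueStep]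
  have hs' : MeasurableSet {p : ℝ × ℕ | 0 ≤ t ∧ t < p.1} := hs.preimage measurable_fst
  rw [← h, ← lintegral_indicator_one hs']
  rfl

omit [IsProbabilityMeasure B₁] [IsProbabilityMeasure B₂] in
lemma queueForcing_le_true (k : ℕ) (t : ℝ) :
    queueForcing P B₁ B₂ L k t ≤ queueForcing True B₁ B₂ L k t :=
  measure_mono fun _ hx => ⟨hx.1, hx.2.1, Or.inl trivial⟩

lemma measurable_servProb_zero (hlam : 0 < lam) (k : ℕ) :
    Measurable (servProb P lam r B₁ B₂ L k 0) :=
  (measurable_servProb (P := P) (r := r) (B₁ := B₁) (B₂ := B₂) (L := L) (k := k) hlam).comp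
    (measurable_const.prodMk measurable_id)

lemma servProb_le_indicator (hlam : 0 < lam) (hB₁ : ∀ᵐ x ∂B₁, 0 ≤ x) (hB₂ : ∀ᵐ x ∂B₂, 0 ≤ x)
    (k : ℕ) (t : ℝ) : servProb P lam r B₁ B₂ L k 0 t ≤ (Set.Ici (0 : ℝ)).indicator 1 t := by
  by_cases ht : 0 ≤ t
  · rw [Set.indicator_of_mem (show t ∈ Set.Ici (0 : ℝ) from ht)]
    exact servProb_le_one hlam
  · rw [servProb_of_lt hB₁ hB₂ (not_le.1 ht)]
    exact zero_le

lemma measurable_idleProb (hlam : 0 < lam) (k : ℕ) : Measurable (idleProb lam r B₁ B₂ L k) :=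
  (measurable_one.indicator measurableSet_Ici).sub (measurable_servProb_zero hlam k)

omit [IsProbabilityMeasure B₁] [IsProbabilityMeasure B₂] in
lemma idleProb_le_one (k : ℕ) (t : ℝ) : idleProb lam r B₁ B₂ L k t ≤ 1 :=
  tsub_le_self.trans (Set.indicator_le_self' (fun _ _ => zero_le) t)

omit [IsProbabilityMeasure B₁] [IsProbabilityMeasure B₂] in
lemma idleProb_of_neg (k : ℕ) (t : ℝ) (ht : t < 0) : idleProb lam r B₁ B₂ L k t = 0 := by
  rw [idleProb, Set.indicator_of_notMem (s := Set.Ici (0 : ℝ)) (not_le.2 ht)]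
  simp

lemma idleProb_add (hlam : 0 < lam) (hB₁ : ∀ᵐ x ∂B₁, 0 ≤ x) (hB₂ : ∀ᵐ x ∂B₂, 0 ≤ x)
    (k : ℕ) (t : ℝ) : idleProb lam r B₁ B₂ L k t + servProb True lam r B₁ B₂ L k 0 t =
      (Set.Ici (0 : ℝ)).indicator 1 t :=
  tsub_add_cancel_of_le (servProb_le_indicator hlam hB₁ hB₂ k t)

lemma shiftMean_idleProb {μ : Measure (ℝ × ℕ)} (hlam : 0 < lam) (hB₁ : ∀ᵐ x ∂B₁, 0 ≤ x)
    (hB₂ : ∀ᵐ x ∂B₂, 0 ≤ x) (k : ℕ) (t : ℝ) :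
    shiftMean μ (idleProb lam r B₁ B₂ L) k t +
      shiftMean μ (fun k t => servProb True lam r B₁ B₂ L k 0 t) k t =
        shiftMean μ (fun _ t => (Set.Ici (0 : ℝ)).indicator 1 t) k t := by
  rw [← shiftMean_add (measurable_idleProb hlam)]
  simp_rw [idleProb_add hlam hB₁ hB₂]

/-- The equation of `servProb` is subtracted from that of the unit step function, whose forcing
terms agree by `queueForcing_true`; finiteness permits the cancellation. -/
lemma idleProb_succ (hlam : 0 < lam) (hr : r 0 = 0) (hB₁ : ∀ᵐ x ∂B₁, 0 ≤ x)
    (hB₂ : ∀ᵐ x ∂B₂, 0 ≤ x) (k : ℕ) (t : ℝ) : idleProb lam r B₁ B₂ L (k + 1) t =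
      shiftMean (queueStep lam r B₁ B₂ L k) (idleProb lam r B₁ B₂ L) k t := by
  have := isProbabilityMeasure_queueStep (r := r) (L := L) hlam hB₁ hB₂ k
  have h1 := idleProb_add (r := r) (L := L) hlam hB₁ hB₂ (k + 1) t
  have h2 : servProb True lam r B₁ B₂ L (k + 1) 0 t = queueForcing True B₁ B₂ L k t +
      shiftMean (queueStep lam r B₁ B₂ L k) (fun k t => servProb True lam r B₁ B₂ L k 0 t) k t :=
    servProb_succ hlam hr hB₁ hB₂ k t
  rw [← step_eq (queueStep_ae_nonneg (r := r) (L := L) hlam hB₁ hB₂ k) k t,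
    ← queueForcing_true hlam hB₁ hB₂, ← shiftMean_idleProb (r := r) (L := L) hlam hB₁ hB₂,
    add_left_comm, ← h2] at h1
  exact (ENNReal.add_left_inj
    ((servProb_le_one hlam).trans_lt ENNReal.one_lt_top).ne).1 h1

lemma idleProb_zero (hlam : 0 < lam) (hr : r 0 = 0) (hB₁ : ∀ᵐ x ∂B₁, 0 ≤ x)
    (hB₂ : ∀ᵐ x ∂B₂, 0 ≤ x) (t : ℝ) : idleProb lam r B₁ B₂ L 0 t =
      (if 0 ≤ t then ENNReal.ofReal (Real.exp (-(lam * t))) else 0) +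
        shiftMean ((expMeasure lam).prod r.toMeasure) (idleProb lam r B₁ B₂ L) 0 t := by
  have hexp := isProbabilityMeasure_expMeasure hlam
  have h0 : ∀ᵐ p ∂((expMeasure lam).prod r.toMeasure), 0 ≤ p.1 :=
    (ae_batch hlam hr).mono fun p hp => hp.1.le
  have h1 := idleProb_add (r := r) (L := L) hlam hB₁ hB₂ 0 t
  have h2 : servProb True lam r B₁ B₂ L 0 0 t = shiftMean ((expMeasure lam).prod r.toMeasure)
      (fun k t => servProb True lam r B₁ B₂ L k 0 t) 0 t := by
    rw [servProb_empty hlam hr]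
    simp [shiftMean]
  have h3 : ((expMeasure lam).prod r.toMeasure) {p | 0 ≤ t ∧ t < p.1} =
      if 0 ≤ t then ENNReal.ofReal (Real.exp (-(lam * t))) else 0 := by
    split_ifs with ht
    · have h4 : {p : ℝ × ℕ | 0 ≤ t ∧ t < p.1} = Set.Ioi t ×ˢ Set.univ := by
        ext p
        simp [ht]
      rw [h4, Measure.prod_prod, measure_univ, mul_one]
      have h5 := lintegral_expMeasure_memoryless (lam := lam) (F := fun _ => 1) measurable_const ht
      rw [lintegral_const, measure_univ, mul_one, mul_one] at h5
      rw [← h5, ← lintegral_indicator_one measurableSet_Ioi]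
      refine lintegral_congr fun u => ?_
      by_cases hu : u ≤ t
      · simp [hu]
      · simp [hu, not_le.1 hu]
    · simp [ht]
  rw [← step_eq h0 0 t, ← shiftMean_idleProb (r := r) (L := L) hlam hB₁ hB₂, add_left_comm,
    ← add_assoc, ← h2, h3] at h1
  rw [(ENNReal.add_left_inj ((servProb_le_one hlam).trans_lt ENNReal.one_lt_top).ne).1 h1,
    add_comm]

lemma initArr_zero (α : ℕ → ℝ) : initArr 0 α = α := by
  ext n
  simp [initArr]

section Limits

variable (hlam : 0 < lam) (hr : r 0 = 0) (hB₁ : ∀ᵐ x ∂B₁, 0 ≤ x) (hB₂ : ∀ᵐ x ∂B₂, 0 ≤ x)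
  (hE : ∫⁻ j, (j : ℝ≥0∞) ∂r.toMeasure ≠ ⊤) (hb₁ : ∫⁻ x, ENNReal.ofReal x ∂B₁ ≠ ⊤)
  (hb₂ : ∫⁻ x, ENNReal.ofReal x ∂B₂ ≠ ⊤)
  (hm₁ : ∫⁻ j, (j : ℝ≥0∞) ∂(inputLaw lam r.toMeasure B₁) ≠ ⊤)
  (hm₂ : ∫⁻ j, (j : ℝ≥0∞) ∂(inputLaw lam r.toMeasure B₂) < 1)

include hlam hB₁ hB₂ hE hb₁ hb₂ hm₁ hm₂

open Classical in
lemma lintegral_batchBusy_queue : ∫⁻ v, batchBusy lam r.toMeasure (queueStep lam r B₁ B₂ L)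
      (queueForcing P B₁ B₂ L) v = ENNReal.ofReal lam *
        ∫⁻ i, cost (inputLaw lam r.toMeasure B₁) (inputLaw lam r.toMeasure B₂)
          (if P then ∫⁻ x, ENNReal.ofReal x ∂B₁ else 0) (∫⁻ x, ENNReal.ofReal x ∂B₂) L i
            ∂r.toMeasure ∧
    ∫⁻ v, batchBusy lam r.toMeasure (queueStep lam r B₁ B₂ L)
      (queueForcing P B₁ B₂ L) v ≠ ⊤ := by
  have hκ := isProbabilityMeasure_queueStep (r := r) (L := L) hlam hB₁ hB₂
  have := isProbabilityMeasure_inputLaw (r := r.toMeasure) hlam hB₁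
  have := isProbabilityMeasure_inputLaw (r := r.toMeasure) hlam hB₂
  have h : ∫⁻ v, batchBusy lam r.toMeasure (queueStep lam r B₁ B₂ L)
      (queueForcing P B₁ B₂ L) v = ENNReal.ofReal lam *
        ∫⁻ i, cost (inputLaw lam r.toMeasure B₁) (inputLaw lam r.toMeasure B₂)
          (if P then ∫⁻ x, ENNReal.ofReal x ∂B₁ else 0) (∫⁻ x, ENNReal.ofReal x ∂B₂) L i
            ∂r.toMeasure :=
    lintegral_batchBusy measurable_queueForcing map_snd_queueStep lintegral_queueForcing
  refine ⟨h, h ▸ ENNReal.mul_ne_top ENNReal.ofReal_ne_top ?_⟩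
  refine lintegral_cost_ne_top inputLaw_zero_ne_zero hm₁ hm₂ hE ?_ hb₂ L
  split_ifs
  exacts [hb₁, ENNReal.zero_ne_top]

include hr

/-- Busy periods start at rate `lam` while the system is empty, and the one running at `t` started
at some `t - v`. -/
lemma servProb_eq_convolution (t : ℝ) : servProb P lam r B₁ B₂ L 0 0 t =
    ∫⁻ v, idleProb lam r B₁ B₂ L 0 (t - v) * batchBusy lam r.toMeasure (queueStep lam r B₁ B₂ L)
      (queueForcing P B₁ B₂ L) v := by
  have hκ := isProbabilityMeasure_queueStep (r := r) (L := L) hlam hB₁ hB₂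
  have := isProbabilityMeasure_inputLaw (r := r.toMeasure) hlam hB₁
  have := isProbabilityMeasure_inputLaw (r := r.toMeasure) hlam hB₂
  refine renewal_representation hlam (queueStep_ae_nonneg hlam hB₁ hB₂) map_snd_queueStep
    (fun k => cost_ne_top inputLaw_zero_ne_zero hm₁ hm₂ ENNReal.one_ne_top ENNReal.one_ne_top L k)
    measurable_queueForcing
    (fun k t => (queueForcing_le_true k t).trans (queueForcing_true hlam hB₁ hB₂ k t).le)
    (lintegral_batchBusy_queue hlam hB₁ hB₂ hE hb₁ hb₂ hm₁ hm₂).2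
    (f := fun k t => servProb P lam r B₁ B₂ L k 0 t)
    (measurable_servProb_zero hlam) (measurable_idleProb hlam)
    (fun k t => servProb_le_one hlam) idleProb_le_one (fun k t ht => servProb_of_lt hB₁ hB₂ ht)
    idleProb_of_neg (fun k t => servProb_succ hlam hr hB₁ hB₂ k t) (fun t => ?_)
    (idleProb_succ hlam hr hB₁ hB₂) (idleProb_zero hlam hr hB₁ hB₂) t
  rw [servProb_empty hlam hr]
  simp [shiftMean]

/-- For `t ≥ 0` the server is either idle or busy, so the idle probability solves a convolution
equation with kernel `batchBusy`. The kernel is nonincreasing, and its integral is `lam` times the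
mean length of a busy period. -/
lemma tendsto_idleProb : Tendsto (fun t => (idleProb lam r B₁ B₂ L 0 t).toReal) atTop
    (𝓝 (1 / (1 + (ENNReal.ofReal lam *
        ∫⁻ i, cost (inputLaw lam r.toMeasure B₁) (inputLaw lam r.toMeasure B₂)
          (∫⁻ x, ENNReal.ofReal x ∂B₁) (∫⁻ x, ENNReal.ofReal x ∂B₂) L i
            ∂r.toMeasure).toReal))) := by
  have hκ := isProbabilityMeasure_queueStep (r := r) (L := L) hlam hB₁ hB₂
  have hκ0 := queueStep_ae_nonneg (r := r) (L := L) hlam hB₁ hB₂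
  have hg := queueForcing_true (r := r) (L := L) hlam hB₁ hB₂
  have hinteg := lintegral_batchBusy_queue (P := True) (L := L) hlam hB₁ hB₂ hE hb₁ hb₂ hm₁ hm₂
  simp only [if_true] at hinteg
  rw [← hinteg.1]
  refine tendsto_of_renewal_equation (measurable_idleProb hlam 0) (idleProb_le_one 0)
    (measurable_batchBusy measurable_queueForcing) hinteg.2 ?_ ?_ ?_ ?_
  · intro v
    refine ENNReal.mul_ne_top ENNReal.ofReal_ne_top (ne_top_of_le_ne_top (b := 1)
      ENNReal.one_ne_top ?_)
    refine (lintegral_mono (g := fun _ => 1) fun i => ?_).trans (by simp)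
    exact (busy_le_step hκ0 (fun k t => (hg k t).le) i v).trans
      (Set.indicator_le_self' (fun _ _ => zero_le) v)
  · intro v hv
    have h0 : ∀ k, ∀ t < 0, queueForcing True B₁ B₂ L k t = 0 := by
      intro k t ht
      simp [queueForcing, not_le.2 ht]
    simp [batchBusy, busy_of_neg hκ0 h0 _ v hv]
  · intro s hs t ht hst
    exact mul_le_mul' le_rfl (lintegral_mono fun i => antitoneOn_busy hκ0 hg i hs ht hst)
  · intro t ht
    rw [← servProb_eq_convolution hlam hr hB₁ hB₂ hE hb₁ hb₂ hm₁ hm₂,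
      idleProb_add hlam hB₁ hB₂]
    exact Set.indicator_of_mem (show t ∈ Set.Ici (0 : ℝ) from ht) _

theorem tendsto_probEmpty : Tendsto (probEmpty lam r B₁ B₂ L) atTop
    (𝓝 (1 / (1 + (ENNReal.ofReal lam *
        ∫⁻ i, cost (inputLaw lam r.toMeasure B₁) (inputLaw lam r.toMeasure B₂)
          (∫⁻ x, ENNReal.ofReal x ∂B₁) (∫⁻ x, ENNReal.ofReal x ∂B₂) L i
            ∂r.toMeasure).toReal))) := by
  refine (tendsto_idleProb hlam hr hB₁ hB₂ hE hb₁ hb₂ hm₁ hm₂).congr' ?_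
  filter_upwards [eventually_ge_atTop 0] with t ht
  have := isProbabilityMeasure_law (r := r) (B₁ := B₁) (B₂ := B₂) hlam
  have hexp := isProbabilityMeasure_expMeasure hlam
  have hms : MeasurableSet {ω : Sample | Serving True L (initArr 0 (arr ω.1)) ω.2 0 t} :=
    measurableSet_serving_sample measurable_fst measurable_snd measurable_const
      measurable_const True L 0
  have hae : ∀ᵐ ω ∂(law lam r B₁ B₂), ∀ n, 0 < (ω.1 n).1 ∧ 1 ≤ (ω.1 n).2 :=
    Measure.quasiMeasurePreserving_fst.ae (ae_batches hlam hr)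
  rw [probEmpty, Measure.real, idleProb, servProb,
    Set.indicator_of_mem (show t ∈ Set.Ici (0 : ℝ) from ht), Pi.one_apply, ← prob_compl_eq_one_sub hms]
  congr 1
  refine measure_congr ?_
  filter_upwards [hae] with ω hω
  refine propext (Iff.symm ?_)
  change level L ω t = 0 ↔ ¬ Serving True L (initArr 0 (arr ω.1)) ω.2 0 t
  rw [initArr_zero, level_eq_zero_iff (arrival_eq_arr ω ▸ arr_mono hω) ht, arrival_eq_arr]

/-- Only the forcing term of the convolution changes: services of type 1 no longer count, so low
steps cost `0`. -/
theorem tendsto_probType2 : Tendsto (probType2 lam r B₁ B₂ L) atTop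
    (𝓝 (1 / (1 + (ENNReal.ofReal lam *
        ∫⁻ i, cost (inputLaw lam r.toMeasure B₁) (inputLaw lam r.toMeasure B₂)
          (∫⁻ x, ENNReal.ofReal x ∂B₁) (∫⁻ x, ENNReal.ofReal x ∂B₂) L i
            ∂r.toMeasure).toReal) * (ENNReal.ofReal lam *
        ∫⁻ i, cost (inputLaw lam r.toMeasure B₁) (inputLaw lam r.toMeasure B₂)
          0 (∫⁻ x, ENNReal.ofReal x ∂B₂) L i ∂r.toMeasure).toReal)) := by
  have hκ := isProbabilityMeasure_queueStep (r := r) (L := L) hlam hB₁ hB₂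
  have hinteg := lintegral_batchBusy_queue (P := False) (L := L) hlam hB₁ hB₂ hE hb₁ hb₂ hm₁ hm₂
  simp only [if_false] at hinteg
  rw [← hinteg.1]
  refine (tendsto_convolution_toReal (measurable_idleProb hlam 0) (idleProb_le_one 0)
    (measurable_batchBusy measurable_queueForcing) hinteg.2
    (tendsto_idleProb hlam hr hB₁ hB₂ hE hb₁ hb₂ hm₁ hm₂)).congr fun t => ?_
  rw [← servProb_eq_convolution hlam hr hB₁ hB₂ hE hb₁ hb₂ hm₁ hm₂, probType2, Measure.real,
    servProb]
  simp only [servesType2_iff, initArr_zero, arrival_eq_arr]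

end Limits

end QueueLimit

/-! ### Moments and transforms of the parameters -/

section Parameters

variable {lam : ℝ} {r : PMF ℕ} {B B₁ B₂ : Measure ℝ}

lemma toMeasure_real_singleton (r : PMF ℕ) (i : ℕ) : r.toMeasure.real {i} = (r i).toReal := by
  rw [Measure.real, r.toMeasure_apply_singleton i (MeasurableSet.singleton i)]

lemma lintegral_ofReal_pmf {a : ℕ → ℝ} (ha : ∀ i, 0 ≤ a i)
    (hs : Summable fun i => (r i).toReal * a i) :
    ∫⁻ i, ENNReal.ofReal (a i) ∂r.toMeasure = ENNReal.ofReal (∑' i, (r i).toReal * a i) := by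
  rw [lintegral_countable',
    ENNReal.ofReal_tsum_of_nonneg (fun i => mul_nonneg ENNReal.toReal_nonneg (ha i)) hs]
  refine tsum_congr fun i => ?_
  rw [r.toMeasure_apply_singleton i (MeasurableSet.singleton i),
    ENNReal.ofReal_mul ENNReal.toReal_nonneg, ENNReal.ofReal_toReal (r.apply_ne_top i), mul_comm]

lemma lintegral_natCast_pmf (hr1 : Summable fun i : ℕ => (r i).toReal * (i : ℝ)) :
    ∫⁻ i, (i : ℝ≥0∞) ∂r.toMeasure = ENNReal.ofReal (batchMoment r 1) := by
  have h := lintegral_ofReal_pmf (r := r) (a := fun i => (i : ℝ)) (fun i => by positivity) hr1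
  simpa [batchMoment] using h

lemma batchMoment_one_pos (hr : r 0 = 0) (hr1 : Summable fun i : ℕ => (r i).toReal * (i : ℝ)) :
    0 < batchMoment r 1 := by
  have h : (1 : ℝ≥0∞) ≤ ∫⁻ i, (i : ℝ≥0∞) ∂r.toMeasure := by
    have h0 : r.toMeasure {0} = 0 := by
      rw [r.toMeasure_apply_singleton 0 (MeasurableSet.singleton 0), hr]
    rw [measure_eq_zero_iff_ae_notMem] at h0
    calc (1 : ℝ≥0∞) = ∫⁻ _, 1 ∂r.toMeasure := by simp
      _ ≤ _ := by
        refine lintegral_mono_ae ?_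
        filter_upwards [h0] with i hi
        exact_mod_cast Nat.one_le_iff_ne_zero.2 (by simpa using hi)
  rw [lintegral_natCast_pmf hr1] at h
  exact ENNReal.ofReal_pos.1 (lt_of_lt_of_le one_pos h)

lemma two_mul_sum_range_cast (n : ℕ) :
    2 * ∑ i ∈ Finset.range n, (i : ℝ) = (n : ℝ) ^ 2 - n := by
  induction n with
  | zero => simp
  | succ n ih =>
    rw [Finset.sum_range_succ, mul_add, ih]
    push_cast
    ring

lemma two_mul_lintegral_sum_range_pmf (hr1 : Summable fun i : ℕ => (r i).toReal * (i : ℝ))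
    (hr2 : Summable fun i : ℕ => (r i).toReal * (i : ℝ) ^ 2) :
    2 * ∫⁻ j, ∑ i ∈ Finset.range j, (i : ℝ≥0∞) ∂r.toMeasure =
      ENNReal.ofReal (batchMoment r 2 - batchMoment r 1) := by
  have h1 : ∀ j : ℕ, 2 * ∑ i ∈ Finset.range j, (i : ℝ≥0∞) =
      ENNReal.ofReal ((j : ℝ) ^ 2 - j) := by
    intro j
    rw [← two_mul_sum_range_cast, ENNReal.ofReal_mul zero_le_two,
      ENNReal.ofReal_sum_of_nonneg fun i _ => by positivity]
    simp
  have hs : Summable fun i : ℕ => (r i).toReal * ((i : ℝ) ^ 2 - i) := by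
    simpa only [mul_sub] using hr2.sub hr1
  rw [← lintegral_const_mul _ Measurable.of_discrete]
  simp_rw [h1]
  rw [lintegral_ofReal_pmf (fun i => ?_) hs]
  · congr 1
    simp_rw [mul_sub]
    rw [hr2.tsum_sub hr1]
    simp [batchMoment]
  · rw [← two_mul_sum_range_cast]
    positivity

variable (hB : ∀ᵐ x ∂B, 0 ≤ x) (hI : Integrable (fun x : ℝ => x) B)
include hB hI

lemma lintegral_ofReal_const_mul {c : ℝ} (hc : 0 ≤ c) :
    ∫⁻ x, ENNReal.ofReal (c * x) ∂B = ENNReal.ofReal (c * ∫ x, x ∂B) := by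
  rw [← integral_const_mul, ofReal_integral_eq_lintegral_ofReal (hI.const_mul c)]
  filter_upwards [hB] with x hx
  exact mul_nonneg hc hx

lemma lintegral_ofReal_id : ∫⁻ x, ENNReal.ofReal x ∂B = ENNReal.ofReal (∫ x, x ∂B) := by
  simpa using lintegral_ofReal_const_mul hB hI zero_le_one

lemma lintegral_natCast_inputLaw_pmf [IsProbabilityMeasure B] (hlam : 0 < lam)
    (hr1 : Summable fun i : ℕ => (r i).toReal * (i : ℝ)) :
    ∫⁻ j, (j : ℝ≥0∞) ∂(inputLaw lam r.toMeasure B) = ENNReal.ofReal (load lam r B) := by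
  have hb : 0 ≤ ∫ x, x ∂B := integral_nonneg_of_ae hB
  rw [lintegral_natCast_inputLaw hlam hB, lintegral_ofReal_const_mul hB hI hlam.le,
    lintegral_natCast_pmf hr1, ← ENNReal.ofReal_mul (by positivity), load]
  congr 1
  ring

end Parameters

/-! ### The limiting probabilities in closed form -/

section Stationary

variable {lam : ℝ} {r : PMF ℕ} {B₁ B₂ : Measure ℝ} [IsProbabilityMeasure B₁]
  [IsProbabilityMeasure B₂]

/-- `V` and `W` stand for the expected numbers of services of the two types in a busy period. The
drift balance `hVW` eliminates `W`: the new denominator is `E * (1 - ρ₂)` times the old one, with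
`ρ₂ = lam * E * b₂`. -/
lemma stationary_formula {lam E b₁ b₂ V W : ℝ} (hlam : 0 < lam) (hE : 0 < E) (hb₁ : 0 ≤ b₁)
    (hb₂ : 0 ≤ b₂) (hV : 0 ≤ V) (hW : 0 ≤ W) (hρ₂ : lam * E * b₂ < 1)
    (hVW : (1 - lam * E * b₂) * W = E - (1 - lam * E * b₁) * V) :
    1 / (1 + lam * (b₁ * V + b₂ * W)) =
        E * (1 - lam * E * b₂) / (E + (lam * E * b₁ - lam * E * b₂) * V) ∧
      1 / (1 + lam * (b₁ * V + b₂ * W)) * (lam * (b₂ * W)) =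
        lam * E * b₂ * (E - (1 - lam * E * b₁) * V) /
          (E + (lam * E * b₁ - lam * E * b₂) * V) := by
  have h1 : 0 < 1 - lam * E * b₂ := by linarith
  have h2 : 0 < 1 + lam * (b₁ * V + b₂ * W) := by positivity
  have h3 : E + (lam * E * b₁ - lam * E * b₂) * V =
      E * (1 - lam * E * b₂) * (1 + lam * (b₁ * V + b₂ * W)) := by
    linear_combination (-(lam * E * b₂)) * hVW
  rw [h3, ← hVW]
  generalize 1 - lam * E * b₂ = d at h1
  constructor <;> field_simp

/-- The limiting probabilities in terms of the expected number of services of type 1 in a busy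
period. -/
theorem tendsto_prob (hlam : 0 < lam) (hr : r 0 = 0)
    (hr1 : Summable fun i : ℕ => (r i).toReal * (i : ℝ)) (hB₁ : ∀ᵐ x ∂B₁, 0 ≤ x)
    (hB₂ : ∀ᵐ x ∂B₂, 0 ≤ x) (hI₁ : Integrable (fun x : ℝ => x) B₁)
    (hI₂ : Integrable (fun x : ℝ => x) B₂) (hρ₂ : load lam r B₂ < 1) (L : ℕ) {V : ℝ}
    (hV : V = lowVisits (inputLaw lam r.toMeasure B₁) (inputLaw lam r.toMeasure B₂) r.toMeasure L) :
    Tendsto (probEmpty lam r B₁ B₂ L) atTop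
        (𝓝 (batchMoment r 1 * (1 - load lam r B₂) /
          (batchMoment r 1 + (load lam r B₁ - load lam r B₂) * V))) ∧
      Tendsto (probType2 lam r B₁ B₂ L) atTop
        (𝓝 (load lam r B₂ * (batchMoment r 1 - (1 - load lam r B₁) * V) /
          (batchMoment r 1 + (load lam r B₁ - load lam r B₂) * V))) := by
  have := isProbabilityMeasure_inputLaw (r := r.toMeasure) hlam hB₁
  have := isProbabilityMeasure_inputLaw (r := r.toMeasure) hlam hB₂
  set p₁ := inputLaw lam r.toMeasure B₁ with hp₁
  set p₂ := inputLaw lam r.toMeasure B₂ with hp₂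
  have hEpos := batchMoment_one_pos hr hr1
  have hm₁' : ∫⁻ j, (j : ℝ≥0∞) ∂p₁ = ENNReal.ofReal (load lam r B₁) :=
    lintegral_natCast_inputLaw_pmf hB₁ hI₁ hlam hr1
  have hm₂' : ∫⁻ j, (j : ℝ≥0∞) ∂p₂ = ENNReal.ofReal (load lam r B₂) :=
    lintegral_natCast_inputLaw_pmf hB₂ hI₂ hlam hr1
  have hm₁ : ∫⁻ j, (j : ℝ≥0∞) ∂p₁ ≠ ⊤ := hm₁' ▸ ENNReal.ofReal_ne_top
  have hm₂ : ∫⁻ j, (j : ℝ≥0∞) ∂p₂ < 1 := hm₂' ▸ ENNReal.ofReal_lt_one.2 hρ₂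
  have hE' := lintegral_natCast_pmf hr1
  have hE : ∫⁻ j, (j : ℝ≥0∞) ∂r.toMeasure ≠ ⊤ := hE' ▸ ENNReal.ofReal_ne_top
  have hb₁ := integral_nonneg_of_ae hB₁
  have hb₂ := integral_nonneg_of_ae hB₂
  have hb₁' := lintegral_ofReal_id hB₁ hI₁
  have hb₂' := lintegral_ofReal_id hB₂ hI₂
  have h0 : p₁ {0} ≠ 0 := inputLaw_zero_ne_zero
  have hb₁t : ∫⁻ x, ENNReal.ofReal x ∂B₁ ≠ ⊤ := hb₁' ▸ ENNReal.ofReal_ne_top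
  have hb₂t : ∫⁻ x, ENNReal.ofReal x ∂B₂ ≠ ⊤ := hb₂' ▸ ENNReal.ofReal_ne_top
  have hload : ∀ B, load lam r B = lam * batchMoment r 1 * ∫ x, x ∂B := fun B => rfl
  have hload₁ : 0 ≤ load lam r B₁ := by
    rw [hload]
    exact mul_nonneg (by positivity) hb₁
  have hload₂ : 0 ≤ load lam r B₂ := by
    rw [hload]
    exact mul_nonneg (by positivity) hb₂
  set W := (∫⁻ j, cost p₁ p₂ 0 1 L j ∂r.toMeasure).toReal with hW
  have hVW := toReal_lintegral_highCost h0 hm₁ hm₂ hE L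
  rw [hm₁', hm₂', hE', ENNReal.toReal_ofReal hload₁, ENNReal.toReal_ofReal hload₂,
    ENNReal.toReal_ofReal hEpos.le, ← hW, ← hV] at hVW
  have hV' := toReal_lintegral_lowCost (q := r.toMeasure) h0 hm₁ hm₂ L
  rw [← hV] at hV'
  have hcost : ∀ a b : ℝ, 0 ≤ a → 0 ≤ b → (ENNReal.ofReal lam *
      ∫⁻ i, cost p₁ p₂ (ENNReal.ofReal a) (ENNReal.ofReal b) L i ∂r.toMeasure).toReal =
        lam * (a * V + b * W) := by
    intro a b ha hb
    have h1 : ∫⁻ j, cost p₁ p₂ 1 0 L j ∂r.toMeasure ≠ ⊤ :=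
      lintegral_cost_ne_top h0 hm₁ hm₂ hE (by simp) (by simp) L
    have h2 : ∫⁻ j, cost p₁ p₂ 0 1 L j ∂r.toMeasure ≠ ⊤ :=
      lintegral_cost_ne_top h0 hm₁ hm₂ hE (by simp) (by simp) L
    simp_rw [cost_linear (α := ENNReal.ofReal a) (β := ENNReal.ofReal b)]
    rw [lintegral_add_left Measurable.of_discrete, lintegral_const_mul _ Measurable.of_discrete,
      lintegral_const_mul _ Measurable.of_discrete, ENNReal.toReal_mul,
      ENNReal.toReal_add (ENNReal.mul_ne_top ENNReal.ofReal_ne_top h1)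
        (ENNReal.mul_ne_top ENNReal.ofReal_ne_top h2), ENNReal.toReal_mul, ENNReal.toReal_mul,
      ENNReal.toReal_ofReal hlam.le, ENNReal.toReal_ofReal ha, ENNReal.toReal_ofReal hb, hV']
  have hform := stationary_formula (V := V) (W := W) hlam hEpos hb₁ hb₂
    (hV ▸ lowVisits_nonneg _ _ _ _) ENNReal.toReal_nonneg hρ₂ hVW
  have t1 := tendsto_probEmpty (L := L) hlam hr hB₁ hB₂ hE hb₁t hb₂t hm₁ hm₂
  have t2 := tendsto_probType2 (L := L) hlam hr hB₁ hB₂ hE hb₁t hb₂t hm₁ hm₂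
  have hc1 := hcost _ _ hb₁ hb₂
  have hc2 := hcost 0 _ le_rfl hb₂
  rw [ENNReal.ofReal_zero, zero_mul, zero_add] at hc2
  rw [hb₁', hb₂', hc1, hform.1] at t1
  rw [hb₁', hb₂', hc1, hc2, hform.2] at t2
  exact ⟨t1, t2⟩

end Stationary

/-! ### The critical second moment and the root of the supercritical equation -/

section Roots

variable {lam : ℝ} {r : PMF ℕ} {B : Measure ℝ}

/-- Otherwise `p` would live on `{0, 1}`, and mean one would force `p {0} = 0`. -/
lemma toReal_lintegral_sum_range_pos {p : Measure ℕ} [IsProbabilityMeasure p] (h0 : p {0} ≠ 0)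
    (hρ : (∫⁻ j, (j : ℝ≥0∞) ∂p).toReal = 1)
    (h : ∫⁻ j, ∑ i ∈ Finset.range j, (i : ℝ≥0∞) ∂p ≠ ⊤) :
    0 < (∫⁻ j, ∑ i ∈ Finset.range j, (i : ℝ≥0∞) ∂p).toReal := by
  refine ENNReal.toReal_pos (fun hz => ?_) h
  rw [← tsum_tsum_tail, ENNReal.tsum_eq_zero] at hz
  have hz' : ∀ i, i ≠ 0 → p.real (Set.Ioi i) = 0 := by
    intro i hi
    obtain ⟨n, rfl⟩ := Nat.exists_eq_succ_of_ne_zero hi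
    have h1 := ENNReal.tsum_eq_zero.1 (hz n) 0
    rw [zero_add] at h1
    simp [Measure.real, h1]
  rw [← tsum_tail, tsum_eq_single 0 hz'] at hρ
  exact (real_Ioi_zero_lt_one h0).ne hρ

/-- Let `b` be the mean of `B`. Twice the moment is `lam * b` times the second factorial moment of
the batch size, plus the second moment of `lam * x` times the squared mean batch size; criticality
makes `lam * b` the inverse of the mean batch size. -/
lemma toReal_lintegral_sum_range_inputLaw [IsProbabilityMeasure B] (hlam : 0 < lam) (hr : r 0 = 0)
    (hB : ∀ᵐ x ∂B, 0 ≤ x) (hI : Integrable (fun x : ℝ => x) B)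
    (hr1 : Summable fun i : ℕ => (r i).toReal * (i : ℝ))
    (hI2 : Integrable (fun x : ℝ => (lam * x) ^ 2) B)
    (hr2 : Summable fun i : ℕ => (r i).toReal * (i : ℝ) ^ 2) (hρ : load lam r B = 1) :
    ∫⁻ j, ∑ i ∈ Finset.range j, (i : ℝ≥0∞) ∂(inputLaw lam r.toMeasure B) ≠ ⊤ ∧
      (∫⁻ j, ∑ i ∈ Finset.range j, (i : ℝ≥0∞) ∂(inputLaw lam r.toMeasure B)).toReal =
        ((∫ x, (lam * x) ^ 2 ∂B) * batchMoment r 1 ^ 3 + batchMoment r 2 - batchMoment r 1) /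
          (2 * batchMoment r 1) := by
  have hE := batchMoment_one_pos hr hr1
  have hb : 0 ≤ ∫ x, x ∂B := integral_nonneg_of_ae hB
  have h2 : ∫⁻ x, ENNReal.ofReal (lam * x) ^ 2 ∂B = ENNReal.ofReal (∫ x, (lam * x) ^ 2 ∂B) := by
    rw [ofReal_integral_eq_lintegral_ofReal hI2 (Eventually.of_forall fun x => sq_nonneg _)]
    refine lintegral_congr_ae ?_
    filter_upwards [hB] with x hx
    rw [ENNReal.ofReal_pow (by positivity)]
  have hmom : 0 ≤ batchMoment r 2 - batchMoment r 1 := by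
    have hs := hr2.tsum_sub hr1
    have : batchMoment r 2 - batchMoment r 1 =
        ∑' i : ℕ, ((r i).toReal * (i : ℝ) ^ 2 - (r i).toReal * i) := by
      rw [hs]
      simp [batchMoment]
    rw [this]
    refine tsum_nonneg fun i => ?_
    rw [← mul_sub, ← two_mul_sum_range_cast]
    exact mul_nonneg ENNReal.toReal_nonneg (by positivity)
  have hsq : 0 ≤ ∫ x, (lam * x) ^ 2 ∂B := integral_nonneg fun x => sq_nonneg _
  have h := two_mul_lintegral_sum_range_inputLaw (r := r.toMeasure) hlam hB
  rw [two_mul_lintegral_sum_range_pmf hr1 hr2, lintegral_ofReal_const_mul hB hI hlam.le,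
    lintegral_natCast_pmf hr1, h2, ← ENNReal.ofReal_pow hE.le, ← ENNReal.ofReal_mul (by positivity),
    ← ENNReal.ofReal_mul hsq, ← ENNReal.ofReal_add (by positivity) (by positivity)] at h
  have htop : ∫⁻ j, ∑ i ∈ Finset.range j, (i : ℝ≥0∞) ∂(inputLaw lam r.toMeasure B) ≠ ⊤ := by
    intro ht
    rw [ht, ENNReal.mul_top two_ne_zero] at h
    exact ENNReal.ofReal_ne_top h.symm
  refine ⟨htop, ?_⟩
  have h' := congrArg ENNReal.toReal h
  rw [ENNReal.toReal_mul, ENNReal.toReal_ofReal (by positivity), ENNReal.toReal_ofNat] at h'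
  have hlb : lam * ∫ x, x ∂B = 1 / batchMoment r 1 := by
    rw [eq_div_iff hE.ne', ← hρ, load]
    ring
  rw [hlb] at h'
  rw [eq_div_iff (by positivity)]
  have h'' : (2 * (∫⁻ j, ∑ i ∈ Finset.range j, (i : ℝ≥0∞)
      ∂(inputLaw lam r.toMeasure B)).toReal) * batchMoment r 1 = _ :=
    congrArg (· * batchMoment r 1) h'
  rw [show ∀ a b : ℝ, a * (2 * b) = 2 * a * b from fun a b => by ring, h'']
  field_simp
  ring

lemma integral_pow_eq_tsum {p : Measure ℕ} [IsProbabilityMeasure p] {z : ℂ} (hz : ‖z‖ ≤ 1) :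
    ∫ j, z ^ j ∂p = ∑' j, (p.real {j} : ℂ) * z ^ j := by
  have hi : Integrable (fun j : ℕ => z ^ j) p := by
    refine Integrable.of_bound Measurable.of_discrete.aestronglyMeasurable 1
      (Eventually.of_forall fun j => ?_)
    rw [norm_pow]
    exact pow_le_one₀ (norm_nonneg _) hz
  rw [integral_countable hi]
  simp

/-- Translates the transform equation for `φ` into the fixed-point equation for the generating
function of `inputLaw`. -/
lemma lstC_pgfC_eq_tsum [IsProbabilityMeasure B] (hlam : 0 < lam) (hB : ∀ᵐ x ∂B, 0 ≤ x) {z : ℂ}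
    (hz : ‖z‖ ≤ 1) : lstC B (lam - lam * pgfC r z) =
      ∑' j, ((inputLaw lam r.toMeasure B).real {j} : ℂ) * z ^ j := by
  have := isProbabilityMeasure_inputLaw (r := r.toMeasure) hlam hB
  rw [← integral_pow_eq_tsum hz, integral_pow_inputLaw hlam hB hz, integral_pow_eq_tsum hz]
  simp only [toMeasure_real_singleton]
  rfl

lemma lst_pgf_eq_tsum [IsProbabilityMeasure B] (hlam : 0 < lam) (hB : ∀ᵐ x ∂B, 0 ≤ x) {x : ℝ}
    (hx : |x| ≤ 1) : lst B (lam - lam * pgf r x) =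
      ∑' j, (inputLaw lam r.toMeasure B).real {j} * x ^ j := by
  have h := lstC_pgfC_eq_tsum (r := r) hlam hB (z := (x : ℂ)) (by simpa using hx)
  have h1 : pgfC r (x : ℂ) = ((pgf r x : ℝ) : ℂ) := by
    unfold pgfC pgf
    push_cast
    rfl
  have h2 : ∀ s : ℝ, lstC B (s : ℂ) = ((lst B s : ℝ) : ℂ) := by
    intro s
    unfold lstC lst
    rw [← integral_complex_ofReal]
    push_cast
    rfl
  rw [h1] at h
  have h3 : (lam : ℂ) - lam * (pgf r x : ℂ) = ((lam - lam * pgf r x : ℝ) : ℂ) := by push_cast; rfl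
  rw [h3, h2] at h
  have h4 : ∑' j, ((inputLaw lam r.toMeasure B).real {j} : ℂ) * (x : ℂ) ^ j =
      ((∑' j, (inputLaw lam r.toMeasure B).real {j} * x ^ j : ℝ) : ℂ) := by
    push_cast
    rfl
  rw [h4] at h
  exact_mod_cast h

/-- Without an atom at `0`, every term of positive weight has `x ^ i ≤ x`. -/
lemma pgf_lt_one (hr : r 0 = 0) {x : ℝ} (hx0 : 0 ≤ x) (hx1 : x < 1) : pgf r x < 1 := by
  have hs : HasSum (fun i => (r i).toReal) 1 := by
    simpa only [toMeasure_real_singleton] using hasSum_real_singleton r.toMeasure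
  have hs' : Summable fun i => (r i).toReal * x ^ i :=
    Summable.of_nonneg_of_le (fun i => by positivity)
      (fun i => mul_le_of_le_one_right ENNReal.toReal_nonneg (pow_le_one₀ hx0 hx1.le)) hs.summable
  have hsx := hs.mul_right x
  rw [one_mul] at hsx
  refine lt_of_le_of_lt (hasSum_le (fun i => ?_) hs'.hasSum hsx) hx1
  rcases Nat.eq_zero_or_pos i with rfl | hi
  · simp [hr]
  · exact mul_le_mul_of_nonneg_left (pow_le_of_le_one hx0 hx1.le hi.ne') ENNReal.toReal_nonneg

/-- Up to the sign of the argument this is the moment generating function of a nonnegative variable,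
which is finite on the negative half-line and differentiable inside it. -/
lemma differentiableAt_lst [IsProbabilityMeasure B] (hB : ∀ᵐ x ∂B, 0 ≤ x) {s : ℝ} (hs : 0 < s) :
    DifferentiableAt ℝ (lst B) s := by
  have hsub : Set.Iio (0 : ℝ) ⊆ integrableExpSet id B := by
    intro t ht
    refine Integrable.of_bound (by fun_prop) 1 ?_
    filter_upwards [hB] with x hx
    rw [Real.norm_of_nonneg (Real.exp_pos _).le, Real.exp_le_one_iff]
    exact mul_nonpos_of_nonpos_of_nonneg (le_of_lt ht) hx
  have hmem : -s ∈ interior (integrableExpSet id B) :=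
    interior_maximal hsub isOpen_Iio (neg_lt_zero.2 hs)
  have h : lst B = fun s => mgf id B (-s) := rfl
  rw [h]
  exact (hasDerivAt_mgf hmem).differentiableAt.comp s differentiableAt_id.neg

/-- Near `x` the generating function of `inputLaw` is `lst B (lam - lam * pgf r y)`; termwise
differentiation and the chain rule compute the same derivative. The transform is differentiated at a
positive argument because `pgf r x < 1`. -/
lemma tsum_deriv_root [IsProbabilityMeasure B] (hlam : 0 < lam) (hr : r 0 = 0)
    (hr1 : Summable fun i : ℕ => (r i).toReal * (i : ℝ)) (hB : ∀ᵐ x ∂B, 0 ≤ x)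
    (hm : ∫⁻ j, (j : ℝ≥0∞) ∂(inputLaw lam r.toMeasure B) ≠ ⊤) {x : ℝ} (hx0 : 0 < x) (hx1 : x < 1) :
    ∑' j, (inputLaw lam r.toMeasure B).real {j} * (j * x ^ (j - 1)) =
      -(lam * deriv (lst B) (lam - lam * pgf r x) * deriv (pgf r) x) := by
  have := isProbabilityMeasure_inputLaw (r := r.toMeasure) hlam hB
  have hxa : |x| < 1 := by rwa [abs_of_pos hx0]
  have hs1 : Summable fun j : ℕ => (inputLaw lam r.toMeasure B).real {j} * j := by
    rw [lintegral_countable'] at hm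
    simpa [ENNReal.toReal_mul, Measure.real, mul_comm] using ENNReal.summable_toReal hm
  have h1 := hasDerivAt_tsum_pow (fun j => measureReal_nonneg)
    (hasSum_real_singleton (inputLaw lam r.toMeasure B)).summable hs1 hxa
  have hpgf : HasDerivAt (pgf r) (deriv (pgf r) x) x := by
    refine DifferentiableAt.hasDerivAt ?_
    have hs : Summable fun i => (r i).toReal := by
      simpa only [toMeasure_real_singleton] using (hasSum_real_singleton r.toMeasure).summable
    exact (hasDerivAt_tsum_pow (fun j => ENNReal.toReal_nonneg) hs hr1 hxa).differentiableAt
  have hpos : 0 < lam - lam * pgf r x := by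
    have := mul_lt_mul_of_pos_left (pgf_lt_one hr hx0.le hx1) hlam
    linarith
  have h2 : HasDerivAt (fun y => lst B (lam - lam * pgf r y))
      (deriv (lst B) (lam - lam * pgf r x) * (-(lam * deriv (pgf r) x))) x :=
    HasDerivAt.comp (h₂ := lst B) (h := fun y => lam - lam * pgf r y) x
      (differentiableAt_lst hB hpos).hasDerivAt ((hpgf.const_mul lam).const_sub lam)
  have h3 : (fun y => lst B (lam - lam * pgf r y)) =ᶠ[𝓝 x]
      fun y => ∑' j, (inputLaw lam r.toMeasure B).real {j} * y ^ j := by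
    filter_upwards [Ioo_mem_nhds (abs_lt.1 hxa).1 (abs_lt.1 hxa).2] with y hy
    exact lst_pgf_eq_tsum hlam hB (abs_le.2 ⟨hy.1.le, hy.2.le⟩)
  rw [h1.unique (h2.congr_of_eventuallyEq h3.symm)]
  ring

end Roots

end Dam

end

/-! ### Assembly of the three regimes -/

theorem theoremM (lam : ℝ) (hlam : 0 < lam)
    (r : PMF ℕ) (hr : r 0 = 0) (hr1 : Summable fun i : ℕ => (r i).toReal * (i : ℝ))
    (B₁ B₂ : Measure ℝ) [IsProbabilityMeasure B₁] [IsProbabilityMeasure B₂]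
    (hB₁ : ∀ᵐ x ∂B₁, 0 ≤ x) (hB₂ : ∀ᵐ x ∂B₂, 0 ≤ x)
    (hI₁ : Integrable (fun x : ℝ => x) B₁) (hI₂ : Integrable (fun x : ℝ => x) B₂)
    (ρ₁ ρ₂ Eς : ℝ) (hρ₁ : ρ₁ = Dam.load lam r B₁) (hρ₂ : ρ₂ = Dam.load lam r B₂)
    (hEς : Eς = Dam.batchMoment r 1) (hρ₂1 : ρ₂ < 1) :
    ∃ p₁ p₂ : ℕ → ℝ,
      (∀ L, Tendsto (Dam.probEmpty lam r B₁ B₂ L) atTop (𝓝 (p₁ L))) ∧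
      (∀ L, Tendsto (Dam.probType2 lam r B₁ B₂ L) atTop (𝓝 (p₂ L))) ∧
      (ρ₁ < 1 →
        Tendsto p₁ atTop (𝓝 (1 - ρ₁)) ∧ Tendsto p₂ atTop (𝓝 0)) ∧
      (ρ₁ = 1 →
        ∀ ρ₁₂ Eς2 : ℝ, ρ₁₂ = ∫ x, (lam * x) ^ 2 ∂B₁ → Eς2 = Dam.batchMoment r 2 →
        Integrable (fun x : ℝ => (lam * x) ^ 2) B₁ →
        Summable (fun i : ℕ => (r i).toReal * (i : ℝ) ^ 2) →
          Tendsto (fun L : ℕ => (L : ℝ) * p₁ L) atTop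
            (𝓝 ((ρ₁₂ * Eς ^ 3 + Eς2 - Eς) / (2 * Eς))) ∧
          Tendsto (fun L : ℕ => (L : ℝ) * p₂ L) atTop
            (𝓝 (ρ₂ / (1 - ρ₂) * ((ρ₁₂ * Eς ^ 3 + Eς2 - Eς) / (2 * Eς))))) ∧
      (1 < ρ₁ →
        (∃ φ : ℝ,
          Dam.IsLeastRoot (fun z => Dam.lstC B₁ (lam - lam * Dam.pgfC r z)) φ ∧
          Tendsto (fun L : ℕ => p₁ L / φ ^ L) atTop
            (𝓝 ((1 - ρ₂) *
                (1 + lam * deriv (Dam.lst B₁) (lam - lam * Dam.pgf r φ) * deriv (Dam.pgf r) φ) *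
                (1 - φ) * Eς /
              ((ρ₁ - ρ₂) * (1 - Dam.pgf r φ))))) ∧
        Tendsto p₂ atTop (𝓝 (ρ₂ * (ρ₁ - 1) / (ρ₁ - ρ₂)))) := by
  have := Dam.isProbabilityMeasure_inputLaw (r := r.toMeasure) hlam hB₁
  have := Dam.isProbabilityMeasure_inputLaw (r := r.toMeasure) hlam hB₂
  set p := Dam.inputLaw lam r.toMeasure B₁ with hp
  set p' := Dam.inputLaw lam r.toMeasure B₂ with hp'
  set V := Dam.lowVisits p p' r.toMeasure with hV
  have hE : 0 < Eς := hEς ▸ Dam.batchMoment_one_pos hr hr1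
  have hρ₁0 : 0 ≤ ρ₁ := by
    rw [hρ₁, Dam.load, ← hEς]
    exact mul_nonneg (by positivity) (integral_nonneg_of_ae hB₁)
  have hm₁' : ∫⁻ j, (j : ℝ≥0∞) ∂p = ENNReal.ofReal ρ₁ :=
    hρ₁ ▸ Dam.lintegral_natCast_inputLaw_pmf hB₁ hI₁ hlam hr1
  have hm₂' : ∫⁻ j, (j : ℝ≥0∞) ∂p' = ENNReal.ofReal ρ₂ :=
    hρ₂ ▸ Dam.lintegral_natCast_inputLaw_pmf hB₂ hI₂ hlam hr1
  have hq' : ∫⁻ j, (j : ℝ≥0∞) ∂r.toMeasure = ENNReal.ofReal Eς :=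
    hEς ▸ Dam.lintegral_natCast_pmf hr1
  have hm₁ : ∫⁻ j, (j : ℝ≥0∞) ∂p ≠ ⊤ := hm₁' ▸ ENNReal.ofReal_ne_top
  have hm₂ : ∫⁻ j, (j : ℝ≥0∞) ∂p' < 1 := hm₂' ▸ ENNReal.ofReal_lt_one.2 hρ₂1
  have hq : ∫⁻ j, (j : ℝ≥0∞) ∂r.toMeasure ≠ ⊤ := hq' ▸ ENNReal.ofReal_ne_top
  have hm₁r : (∫⁻ j, (j : ℝ≥0∞) ∂p).toReal = ρ₁ := by rw [hm₁', ENNReal.toReal_ofReal hρ₁0]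
  have hqr : (∫⁻ j, (j : ℝ≥0∞) ∂r.toMeasure).toReal = Eς := by
    rw [hq', ENNReal.toReal_ofReal hE.le]
  have h0 : p {0} ≠ 0 := Dam.inputLaw_zero_ne_zero
  have hlim := fun L => Dam.tendsto_prob hlam hr hr1 hB₁ hB₂ hI₁ hI₂ (hρ₂ ▸ hρ₂1) L
    (V := V L) rfl
  rw [← hρ₁, ← hρ₂, ← hEς] at hlim
  -- The limits in `t` for fixed `L`, written through the single quantity `V L`.
  refine ⟨fun L => Eς * (1 - ρ₂) / (Eς + (ρ₁ - ρ₂) * V L),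
    fun L => ρ₂ * (Eς - (1 - ρ₁) * V L) / (Eς + (ρ₁ - ρ₂) * V L), fun L => (hlim L).1,
    fun L => (hlim L).2, fun h => ?_, fun h ρ₁₂ Eς2 hρ₁₂ hEς2 hI2 hr2 => ?_, fun h => ?_⟩
  · have hVlim := Dam.lowVisits_tendsto_subcritical h0 hm₁ hm₂ hq (hm₁r.trans_lt h)
    rw [hm₁r, hqr] at hVlim
    exact Dam.stationary_subcritical hE h hρ₂1 hVlim
  · obtain ⟨htop, hμ⟩ := Dam.toReal_lintegral_sum_range_inputLaw hlam hr hB₁ hI₁ hr1 hI2 hr2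
      (hρ₁ ▸ h)
    rw [← hρ₁₂, ← hEς2, ← hEς] at hμ
    have hμ0 := Dam.toReal_lintegral_sum_range_pos h0 (hm₁r.trans h) htop
    have hVlim := Dam.lowVisits_tendsto_critical h0 hm₁ hm₂ hq (hm₁r.trans h)
      (Dam.hasSum_tsum_tail hm₁ htop)
    rw [hqr] at hVlim
    rw [← hμ, h]
    exact Dam.stationary_critical hE hρ₂1 hμ0 hVlim
  · have h1 : 1 < (∫⁻ j, (j : ℝ≥0∞) ∂p).toReal := hm₁r.symm ▸ h
    have hp1 : p (Set.Ioi 1) ≠ 0 := Dam.real_Ioi_one_ne_zero h1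
    obtain ⟨φ, hφ0, hφ1, hφ⟩ := Dam.exists_tail_root hm₁ h0 h1
    have hVlim := Dam.lowVisits_tendsto_supercritical h0 hm₁ hm₂ hq hp1 hφ0 hφ1 hφ
    have hD := Dam.tsum_deriv_root hlam hr hr1 hB₁ hm₁ hφ0 hφ1
    -- The derivative at the root is the mean of the tilted law, hence below one; this makes the
    -- limit of `φ ^ L * V L` positive.
    have hD1 : ∑' j, p.real {j} * (j * φ ^ (j - 1)) < 1 := by
      rw [← Dam.toReal_lintegral_tilt hφ0]
      have := ENNReal.toReal_strict_mono ENNReal.one_ne_top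
        (Dam.lintegral_tilt_lt_one hm₁ hφ0 hφ1 hφ hp1)
      simpa using this
    have hpgf : ∑' j, r.toMeasure.real {j} * φ ^ j = Dam.pgf r φ := by
      simp only [Dam.toMeasure_real_singleton]
      rfl
    have hpgf1 : Dam.pgf r φ < 1 := Dam.pgf_lt_one hr hφ0.le hφ1
    rw [hpgf, hD] at hVlim
    rw [hD] at hD1
    set d := lam * deriv (Dam.lst B₁) (lam - lam * Dam.pgf r φ) * deriv (Dam.pgf r) φ with hd
    have hd1 : 0 < 1 + d := by linarith
    have hφn : ‖(φ : ℂ)‖ = φ := by rw [Complex.norm_real, Real.norm_of_nonneg hφ0.le]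
    have hst := Dam.stationary_supercritical (E := Eς) h hρ₂1 hφ0 hφ1
      (mul_pos (one_div_pos.2 (by linarith)) (div_pos (by linarith) (by linarith))) hVlim
    refine ⟨⟨φ, ⟨⟨hφn.trans_le hφ1.le, ?_⟩, fun z hz hne => ?_⟩, ?_⟩, hst.2⟩
    · beta_reduce
      rw [Dam.lstC_pgfC_eq_tsum hlam hB₁ (hφn.trans_le hφ1.le)]
      have := congrArg (fun x : ℝ => (x : ℂ)) (Dam.tsum_mass_mul_pow_root hm₁ hφ0 hφ1 hφ)
      push_cast at this
      exact this.symm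
    · rw [hφn]
      refine Dam.lt_norm_of_root hm₁ hφ0 hφ1 hφ hp1 hz.1 ?_ hne
      rw [← Dam.lstC_pgfC_eq_tsum hlam hB₁ hz.1]
      exact hz.2
    · rw [← hd]
      clear_value d
      convert hst.1 using 2
      have e1 : 1 - φ ≠ 0 := by linarith
      have e2 : 1 - Dam.pgf r φ ≠ 0 := by linarith
      have e3 : ρ₁ - ρ₂ ≠ 0 := by linarith
      -- The derivative at the root is `-d` by `hD`, so `1 - (-d)` is the bracket `1 + d` of the
      -- claimed limit.
      rw [sub_neg_eq_add]
      field_simp
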